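/- Let $\mathfrak g$ be the complex simple Lie algebra of type $D_4$, realised as $\mathfrak{so}(8)$ on the space with basis $a_1,\dots,a_4,a_1^*,\dots,a_4^*$ (so that $\mathfrak h=\langle H_1,\dots,H_4\rangle$ with $H_i={:}a_ia_i^*{:}$ and dual basis $\varepsilon_1,\dots,\varepsilon_4$ of $\mathfrak h^*$), with positive roots $\varepsilon_i\pm\varepsilon_j$ $(i<j)$, root vectors $e_{\varepsilon_i-\varepsilon_j}={:}a_ia_j^*{:}$, $e_{\varepsilon_i+\varepsilon_j}={:}a_ia_j{:}$, $f_{\varepsilon_i-\varepsilon_j}={:}a_ja_i^*{:}$, $f_{\varepsilon_i+\varepsilon_j}={:}a_j^*a_i^*{:}$, simple coroots $h_1=H_1-H_2$, $h_2=H_2-H_3$, $h_3=H_3-H_4$, $h_4=H_3+H_4$, first fundamental weight $\omega_1=\varepsilon_1$, and invariant form $(\cdot|\cdot)$ normalised by $(\theta|\theta)=2$ for the highest root $\theta=\varepsilon_1+\varepsilon_2$. Let $\hat{\mathfrak g}=\mathfrak g\otimes\mathbb C[t,t^{-1}]\oplus\mathbb CK\oplus\mathbb Cd$ be the affine Kac–Moody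 algebra, with $x(n)=x\otimes t^n$, $K$ central, $[d,x(n)]=n\,x(n)$ and $[x(m),y(n)]=[x,y](m+n)+m\,\delta_{m+n,0}(x|y)K$; let $\hat{\mathfrak h}=\mathfrak h\oplus\mathbb CK\oplus\mathbb Cd$, let $\Lambda_0\in\hat{\mathfrak h}^*$ be $1$ on $K$ and $0$ on $\mathfrak h\oplus\mathbb Cd$, and let $\delta$ be $1$ on $d$ and $0$ on $\mathfrak h\oplus\mathbb CK$. Let $V^{-14/3}(\mathfrak g)$ be the universal affine vertex algebra at level $-14/3$: the $\hat{\mathfrak g}$-module induced from the one-dimensional module of $\mathfrak g\otimes\mathbb C[t]\oplus\mathbb CK\oplus\mathbb Cd$ on which $K$ acts as $-14/3$ and $\mathfrak g\otimes\mathbb C[t]$ and $d$ act as $0$, with vacuum vector $\mathbf 1$, and graded by conformal weight so that $x_1(-n_1)\cdots x_r(-n_r)\mathbf 1$ with all $n_i\ge 1$ has conformal weight $n_1+\cdots+n_r$. **Theorem.** There is a singular vector $v$ in $V^{-14/3}(\mathfrak g)$, that is, a non-zero vector with $x(0)v=0$ for all $x\in\mathfrak n_+$ (the sum of the positive root spaces)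 and $x(n)v=0$ for all $x\in\mathfrak g$, $n\ge1$, such that $v$ has $\hat{\mathfrak h}$-weight $-\frac{14}{3}\Lambda_0-6\delta+2\omega_1$ and conformal weight $6$. Moreover, for a suitable total order on the set of all $x(-n)$ with $n\ge1$ and $x$ in the basis $\{e_\alpha,f_\alpha,h_i\}$ of $\mathfrak g$ ($\alpha$ a positive root, $i=1,\dots,4$), exactly $6753$ monomials have a non-zero coefficient in the expansion of $v$ in the corresponding Poincaré–Birkhoff–Witt basis. -/

import Mathlib

open scoped TensorProduct

noncomputable section

attribute [local instance 100] LieRing.ofAssociativeRing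

namespace AffineD4

/-! ### The simple Lie algebra of type `D₄` -/

/-- The simple Lie algebra of type `D₄`: the complex `8 × 8` matrices that are skew-adjoint for the
split symmetric form with `(a_i, a_j^*) = δ_{ij}`. The basis vector `a_i` has index `Sum.inl i`, the
vector `a_i^*` has index `Sum.inr i`. -/
def D4 : Type := LieAlgebra.Orthogonal.typeD (Fin 4) ℂ

instance : LieRing D4 := inferInstanceAs (LieRing (LieAlgebra.Orthogonal.typeD (Fin 4) ℂ))

instance : LieAlgebra ℂ D4 :=
  inferInstanceAs (LieAlgebra ℂ (LieAlgebra.Orthogonal.typeD (Fin 4) ℂ))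

/-- The inclusion of `D₄` into the `8 × 8` matrices. -/
def toMatrix : D4 →ₗ⁅ℂ⁆ Matrix (Fin 4 ⊕ Fin 4) (Fin 4 ⊕ Fin 4) ℂ :=
  (LieAlgebra.Orthogonal.typeD (Fin 4) ℂ).incl

/-- The matrix `E_{p,q} - E_{q*,p*}`, where `*` exchanges the indices of `a_i` and `a_i^*`. It is
the action `[:u v:, -]` on the span of the `a_i, a_i^*` of the Clifford element `:u v:`, where `u`
is the basis vector with index `p` and `v` the one with index `q*`. -/
def elem (p q : Fin 4 ⊕ Fin 4) : D4 :=
  ⟨Matrix.single p q 1 - Matrix.single q.swap p.swap 1, by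
    rw [LieAlgebra.Orthogonal.typeD, mem_skewAdjointMatricesLieSubalgebra,
      mem_skewAdjointMatricesSubmodule]
    have hJ : LieAlgebra.Orthogonal.JD (Fin 4) ℂ =
        Matrix.of fun a b => if b = a.swap then 1 else 0 := by
      ext a b
      rcases a with a | a <;> rcases b with b | b <;>
        simp [LieAlgebra.Orthogonal.JD, Matrix.one_apply, eq_comm]
    ext a b
    simp only [hJ, Matrix.mul_apply, Matrix.single_apply, Matrix.transpose_apply, Matrix.sub_apply,
      Matrix.neg_apply, Matrix.of_apply]
    simp only [mul_ite, ite_mul, mul_one, mul_zero, one_mul, zero_mul]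
    have h2 : ∀ x y : Fin 4 ⊕ Fin 4, y = x.swap ↔ x = y.swap := by decide
    simp only [h2 _ b]
    have h3 : ∀ x y : Fin 4 ⊕ Fin 4, x.swap = y ↔ x = y.swap := by decide
    simp [h3, and_comm]⟩

theorem toMatrix_elem (p q : Fin 4 ⊕ Fin 4) :
    toMatrix (elem p q) = Matrix.single p q 1 - Matrix.single q.swap p.swap 1 := rfl

/-- `H_i = :a_i a_i^*:`. -/
def H (i : Fin 4) : D4 := elem (.inl i) (.inl i)

/-- The positive roots `ε_i - ε_j` (flag `false`) and `ε_i + ε_j` (flag `true`), for `i < j`. -/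
abbrev PosRoot : Type := {p : Fin 4 × Fin 4 // p.1 < p.2} × Bool

/-- `e_{ε_i - ε_j} = :a_i a_j^*:` and `e_{ε_i + ε_j} = :a_i a_j:`. -/
def e : PosRoot → D4
  | (⟨(i, j), _⟩, false) => elem (.inl i) (.inl j)
  | (⟨(i, j), _⟩, true) => elem (.inl i) (.inr j)

/-- `f_{ε_i - ε_j} = :a_j a_i^*:` and `f_{ε_i + ε_j} = :a_j^* a_i^*:`. -/
def f : PosRoot → D4
  | (⟨(i, j), _⟩, false) => elem (.inl j) (.inl i)
  | (⟨(i, j), _⟩, true) => elem (.inr j) (.inl i)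

/-- The simple coroots for `α_i = ε_i - ε_{i+1}` (`i = 1, 2, 3`) and `α_4 = ε_3 + ε_4`. -/
def coroot : Fin 4 → D4 :=
  ![H 0 - H 1, H 1 - H 2, H 2 - H 3, H 2 + H 3]

/-- The Cartan subalgebra. -/
def cartan : Submodule ℂ D4 := Submodule.span ℂ (Set.range H)

/-- The sum `𝔫₊` of the positive root spaces. -/
def nPos : Submodule ℂ D4 := Submodule.span ℂ (Set.range e)

/-- The invariant form `(x | y) = ½ tr (x y)`. It makes the `H_i` orthonormal, so that every root,
in particular the highest root `θ = ε_1 + ε_2`, has square length `2`. -/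
def form : LinearMap.BilinForm ℂ D4 :=
  LinearMap.mk₂ ℂ (fun x y => (1 / 2 : ℂ) * Matrix.trace (toMatrix x * toMatrix y))
    (by intro x y z; simp [add_mul, mul_add])
    (by intro c x y; simp; ring)
    (by intro x y z; simp [mul_add])
    (by intro c x y; simp; ring)

theorem form_apply (x y : D4) :
    form x y = (1 / 2 : ℂ) * Matrix.trace (toMatrix x * toMatrix y) := rfl

theorem form_comm (x y : D4) : form x y = form y x := by
  rw [form_apply, form_apply, Matrix.trace_mul_comm]

theorem form_lieInvariant (x y z : D4) : form ⁅x, y⁆ z = -form y ⁅x, z⁆ := by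
  simp only [form_apply, LieHom.map_lie, Ring.lie_def, mul_sub, sub_mul, Matrix.trace_sub]
  rw [← Matrix.mul_assoc, ← Matrix.mul_assoc, Matrix.mul_assoc (toMatrix x),
    Matrix.trace_mul_comm (toMatrix x)]
  ring

/-! ### The affine Kac–Moody algebra `𝔤 ⊗ ℂ[t,t⁻¹] ⊕ ℂ K ⊕ ℂ d` -/

/-- The loop algebra `𝔤 ⊗ ℂ[t,t⁻¹]`. -/
def Loop : Type := LieAlgebra.loopAlgebra ℂ ℤ D4

instance : LieRing Loop := inferInstanceAs (LieRing (LieAlgebra.loopAlgebra ℂ ℤ D4))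

instance : LieAlgebra ℂ Loop := inferInstanceAs (LieAlgebra ℂ (LieAlgebra.loopAlgebra ℂ ℤ D4))

/-- The coefficients of an element of the loop algebra. -/
def coeffs : Loop ≃ₗ[ℂ] (ℤ →₀ D4) := LieAlgebra.LoopAlgebra.toFinsupp ℂ ℤ D4

/-- `x ⊗ t ^ n`. -/
def loop (n : ℤ) : D4 →ₗ[ℂ] Loop :=
  TensorProduct.mk ℂ (AddMonoidAlgebra ℂ ℤ) D4 (AddMonoidAlgebra.single n 1)

/-- The derivation `t d/dt` of the loop algebra. -/
def eulerD : Loop →ₗ[ℂ] Loop :=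
  (Finsupp.lsum ℂ fun n : ℤ => (n : ℂ) • loop n) ∘ₗ coeffs.toLinearMap

/-- The cocycle `(x ⊗ t ^ m, y ⊗ t ^ n) ↦ m δ_{m+n,0} (x | y)`, i.e. `Res_{t=0} (da | b)`. -/
def cocycle : LinearMap.BilinForm ℂ Loop :=
  (LieAlgebra.LoopAlgebra.residuePairing ℂ ℤ D4 form).flip

theorem coeffs_loop (n : ℤ) (x : D4) : coeffs (loop n x) = Finsupp.single n x :=
  LieAlgebra.LoopAlgebra.toFinsupp_single_tmul ℂ ℤ D4 n x

theorem loop_induction {P : Loop → Prop} (h0 : P 0) (hadd : ∀ a b, P a → P b → P (a + b))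
    (hl : ∀ n x, P (loop n x)) (a : Loop) : P a := by
  obtain ⟨a, rfl⟩ := coeffs.symm.surjective a
  induction a using Finsupp.induction_linear with
  | zero => simpa using h0
  | add a b ha hb => simpa using hadd _ _ ha hb
  | single n x => rw [← coeffs_loop, LinearEquiv.symm_apply_apply]; exact hl n x

theorem eulerD_loop (n : ℤ) (x : D4) : eulerD (loop n x) = (n : ℂ) • loop n x := by
  simp [eulerD, coeffs_loop]

theorem cocycle_apply (a b : Loop) :
    cocycle a b = (coeffs a).sum fun n x => n • form (coeffs b (-n)) x := rfl

theorem cocycle_loop (m n : ℤ) (x y : D4) :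
    cocycle (loop m x) (loop n y) = if m + n = 0 then (m : ℂ) * form x y else 0 := by
  rw [cocycle_apply, coeffs_loop, coeffs_loop, Finsupp.sum_single_index (by simp)]
  by_cases h : m + n = 0
  · obtain rfl : n = -m := by omega
    simp [form_comm x y]
  · have h' : n ≠ -m := by omega
    simp [h, h']

theorem lie_loop (m n : ℤ) (x y : D4) : ⁅loop m x, loop n y⁆ = loop (m + n) ⁅x, y⁆ := by
  refine (LieAlgebra.ExtendScalars.bracket_tmul ℂ (AddMonoidAlgebra ℂ ℤ) D4 D4 _ _ x y).trans ?_
  rw [AddMonoidAlgebra.single_mul_single, one_mul]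
  rfl

theorem eulerD_lie (a b : Loop) : eulerD ⁅a, b⁆ = ⁅eulerD a, b⁆ + ⁅a, eulerD b⁆ := by
  induction a using loop_induction with
  | h0 => simp
  | hadd a a' ha ha' => simp only [add_lie, map_add, ha, ha']; abel
  | hl m x =>
    induction b using loop_induction with
    | h0 => simp
    | hadd b b' hb hb' => simp only [lie_add, map_add, hb, hb']; abel
    | hl n y => simp only [lie_loop, eulerD_loop, smul_lie, lie_smul, ← add_smul]; push_cast; rfl

theorem cocycle_skew (a b : Loop) : cocycle a b = -cocycle b a := by
  induction a using loop_induction with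
  | h0 => simp
  | hadd a a' ha ha' => simp only [map_add, LinearMap.add_apply, ha, ha']; ring
  | hl m x =>
    induction b using loop_induction with
    | h0 => simp
    | hadd b b' hb hb' => simp only [map_add, LinearMap.add_apply, hb, hb']; ring
    | hl n y =>
      simp only [cocycle_loop, add_comm n m, form_comm y x]
      split_ifs with h
      · obtain rfl : n = -m := by omega
        push_cast; ring
      · simp

theorem cocycle_eulerD (a b : Loop) : cocycle (eulerD a) b = -cocycle a (eulerD b) := by
  induction a using loop_induction with
  | h0 => simp
  | hadd a a' ha ha' => simp only [map_add, LinearMap.add_apply, ha, ha']; ring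
  | hl m x =>
    induction b using loop_induction with
    | h0 => simp
    | hadd b b' hb hb' => simp only [map_add, hb, hb']; ring
    | hl n y =>
      simp only [eulerD_loop, map_smul, LinearMap.smul_apply, cocycle_loop, smul_eq_mul]
      split_ifs with h
      · obtain rfl : n = -m := by omega
        push_cast; ring
      · simp

theorem cocycle_lie (a b c : Loop) :
    cocycle a ⁅b, c⁆ = cocycle ⁅a, b⁆ c + cocycle b ⁅a, c⁆ := by
  induction a using loop_induction with
  | h0 => simp
  | hadd a a' ha ha' => simp only [map_add, LinearMap.add_apply, add_lie, ha, ha']; ring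
  | hl m x =>
    induction b using loop_induction with
    | h0 => simp
    | hadd b b' hb hb' =>
      simp only [map_add, LinearMap.add_apply, add_lie, lie_add, hb, hb']; ring
    | hl n y =>
      induction c using loop_induction with
      | h0 => simp
      | hadd c c' hc hc' => simp only [map_add, lie_add, hc, hc']; ring
      | hl p z =>
        have h1 : form ⁅x, y⁆ z = -form y ⁅x, z⁆ := form_lieInvariant x y z
        have h2 : form ⁅y, x⁆ z = -form x ⁅y, z⁆ := form_lieInvariant y x z
        rw [← lie_skew] at h2
        simp only [map_neg, LinearMap.neg_apply, neg_inj] at h2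
        simp only [lie_loop, cocycle_loop, ← h2]
        by_cases h : m + n + p = 0
        · have hy : form y ⁅x, z⁆ = -form ⁅x, y⁆ z := by rw [h1, neg_neg]
          rw [if_pos (by omega), if_pos h, if_pos (by omega), hy]
          push_cast; ring
        · rw [if_neg (by omega), if_neg h, if_neg (by omega)]; simp

/-- The underlying vector space of the affine Kac–Moody algebra `𝔤̂` of type `D₄⁽¹⁾`; the triple
`(a, c, s)` stands for `a + c K + s d`. -/
def AffineLie : Type := Loop × ℂ × ℂ

namespace AffineLie

instance : AddCommGroup AffineLie := inferInstanceAs (AddCommGroup (Loop × ℂ × ℂ))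

instance : Module ℂ AffineLie := inferInstanceAs (Module ℂ (Loop × ℂ × ℂ))

/-- The component in the loop algebra. -/
def loopPart : AffineLie →ₗ[ℂ] Loop := LinearMap.fst ℂ Loop (ℂ × ℂ)

/-- The coefficient of `K`. -/
def coeffK : AffineLie →ₗ[ℂ] ℂ := LinearMap.fst ℂ ℂ ℂ ∘ₗ LinearMap.snd ℂ Loop (ℂ × ℂ)

/-- The coefficient of `d`. -/
def coeffD : AffineLie →ₗ[ℂ] ℂ := LinearMap.snd ℂ ℂ ℂ ∘ₗ LinearMap.snd ℂ Loop (ℂ × ℂ)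

theorem ext' {a b : AffineLie} (h1 : a.loopPart = b.loopPart) (h2 : a.coeffK = b.coeffK)
    (h3 : a.coeffD = b.coeffD) : a = b :=
  Prod.ext h1 (Prod.ext h2 h3)

/-- `K` is central, `[d, a] = t (da/dt)`, and
`[x ⊗ t ^ m, y ⊗ t ^ n] = [x, y] ⊗ t ^ (m + n) + m δ_{m+n,0} (x | y) K`. -/
instance : Bracket AffineLie AffineLie where
  bracket a b :=
    (⁅a.loopPart, b.loopPart⁆ + a.coeffD • eulerD b.loopPart - b.coeffD • eulerD a.loopPart,
      cocycle a.loopPart b.loopPart, 0)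

theorem loopPart_lie (a b : AffineLie) : loopPart ⁅a, b⁆ =
    ⁅a.loopPart, b.loopPart⁆ + a.coeffD • eulerD b.loopPart - b.coeffD • eulerD a.loopPart := rfl

theorem coeffK_lie (a b : AffineLie) : coeffK ⁅a, b⁆ = cocycle a.loopPart b.loopPart := rfl

theorem coeffD_lie (a b : AffineLie) : coeffD ⁅a, b⁆ = 0 := rfl

instance : LieRing AffineLie where
  add_lie a b c := by
    apply ext'
    · simp only [loopPart_lie, map_add, add_lie, add_smul, smul_add]; abel
    · simp [coeffK_lie]
    · simp [coeffD_lie]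
  lie_add a b c := by
    apply ext'
    · simp only [loopPart_lie, map_add, lie_add, add_smul, smul_add]; abel
    · simp [coeffK_lie]
    · simp [coeffD_lie]
  lie_self a := by
    apply ext'
    · simp [loopPart_lie]
    · have := cocycle_skew a.loopPart a.loopPart
      rw [coeffK_lie, map_zero]
      exact self_eq_neg.mp this
    · simp [coeffD_lie]
  leibniz_lie a b c := by
    apply ext'
    · simp only [loopPart_lie, coeffD_lie, map_add, map_sub, map_smul, lie_add, lie_sub, add_lie,
        sub_lie, lie_smul, smul_lie, smul_add, smul_sub, eulerD_lie, zero_smul]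
      rw [leibniz_lie a.loopPart b.loopPart c.loopPart,
        ← lie_skew (eulerD a.loopPart) b.loopPart]
      simp only [smul_comm (coeffD b) (coeffD a), smul_comm (coeffD c) (coeffD a),
        smul_comm (coeffD c) (coeffD b), smul_neg]
      abel
    · simp only [coeffK_lie, loopPart_lie, map_add, map_sub, map_smul, LinearMap.add_apply,
        LinearMap.sub_apply, LinearMap.smul_apply, smul_eq_mul, cocycle_eulerD]
      rw [cocycle_lie, cocycle_skew b.loopPart (eulerD a.loopPart), cocycle_eulerD]
      ring
    · simp [coeffD_lie]

instance : LieAlgebra ℂ AffineLie where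
  lie_smul r a b := by
    apply ext'
    · simp only [loopPart_lie, map_smul, lie_smul, smul_add, smul_sub, smul_smul, smul_eq_mul,
        mul_comm r]
    · simp [coeffK_lie]
    · simp [coeffD_lie]

/-- The element `x(n) = x ⊗ t ^ n` of `𝔤̂`. -/
def mode (x : D4) (n : ℤ) : AffineLie := LinearMap.inl ℂ Loop (ℂ × ℂ) (loop n x)

/-- The central element `K`. -/
def K : AffineLie := (0, 1, 0)

/-- The scaling element `d`. -/
def d : AffineLie := (0, 0, 1)

/-- The Cartan subalgebra `𝔥̂ = 𝔥 ⊕ ℂ K ⊕ ℂ d`. -/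
def cartan : Submodule ℂ AffineLie :=
  Submodule.span ℂ ({a | ∃ h ∈ AffineD4.cartan, a = mode h 0} ∪ {K, d})

/-! Weights are written as linear functionals on `𝔤̂`; only their values on `𝔥̂` are used. -/

/-- The weight `Λ₀`: `1` on `K`, and `0` on `𝔥` and `d`. -/
def Λ₀ : Module.Dual ℂ AffineLie := coeffK

/-- The weight `δ`: `1` on `d`, and `0` on `𝔥` and `K`. -/
def δ : Module.Dual ℂ AffineLie := coeffD

/-- The weight `ε_i`: `ε_i(H_j) = δ_{ij}`, and `0` on `K` and `d`. -/
def ε (i : Fin 4) : Module.Dual ℂ AffineLie where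
  toFun a := toMatrix (coeffs a.loopPart 0) (.inl i) (.inl i)
  map_add' a b := by simp
  map_smul' c a := by simp

/-- The first fundamental weight `ω_1 = ε_1` of `D₄`. -/
def ω₁ : Module.Dual ℂ AffineLie := ε 0

theorem ω₁_coroot (i : Fin 4) : ω₁ (mode (coroot i) 0) = if i = 0 then 1 else 0 := by
  have h : ∀ j, ω₁ (mode (H j) 0) = if j = 0 then 1 else 0 := by
    intro j
    change toMatrix (coeffs (loop 0 (H j)) 0) (.inl 0) (.inl 0) = _
    simp [coeffs_loop, H, toMatrix_elem, Matrix.single_apply]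
  have hs : ∀ x y, mode (x - y) 0 = mode x 0 - mode y 0 := fun x y => by
    unfold mode; rw [map_sub, map_sub]; rfl
  have ha : ∀ x y, mode (x + y) 0 = mode x 0 + mode y 0 := fun x y => by
    unfold mode; rw [map_add, map_add]; rfl
  fin_cases i <;> simp [coroot, hs, ha, h]

end AffineLie

/-! ### The universal affine vertex algebra `V^k(D₄)` as a `𝔤̂`-module -/

open AffineLie

/-- The universal enveloping algebra of `𝔤̂`. -/
abbrev U : Type := UniversalEnvelopingAlgebra ℂ AffineLie

/-- The left ideal of `U(𝔤̂)` generated by `𝔤 ⊗ ℂ[t]`, `d` and `K - k`. -/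
def vacIdeal (k : ℂ) : Submodule U U :=
  Submodule.span U
    ({u | ∃ (x : D4) (n : ℕ), u = UniversalEnvelopingAlgebra.ι ℂ (mode x n)} ∪
      {UniversalEnvelopingAlgebra.ι ℂ d,
        UniversalEnvelopingAlgebra.ι ℂ K - algebraMap ℂ U k})

/-- The universal affine vertex algebra `V^k(D₄)`, as a module over `𝔤̂` (that is, over `U(𝔤̂)`): the
module induced from the one-dimensional module of `𝔤 ⊗ ℂ[t] ⊕ ℂ K ⊕ ℂ d` on which `K` acts as `k`
and `𝔤 ⊗ ℂ[t]` and `d` act as `0`. -/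
abbrev V (k : ℂ) : Type := U ⧸ vacIdeal k

/-- The vacuum vector `𝟏`. -/
def vac (k : ℂ) : V k := (vacIdeal k).mkQ 1

/-- The action of `𝔤̂` on `V^k(D₄)`. -/
def act {k : ℂ} (a : AffineLie) (v : V k) : V k := UniversalEnvelopingAlgebra.ι ℂ a • v

/-- A singular vector: a non-zero vector annihilated by `𝔫̂₊ = 𝔫₊ ⊕ 𝔤 ⊗ t ℂ[t]`. -/
def IsSingular {k : ℂ} (v : V k) : Prop :=
  v ≠ 0 ∧ (∀ x ∈ nPos, act (mode x 0) v = 0) ∧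
    ∀ (x : D4) (n : ℤ), 0 < n → act (mode x n) v = 0

/-- The vector `v` has weight `wt` with respect to `𝔥̂`. -/
def HasWeight {k : ℂ} (v : V k) (wt : Module.Dual ℂ AffineLie) : Prop :=
  ∀ h ∈ AffineLie.cartan, act h v = wt h • v

/-- The vector `x₁(-n₁) ⋯ x_r(-n_r) 𝟏` for the list of the pairs `(x_i, n_i)`. -/
def word (k : ℂ) (l : List (D4 × ℕ)) : V k :=
  (l.map fun p => UniversalEnvelopingAlgebra.ι ℂ (mode p.1 (-(p.2 : ℤ)))).prod • vac k

/-- The vector `v` has conformal weight `N`: it is a linear combination of vectors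
`x₁(-n₁) ⋯ x_r(-n_r) 𝟏` with `n_i ≥ 1` and `n₁ + ⋯ + n_r = N`. -/
def HasConformalWeight {k : ℂ} (v : V k) (N : ℕ) : Prop :=
  v ∈ Submodule.span ℂ
    {w | ∃ l : List (D4 × ℕ), (∀ p ∈ l, 1 ≤ p.2) ∧ (l.map Prod.snd).sum = N ∧ w = word k l}

/-! ### PBW monomials -/

/-- Indices of the basis `e_α`, `h_i`, `f_α` of `D₄`. -/
abbrev BasisIndex : Type := PosRoot ⊕ Fin 4 ⊕ PosRoot

/-- The basis of root vectors and simple coroots. -/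
def basisVec : BasisIndex → D4
  | .inl α => e α
  | .inr (.inl i) => coroot i
  | .inr (.inr α) => f α

/-- Indices of the basis of `𝔤 ⊗ t⁻¹ ℂ[t⁻¹]`: the pair `(b, n)`, `n ≥ 1`, stands for `x_b(-n)`. -/
abbrev Gen : Type := BasisIndex × ℕ+

/-- The PBW monomial of a multiset of generators: the generators are applied to `𝟏` in the order
that is prescribed by the linear order `r` (the smallest one stands on the left). -/
def monomial (k : ℂ) (r : LinearOrder Gen) (m : Multiset Gen) : V k :=
  word k ((m.sort r.le).map fun g => (basisVec g.1, (g.2 : ℕ)))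

/-- The vector `v` is the linear combination of exactly `N` distinct PBW monomials with non-zero
coefficients. -/
def HasPBWExpansion {k : ℂ} (r : LinearOrder Gen) (v : V k) (N : ℕ) : Prop :=
  ∃ c : Multiset Gen →₀ ℂ, c.support.card = N ∧
    v = c.sum fun m a => a • monomial k r m

end AffineD4

end

/-! The vector is written down explicitly, as an integral combination of ordered monomials in the
x(-n), and its properties are verified by exact computation. The mathematics reduces each property
to a finite check.

Singularity. The elements of 𝔤̂ that annihilate a fixed vector form a Lie subalgebra. The four
simple root vectors e_i(0) together with f_θ(1) generate 𝔫₊ ⊕ 𝔤 ⊗ tℂ[t]: the simple root vectors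
generate 𝔫₊, they raise the lowest root vector f_θ(1) to all of 𝔤 ⊗ t, and a bracket with h_2(1)
passes from f_θ(n) to f_θ(n+1). So five annihilation conditions suffice (`isSingular_of_simple`).

Each condition is tested by moving the operator to the right through the monomials until it reaches
the vacuum, and by reordering what the commutators leave (`eval_mulGen`, `eval_actZero`,
`eval_actOne`). The level enters only through the central term of [f_θ(1), x(-1)], and among the
basis vectors only x = e_θ pairs non-trivially with f_θ. Hence f_θ(1) acts as A + k D, where A does
not involve the level and D is the formal derivative with respect to e_θ(-1). At k = -14/3 the
condition becomes the integral identity 3 A v - 14 D v = 0.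

Non-vanishing. For this, V^k must be known not to be too small. A representation of 𝔤̂ on U(𝔤 ⊗
t⁻¹ℂ[t⁻¹]) is constructed directly (`InducedModule.action_lie`), without the Poincaré–Birkhoff–Witt
theorem. It yields a linear map from V^k to that enveloping algebra. Evaluation at t = 1 in the
defining representation continues it to the 8 × 8 matrices, where x₁(-n₁)⋯x_r(-n_r)𝟏 becomes the
product x₁⋯x_r (`matrixMap_smul`). One matrix entry of the image of v is computed to be -255255.

Weights and monomials. Both weights are read off from the monomials, since d and the H_i act
diagonally on the generators. Sortedness of the stored words shows that they are distinct PBW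
monomials for one total order (`card_support_coefficients`), so the non-zero coefficients can be
counted.

The numbers agree with the Sugawara construction, which the proof does not use: the dual Coxeter
number is 6, so k + 6 = 4/3, and (2ω₁ | 2ω₁ + 2ρ) / (2 · 4/3) = 16 / (8/3) = 6. -/

noncomputable section

attribute [local instance 100] LieRing.ofAssociativeRing

/-! ### Modules induced from a complement of a subalgebra -/

namespace InducedModule

variable {R L N : Type*} [CommRing R] [LieRing L] [LieAlgebra R L] [LieRing N] [LieAlgebra R N]

/-- The adjoint-type action of `N` on the linear maps from `L` to `U(N)`. -/
def homAction (i : N →ₗ⁅R⁆ L) :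
    N →ₗ⁅R⁆ Module.End R (L →ₗ[R] UniversalEnvelopingAlgebra R N) where
  toFun x := LinearMap.llcomp R L _ _ (LinearMap.mulLeft R (UniversalEnvelopingAlgebra.ι R x)) -
    LinearMap.lcomp R _ (LieAlgebra.ad R L (i x))
  map_add' x y := by
    ext φ a
    simp [add_mul]
    abel
  map_smul' c x := by
    ext φ a
    simp [smul_sub]
  map_lie' {x y} := by
    ext φ a
    simp [Ring.lie_def, sub_mul, mul_assoc, mul_sub]
    abel

theorem homAction_apply (i : N →ₗ⁅R⁆ L) (x : N) (φ : L →ₗ[R] UniversalEnvelopingAlgebra R N)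
    (a : L) :
    homAction i x φ a = UniversalEnvelopingAlgebra.ι R x * φ a - φ ⁅i x, a⁆ := by
  simp [homAction]

/-- The action of `L` on `U(N)`, before it is known to be a representation: `a` acts on `u` by
evaluating at `a` the image under `u` of the map `ι ∘ p + χ`. -/
def action (i : N →ₗ⁅R⁆ L) (p : L →ₗ[R] N) (χ : L →ₗ[R] R) :
    L →ₗ[R] Module.End R (UniversalEnvelopingAlgebra R N) :=
  LinearMap.flip ((LinearMap.applyₗ ((UniversalEnvelopingAlgebra.ι R : N →ₗ⁅R⁆ _).toLinearMap ∘ₗ p +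
    Algebra.linearMap R _ ∘ₗ χ)) ∘ₗ
      (UniversalEnvelopingAlgebra.lift R (homAction i)).toLinearMap)

variable {i : N →ₗ⁅R⁆ L} {p : L →ₗ[R] N} {χ : L →ₗ[R] R}

theorem action_one (a : L) : action i p χ a 1 =
    UniversalEnvelopingAlgebra.ι R (p a) + algebraMap R _ (χ a) := by
  simp [action]

/-- This is the recursion a x u = x a u - [x, a] u that any representation extending left
multiplication by N must satisfy. As a definition it would need consistency on U(N); this is
supplied by `homAction` being a Lie algebra homomorphism, so that it extends to U(N). -/
theorem action_ι_mul (a : L) (x : N) (u : UniversalEnvelopingAlgebra R N) :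
    action i p χ a (UniversalEnvelopingAlgebra.ι R x * u) =
      UniversalEnvelopingAlgebra.ι R x * action i p χ a u - action i p χ ⁅i x, a⁆ u := by
  simp only [action, LinearMap.flip_apply, LinearMap.comp_apply, AlgHom.toLinearMap_apply, map_mul,
    UniversalEnvelopingAlgebra.lift_ι_apply, LinearMap.applyₗ_apply_apply, Module.End.mul_apply,
    homAction_apply]

/-- The elements whose left multiplication preserves `P` form a subalgebra, and this subalgebra
contains the generators ι x. -/
theorem ι_induction {P : UniversalEnvelopingAlgebra R N → Prop} (h1 : P 1)
    (hadd : ∀ u w, P u → P w → P (u + w)) (hsmul : ∀ (c : R) u, P u → P (c • u))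
    (hι : ∀ x u, P u → P (UniversalEnvelopingAlgebra.ι R x * u))
    (u : UniversalEnvelopingAlgebra R N) : P u := by
  have key : ∀ w : UniversalEnvelopingAlgebra R N, ∀ u, P u → P (w * u) := by
    let S : Subalgebra R (UniversalEnvelopingAlgebra R N) :=
      { carrier := {w | ∀ u, P u → P (w * u)}
        mul_mem' := fun {a b} ha hb u hu => by rw [mul_assoc]; exact ha _ (hb _ hu)
        add_mem' := fun {a b} ha hb u hu => by rw [add_mul]; exact hadd _ _ (ha _ hu) (hb _ hu)
        algebraMap_mem' := fun r u hu => by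
          rw [← Algebra.smul_def]; exact hsmul _ _ hu }
    let j : N →ₗ⁅R⁆ S :=
      { toFun := fun x => ⟨UniversalEnvelopingAlgebra.ι R x, fun u hu => hι x u hu⟩
        map_add' := fun x y => Subtype.ext (map_add _ x y)
        map_smul' := fun c x => Subtype.ext (map_smul _ c x)
        map_lie' := fun {x y} => Subtype.ext (LieHom.map_lie _ x y) }
    -- By the universal property, a subalgebra that contains ι N is everything: the identity of U(N)
    -- factors through it.
    have h : S.val.comp (UniversalEnvelopingAlgebra.lift R j) = AlgHom.id R _ := by
      apply UniversalEnvelopingAlgebra.hom_ext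
      ext x
      simp [j]
    intro w
    have := DFunLike.congr_fun h w
    simp only [AlgHom.comp_apply, AlgHom.id_apply] at this
    rw [← this]
    exact (UniversalEnvelopingAlgebra.lift R j w).2
  simpa using key u 1 h1

variable (hpi : ∀ x, p (i x) = x) (hχi : ∀ x, χ (i x) = 0)

include hpi hχi in
-- By the recursion, x acts on y u as y x u - [y, x] u = x y u. The conditions on `p` and `χ` give
-- the starting value at 1.
theorem action_incl (x : N) (u : UniversalEnvelopingAlgebra R N) :
    action i p χ (i x) u = UniversalEnvelopingAlgebra.ι R x * u := by
  induction u using ι_induction generalizing x with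
  | h1 => simp [action_one, hpi, hχi]
  | hadd u w hu hw => simp [mul_add, hu, hw]
  | hsmul c u hu => simp [hu]
  | hι y u hu =>
    rw [action_ι_mul, hu, ← LieHom.map_lie, hu, LieHom.map_lie, Ring.lie_def]
    noncomm_ring

variable {B : Submodule R L} (hB : ∀ a, a - i (p a) ∈ B) (hpB : ∀ a ∈ B, p a = 0)
  (hlie : ∀ a ∈ B, ∀ b ∈ B, p ⁅a, b⁆ = 0 ∧ χ ⁅a, b⁆ = 0)

include hpi hχi hB hpB hlie in
-- Here L = N + B, where brackets of elements of B have neither an N-component nor a value under χ;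
-- in the application B is a subalgebra and χ a character of it. The Jacobi identity carries the
-- relation from u to y u, so it only has to hold at u = 1. There it splits into the case with one
-- entry in N, where it is the recursion, and the case with both entries in B, which act on 1 by
-- commuting scalars.
theorem action_lie (a b : L) (u : UniversalEnvelopingAlgebra R N) :
    action i p χ ⁅a, b⁆ u =
      action i p χ a (action i p χ b u) - action i p χ b (action i p χ a u) := by
  induction u using ι_induction generalizing a b with
  | h1 =>
    have hN : ∀ (x : N) (b : L), action i p χ ⁅i x, b⁆ 1 =
        action i p χ (i x) (action i p χ b 1) - action i p χ b (action i p χ (i x) 1) := by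
      intro x b
      rw [action_incl hpi hχi, action_incl hpi hχi, action_ι_mul]
      abel
    have hBB : ∀ a ∈ B, ∀ b ∈ B, action i p χ ⁅a, b⁆ 1 =
        action i p χ a (action i p χ b 1) - action i p χ b (action i p χ a 1) := by
      intro a ha b hb
      simp only [action_one, hpB a ha, hpB b hb, (hlie a ha b hb).1, (hlie a ha b hb).2, map_zero,
        zero_add, Algebra.algebraMap_eq_smul_one, map_smul]
      rw [smul_comm, sub_self]
    have ha : a = i (p a) + (a - i (p a)) := by abel
    have hb : b = i (p b) + (b - i (p b)) := by abel
    have h1 := hN (p a) b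
    have h2 := hN (p b) (a - i (p a))
    have h3 := hBB _ (hB a) _ (hB b)
    rw [← lie_skew, map_neg, LinearMap.neg_apply] at h2
    -- Only the last of the three brackets has no entry in N.
    have h4 : ⁅a, b⁆ = ⁅i (p a), b⁆ + ⁅a - i (p a), i (p b)⁆ + ⁅a - i (p a), b - i (p b)⁆ := by
      simp
    rw [h4, map_add, map_add, LinearMap.add_apply, LinearMap.add_apply, h1, h3, ← neg_eq_iff_eq_neg.mpr h2.symm]
    simp
    abel
  | hadd u w hu hw => simp [hu, hw]; abel
  | hsmul c u hu => simp [hu, smul_sub]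
  | hι y u hu =>
    simp only [action_ι_mul, map_sub]
    -- The induction hypothesis is used for the three pairs that the Jacobi identity produces from
    -- [y, [a, b]]; this is why it is generalised over a and b.
    rw [leibniz_lie (i y) a b, map_add, LinearMap.add_apply, hu a b, hu ⁅i y, a⁆ b, hu a ⁅i y, b⁆,
      mul_sub]
    abel

/-- The representation of `L` on `U(N)` that is induced from the character `χ` of `B`. -/
def rep : L →ₗ⁅R⁆ Module.End R (UniversalEnvelopingAlgebra R N) :=
  { action i p χ with
    map_lie' := fun {a b} => by
      ext1 u
      exact action_lie hpi hχi hB hpB hlie a b u }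

end InducedModule

/-! ### The vacuum representation on U(𝔤 ⊗ t⁻¹ℂ[t⁻¹]) -/

namespace AffineD4

namespace AffineLie

theorem mode_add (x y : D4) (n : ℤ) : mode (x + y) n = mode x n + mode y n := by
  unfold mode; rw [map_add, map_add]; rfl

theorem mode_smul (c : ℂ) (x : D4) (n : ℤ) : mode (c • x) n = c • mode x n := by
  unfold mode; rw [map_smul, map_smul]; rfl

/-- `x ↦ x(n)` as a linear map. -/
def modeₗ (n : ℤ) : D4 →ₗ[ℂ] AffineLie where
  toFun x := mode x n
  map_add' x y := mode_add x y n
  map_smul' c x := mode_smul c x n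

theorem modeₗ_apply (n : ℤ) (x : D4) : modeₗ n x = mode x n := rfl

theorem loopPart_mode (x : D4) (n : ℤ) : loopPart (mode x n) = loop n x := rfl
theorem coeffK_mode (x : D4) (n : ℤ) : coeffK (mode x n) = 0 := rfl
theorem coeffD_mode (x : D4) (n : ℤ) : coeffD (mode x n) = 0 := rfl
theorem loopPart_K : loopPart K = 0 := rfl
theorem coeffK_K : coeffK K = 1 := rfl
theorem coeffD_K : coeffD K = 0 := rfl
theorem loopPart_d : loopPart d = 0 := rfl
theorem coeffK_d : coeffK d = 0 := rfl
theorem coeffD_d : coeffD d = 1 := rfl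

theorem mode_lie (x y : D4) (m n : ℤ) : ⁅mode x m, mode y n⁆ =
    mode ⁅x, y⁆ (m + n) + (if m + n = 0 then (m : ℂ) * form x y else 0) • K := by
  apply ext'
  · rw [map_add, map_smul, loopPart_K, smul_zero, loopPart_lie]
    simp [loopPart_mode, coeffD_mode, lie_loop]
  · rw [map_add, map_smul, coeffK_K, coeffK_mode, coeffK_lie, loopPart_mode, loopPart_mode,
      cocycle_loop, zero_add, smul_eq_mul, mul_one]
  · rw [map_add, map_smul, coeffD_K, coeffD_mode, coeffD_lie, smul_zero, zero_add]

theorem lie_K (a : AffineLie) : ⁅a, K⁆ = 0 := by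
  apply ext'
  · simp [loopPart_lie, loopPart_K, coeffD_K]
  · simp [coeffK_lie, loopPart_K]
  · simp [coeffD_lie]

theorem K_lie (a : AffineLie) : ⁅K, a⁆ = 0 := by
  rw [← lie_skew, lie_K, neg_zero]

theorem d_lie (x : D4) (n : ℤ) : ⁅d, mode x n⁆ = (n : ℂ) • mode x n := by
  apply ext'
  · simp [loopPart_lie, loopPart_d, coeffD_d, coeffD_mode, loopPart_mode, eulerD_loop]
  · simp [coeffK_lie, loopPart_d, coeffK_mode]
  · simp [coeffD_lie, coeffD_mode]

theorem mode_induction {P : AffineLie → Prop} (hadd : ∀ a b, P a → P b → P (a + b))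
    (hm : ∀ x n, P (mode x n)) (hK : ∀ c : ℂ, P (c • K)) (hd : ∀ c : ℂ, P (c • d))
    (a : AffineLie) : P a := by
  let j : Loop →ₗ[ℂ] AffineLie := LinearMap.inl ℂ Loop (ℂ × ℂ)
  have h1 : ∀ l : Loop, P (j l) := by
    intro l
    induction l using loop_induction with
    | h0 => rw [map_zero, ← zero_smul ℂ K]; exact hK 0
    | hadd a b ha hb => rw [map_add]; exact hadd _ _ ha hb
    | hl n x => exact hm x n
  have h2 : a = j a.loopPart + a.coeffK • K +
      a.coeffD • d := by
    apply ext'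
    · rw [map_add, map_add, map_smul, map_smul, loopPart_K, loopPart_d, smul_zero, smul_zero,
        add_zero, add_zero]
      rfl
    · rw [map_add, map_add, map_smul, map_smul, coeffK_K, coeffK_d, smul_zero, add_zero,
        smul_eq_mul, mul_one]
      exact (zero_add _).symm
    · rw [map_add, map_add, map_smul, map_smul, coeffD_K, coeffD_d, smul_zero, add_zero,
        smul_eq_mul, mul_one]
      exact (zero_add _).symm
  rw [h2]
  exact hadd _ _ (hadd _ _ (h1 _) (hK _)) (hd _)

/-- The span of the `x(n)` with `n < 0`. -/
def negSpan : Submodule ℂ AffineLie := Submodule.span ℂ {a | ∃ x n, n < 0 ∧ a = mode x n}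

theorem mode_mem_negSpan (x : D4) {n : ℤ} (hn : n < 0) : mode x n ∈ negSpan :=
  Submodule.subset_span ⟨x, n, hn, rfl⟩

/-- The subalgebra `𝔤 ⊗ t⁻¹ ℂ[t⁻¹]`. -/
def negPart : LieSubalgebra ℂ AffineLie :=
  { negSpan with
    lie_mem' := fun {a b} ha hb => by
      refine Submodule.span_induction₂ (p := fun a b _ _ => ⁅a, b⁆ ∈ negSpan) ?_ ?_ ?_ ?_ ?_ ?_ ?_
        ha hb
      · rintro _ _ ⟨x, m, hm, rfl⟩ ⟨y, n, hn, rfl⟩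
        rw [mode_lie, if_neg (by omega), zero_smul, add_zero]
        exact mode_mem_negSpan _ (by omega)
      · intro b hb; simp
      · intro a ha; simp
      · intro a b c _ _ _ h1 h2; rw [add_lie]; exact add_mem h1 h2
      · intro a b c _ _ _ h1 h2; rw [lie_add]; exact add_mem h1 h2
      · intro r a b _ _ h; rw [smul_lie]; exact Submodule.smul_mem _ _ h
      · intro r a b _ _ h; rw [lie_smul]; exact Submodule.smul_mem _ _ h }

/-- The span of the `x(n)` with `n ≥ 0`, of `K` and of `d`. -/
def nonnegSpan : Submodule ℂ AffineLie :=
  Submodule.span ℂ ({a | ∃ x n, 0 ≤ n ∧ a = mode x n} ∪ {K, d})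

/-- The projection to `𝔤 ⊗ t⁻¹ ℂ[t⁻¹]`, with values in `𝔤̂`. -/
def negProjAux : AffineLie →ₗ[ℂ] AffineLie :=
  (Finsupp.lsum ℂ fun n : ℤ => if n < 0 then modeₗ n else 0) ∘ₗ coeffs.toLinearMap ∘ₗ loopPart

theorem negProjAux_mode (x : D4) (n : ℤ) :
    negProjAux (mode x n) = if n < 0 then mode x n else 0 := by
  simp only [negProjAux, LinearMap.comp_apply, loopPart_mode, LinearEquiv.coe_coe, coeffs_loop,
    Finsupp.lsum_single]
  split_ifs <;> rfl

theorem negProjAux_K : negProjAux K = 0 := by simp [negProjAux, loopPart_K]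

theorem negProjAux_d : negProjAux d = 0 := by simp [negProjAux, loopPart_d]

theorem negProjAux_mem (a : AffineLie) : negProjAux a ∈ negSpan := by
  induction a using mode_induction with
  | hadd a b ha hb => rw [map_add]; exact add_mem ha hb
  | hm x n =>
    rw [negProjAux_mode]
    split_ifs with h
    · exact mode_mem_negSpan x h
    · exact zero_mem _
  | hK c => rw [map_smul, negProjAux_K, smul_zero]; exact zero_mem _
  | hd c => rw [map_smul, negProjAux_d, smul_zero]; exact zero_mem _

/-- The projection to `𝔤 ⊗ t⁻¹ ℂ[t⁻¹]`. -/
def negProj : AffineLie →ₗ[ℂ] negPart :=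
  negProjAux.codRestrict negPart.toSubmodule negProjAux_mem

theorem coe_negProj (a : AffineLie) : (negProj a : AffineLie) = negProjAux a := rfl

theorem negProj_coe (a : negPart) : negProj (negPart.incl a) = a := by
  apply Subtype.ext
  rw [coe_negProj]
  change negProjAux (a : AffineLie) = a
  obtain ⟨a, ha⟩ := a
  change negProjAux a = a
  induction ha using Submodule.span_induction with
  | mem a ha => obtain ⟨x, n, hn, rfl⟩ := ha; rw [negProjAux_mode, if_pos hn]
  | zero => simp
  | add a b _ _ ha hb => rw [map_add, ha, hb]
  | smul c a _ ha => rw [map_smul, ha]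

theorem coeffK_coe (a : negPart) : coeffK (negPart.incl a) = 0 := by
  obtain ⟨a, ha⟩ := a
  change coeffK a = 0
  induction ha using Submodule.span_induction with
  | mem a ha => obtain ⟨x, n, hn, rfl⟩ := ha; rfl
  | zero => simp
  | add a b _ _ ha hb => rw [map_add, ha, hb, add_zero]
  | smul c a _ ha => rw [map_smul, ha, smul_zero]

theorem coeffD_coe (a : negPart) : coeffD (negPart.incl a) = 0 := by
  obtain ⟨a, ha⟩ := a
  change coeffD a = 0
  induction ha using Submodule.span_induction with
  | mem a ha => obtain ⟨x, n, hn, rfl⟩ := ha; rfl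
  | zero => simp
  | add a b _ _ ha hb => rw [map_add, ha, hb, add_zero]
  | smul c a _ ha => rw [map_smul, ha, smul_zero]

theorem sub_negProj_mem (a : AffineLie) : a - negPart.incl (negProj a) ∈ nonnegSpan := by
  change a - negProjAux a ∈ nonnegSpan
  induction a using mode_induction with
  | hadd a b ha hb => rw [map_add, add_sub_add_comm]; exact add_mem ha hb
  | hm x n =>
    rw [negProjAux_mode]
    split_ifs with h
    · rw [sub_self]; exact zero_mem _
    · rw [sub_zero]; exact Submodule.subset_span (.inl ⟨x, n, not_lt.mp h, rfl⟩)
  | hK c =>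
    rw [map_smul, negProjAux_K, smul_zero, sub_zero]
    exact Submodule.smul_mem _ _ (Submodule.subset_span (by simp))
  | hd c =>
    rw [map_smul, negProjAux_d, smul_zero, sub_zero]
    exact Submodule.smul_mem _ _ (Submodule.subset_span (by simp))

theorem negProj_eq_zero {a : AffineLie} (ha : a ∈ nonnegSpan) : negProj a = 0 := by
  apply Subtype.ext
  rw [coe_negProj]
  change negProjAux a = 0
  induction ha using Submodule.span_induction with
  | mem a ha =>
    rcases ha with ⟨x, n, hn, rfl⟩ | rfl | rfl
    · rw [negProjAux_mode, if_neg (by omega)]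
    · exact negProjAux_K
    · exact negProjAux_d
  | zero => simp
  | add a b _ _ ha hb => rw [map_add, ha, hb, add_zero]
  | smul c a _ ha => rw [map_smul, ha, smul_zero]

/-- For m, n ≥ 0 the cocycle requires m + n = 0, hence m = 0, and then its factor m vanishes. This
is what makes k times the K-coefficient a character of the non-negative part. -/
theorem lie_nonnegSpan {a b : AffineLie} (ha : a ∈ nonnegSpan) (hb : b ∈ nonnegSpan) :
    ⁅a, b⁆ ∈ nonnegSpan ∧ coeffK ⁅a, b⁆ = 0 := by
  refine Submodule.span_induction₂
    (p := fun a b _ _ => ⁅a, b⁆ ∈ nonnegSpan ∧ coeffK ⁅a, b⁆ = 0) ?_ ?_ ?_ ?_ ?_ ?_ ?_ ha hb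
  · rintro a b (⟨x, m, hm, rfl⟩ | rfl | rfl) hb
    · rcases hb with ⟨y, n, hn, rfl⟩ | rfl | rfl
      · have h : (if m + n = 0 then (m : ℂ) * form x y else 0) = 0 := by
          split_ifs with h
          · obtain rfl : m = 0 := by omega
            simp
          · rfl
        rw [mode_lie, h, zero_smul, add_zero]
        exact ⟨Submodule.subset_span (.inl ⟨_, _, by omega, rfl⟩), rfl⟩
      · simp [lie_K]
      · rw [← lie_skew, d_lie, ← neg_smul, map_smul, coeffK_mode, smul_zero]
        exact ⟨Submodule.smul_mem _ _ (Submodule.subset_span (.inl ⟨_, _, hm, rfl⟩)), rfl⟩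
    · simp [K_lie]
    · rcases hb with ⟨y, n, hn, rfl⟩ | rfl | rfl
      · rw [d_lie, map_smul, coeffK_mode, smul_zero]
        exact ⟨Submodule.smul_mem _ _ (Submodule.subset_span (.inl ⟨_, _, hn, rfl⟩)), rfl⟩
      · simp [lie_K]
      · simp
  · intro b hb; simp
  · intro a ha; simp
  · intro a b c _ _ _ h1 h2
    rw [add_lie, map_add, h1.2, h2.2, add_zero]; exact ⟨add_mem h1.1 h2.1, rfl⟩
  · intro a b c _ _ _ h1 h2
    rw [lie_add, map_add, h1.2, h2.2, add_zero]; exact ⟨add_mem h1.1 h2.1, rfl⟩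
  · intro r a b _ _ h
    rw [smul_lie, map_smul, h.2, smul_zero]; exact ⟨Submodule.smul_mem _ _ h.1, rfl⟩
  · intro r a b _ _ h
    rw [lie_smul, map_smul, h.2, smul_zero]; exact ⟨Submodule.smul_mem _ _ h.1, rfl⟩

/-- The representation of `𝔤̂` on `U(𝔤 ⊗ t⁻¹ ℂ[t⁻¹])` at level `k`. -/
def vacRep (k : ℂ) :
    AffineLie →ₗ⁅ℂ⁆ Module.End ℂ (UniversalEnvelopingAlgebra ℂ negPart) :=
  InducedModule.rep (i := negPart.incl) (p := negProj) (χ := k • coeffK) (B := nonnegSpan)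
    negProj_coe (fun a => by simp only [LinearMap.smul_apply, coeffK_coe, smul_zero])
    sub_negProj_mem (fun a ha => negProj_eq_zero ha) (fun a ha b hb => by
      obtain ⟨h1, h2⟩ := lie_nonnegSpan ha hb
      simp [negProj_eq_zero h1, h2])

theorem vacRep_incl (k : ℂ) (a : negPart) (u : UniversalEnvelopingAlgebra ℂ negPart) :
    vacRep k (negPart.incl a) u = UniversalEnvelopingAlgebra.ι ℂ a * u :=
  InducedModule.action_incl (χ := k • coeffK) negProj_coe
    (fun a => by simp only [LinearMap.smul_apply, coeffK_coe, smul_zero]) a u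

/-- With this formula the generators of the left ideal `vacIdeal k` kill 1, so the action on 1
descends to V^k. -/
theorem vacRep_one (k : ℂ) {a : AffineLie} (ha : a ∈ nonnegSpan) :
    vacRep k a 1 = algebraMap ℂ _ (k * coeffK a) := by
  refine (InducedModule.action_one a).trans ?_
  rw [negProj_eq_zero ha, map_zero, zero_add]
  rfl

/-! ### Evaluation at t = 1 and the map from V^k to 8 × 8 matrices -/

/-- The evaluation of the loop algebra at `t = 1`. -/
def evalOne : Loop →ₗ⁅ℂ⁆ Matrix (Fin 4 ⊕ Fin 4) (Fin 4 ⊕ Fin 4) ℂ :=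
  { (Finsupp.lsum ℂ fun _ : ℤ => toMatrix.toLinearMap) ∘ₗ coeffs.toLinearMap with
    map_lie' := fun {a b} => by
      have h : ∀ n x, ((Finsupp.lsum ℂ fun _ : ℤ => toMatrix.toLinearMap) ∘ₗ
          coeffs.toLinearMap) (loop n x) = toMatrix x := by
        intro n x
        simp only [LinearMap.comp_apply, LinearEquiv.coe_coe, coeffs_loop, Finsupp.lsum_single]
        rfl
      change ((Finsupp.lsum ℂ fun _ : ℤ => toMatrix.toLinearMap) ∘ₗ
          coeffs.toLinearMap) _ = ⁅((Finsupp.lsum ℂ fun _ : ℤ => toMatrix.toLinearMap) ∘ₗ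
          coeffs.toLinearMap) a, ((Finsupp.lsum ℂ fun _ : ℤ => toMatrix.toLinearMap) ∘ₗ
          coeffs.toLinearMap) b⁆
      generalize ((Finsupp.lsum ℂ fun _ : ℤ => toMatrix.toLinearMap) ∘ₗ
          coeffs.toLinearMap) = F at h ⊢
      induction a using loop_induction with
      | h0 => simp
      | hadd a a' ha ha' => simp only [map_add, add_lie, ha, ha']
      | hl m x =>
        induction b using loop_induction with
        | h0 => simp
        | hadd b b' hb hb' => simp only [map_add, lie_add, hb, hb']
        | hl n y => rw [lie_loop, h, h, h, LieHom.map_lie] }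

theorem evalOne_loop (n : ℤ) (x : D4) : evalOne (loop n x) = toMatrix x := by
  change ((Finsupp.lsum ℂ fun _ : ℤ => toMatrix.toLinearMap) ∘ₗ coeffs.toLinearMap) _ = _
  simp only [LinearMap.comp_apply, LinearEquiv.coe_coe, coeffs_loop, Finsupp.lsum_single]
  rfl

/-- The evaluation at `t = 1` of `𝔤 ⊗ t⁻¹ ℂ[t⁻¹]`. -/
def negEval : negPart →ₗ⁅ℂ⁆ Matrix (Fin 4 ⊕ Fin 4) (Fin 4 ⊕ Fin 4) ℂ :=
  { evalOne.toLinearMap ∘ₗ loopPart ∘ₗ negPart.incl.toLinearMap with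
    map_lie' := fun {a b} => by
      -- Elements of 𝔤 ⊗ t⁻¹ℂ[t⁻¹] have no d-component, so the derivation terms in the bracket
      -- disappear and the loop part is multiplicative.
      change evalOne (loopPart (negPart.incl ⁅a, b⁆)) =
        ⁅evalOne (loopPart (negPart.incl a)), evalOne (loopPart (negPart.incl b))⁆
      rw [LieHom.map_lie, loopPart_lie, coeffD_coe, coeffD_coe, zero_smul, zero_smul, add_zero,
        sub_zero, LieHom.map_lie] }

end AffineLie

open AffineLie

/-- The linear map `V^k → U(𝔤 ⊗ t⁻¹ ℂ[t⁻¹])`. -/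
def vacMap (k : ℂ) : V k →ₗ[ℂ] UniversalEnvelopingAlgebra ℂ negPart :=
  ((vacIdeal k).restrictScalars ℂ).liftQ
    (LinearMap.applyₗ (1 : UniversalEnvelopingAlgebra ℂ negPart) ∘ₗ
      (UniversalEnvelopingAlgebra.lift ℂ (vacRep k)).toLinearMap) (by
      intro u hu
      change UniversalEnvelopingAlgebra.lift ℂ (vacRep k) u 1 = 0
      replace hu : u ∈ vacIdeal k := hu
      induction hu using Submodule.span_induction with
      | mem u hu =>
        rcases hu with ⟨x, n, rfl⟩ | rfl | rfl
        · rw [UniversalEnvelopingAlgebra.lift_ι_apply,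
            vacRep_one k (Submodule.subset_span (.inl ⟨x, n, by omega, rfl⟩)), coeffK_mode]
          simp
        · rw [UniversalEnvelopingAlgebra.lift_ι_apply,
            vacRep_one k (Submodule.subset_span (.inr (by simp))), coeffK_d]
          simp
        · rw [map_sub, LinearMap.sub_apply, UniversalEnvelopingAlgebra.lift_ι_apply,
            vacRep_one k (Submodule.subset_span (.inr (by simp))), coeffK_K, AlgHom.commutes,
            Module.algebraMap_end_apply, mul_one, Algebra.algebraMap_eq_smul_one, sub_self]
      | zero => simp
      | add u w _ _ hu hw => rw [map_add, LinearMap.add_apply, hu, hw, add_zero]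
      | smul a u _ hu => rw [smul_eq_mul, map_mul, Module.End.mul_apply, hu, map_zero]) ∘ₗ
    (Submodule.Quotient.restrictScalarsEquiv ℂ (vacIdeal k)).symm.toLinearMap

theorem vacMap_mkQ (k : ℂ) (u : U) :
    vacMap k ((vacIdeal k).mkQ u) = UniversalEnvelopingAlgebra.lift ℂ (vacRep k) u 1 := rfl

/-- The map u ↦ u · 1 intertwines left multiplication with the vacuum representation. -/
theorem vacMap_smul (k : ℂ) (u : U) (w : V k) :
    vacMap k (u • w) = UniversalEnvelopingAlgebra.lift ℂ (vacRep k) u (vacMap k w) := by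
  obtain ⟨w, rfl⟩ := (vacIdeal k).mkQ_surjective w
  rw [← map_smul, vacMap_mkQ, vacMap_mkQ, smul_eq_mul, map_mul, Module.End.mul_apply]

/-- The linear map `V^k → M₈(ℂ)` that sends `x₁(-n₁) ⋯ x_r(-n_r) 𝟏` to `x₁ ⋯ x_r`. -/
def matrixMap (k : ℂ) : V k →ₗ[ℂ] Matrix (Fin 4 ⊕ Fin 4) (Fin 4 ⊕ Fin 4) ℂ :=
  (UniversalEnvelopingAlgebra.lift ℂ negEval).toLinearMap ∘ₗ vacMap k

theorem matrixMap_vac (k : ℂ) : matrixMap k (vac k) = 1 := by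
  simp only [matrixMap, LinearMap.comp_apply, vac, vacMap_mkQ, map_one, Module.End.one_apply,
    AlgHom.toLinearMap_apply]

/-- For n < 0 the element x(n) acts on U(𝔤 ⊗ t⁻¹ℂ[t⁻¹]) by left multiplication, and evaluation at t
= 1 is an algebra homomorphism. Neither n nor the level is left in the result. -/
theorem matrixMap_smul (k : ℂ) (x : D4) {n : ℤ} (hn : n < 0) (w : V k) :
    matrixMap k (UniversalEnvelopingAlgebra.ι ℂ (mode x n) • w) = toMatrix x * matrixMap k w := by
  have h := vacRep_incl k ⟨mode x n, mode_mem_negSpan x hn⟩ (vacMap k w)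
  simp only [matrixMap, LinearMap.comp_apply, vacMap_smul, AlgHom.toLinearMap_apply,
    UniversalEnvelopingAlgebra.lift_ι_apply]
  change UniversalEnvelopingAlgebra.lift ℂ negEval
    (vacRep k (negPart.incl ⟨mode x n, mode_mem_negSpan x hn⟩) (vacMap k w)) = _
  rw [h, map_mul, UniversalEnvelopingAlgebra.lift_ι_apply]
  congr 1
  exact evalOne_loop n x


/-! ### The structure constants of `D₄` in the basis of root vectors and simple coroots -/

/-- The positive roots in lexicographic order. -/
def posRoot (i : Fin 12) : PosRoot :=
  (![⟨(0, 1), by decide⟩, ⟨(0, 2), by decide⟩, ⟨(0, 3), by decide⟩, ⟨(1, 2), by decide⟩,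
    ⟨(1, 3), by decide⟩, ⟨(2, 3), by decide⟩] ⟨i / 2, by omega⟩, i.val % 2 == 1)

/-- The order on the basis: first the `e_α`, then the `h_i`, then the `f_α`; the roots are in
lexicographic order, except that `f_{ε_3 + ε_4}` precedes the other `f_α`. -/
def basisIndex (b : Fin 28) : BasisIndex :=
  if h : b.val < 12 then .inl (posRoot ⟨b, h⟩)
  else if h' : b.val < 16 then .inr (.inl ⟨b - 12, by omega⟩)
  else .inr (.inr (posRoot ⟨(b + 7) % 12, by omega⟩))

set_option maxRecDepth 10000 in
theorem basisIndex_bijective : Function.Bijective basisIndex := by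
  rw [Fintype.bijective_iff_injective_and_card]
  exact ⟨by decide +kernel, by decide +kernel⟩

/-- The basis vector with a given rank. -/
def basisAt (b : ℕ) : D4 := basisVec (basisIndex ⟨b % 28, Nat.mod_lt _ (by norm_num)⟩)

/-- Byte `8 a + p` describes the image `c v_q` of the vector `v_p` under the basis vector of rank
`a` as `5 q + c + 2`. -/
def columnTable : ℕ :=
  0x1f02020202120202020202021a0226021a0202020202120202020202021a2102021a020202020d02020202021502022615020202020202120202020202150221021502020202020d020202020202151c0202150202020208020202021f260202241f0202120d0202261f0202100d020202211a02020b080202021c15020206030d10020202020202022402020d0202020802100202020202020224020802020202080b020202020202021f0202080202030202100202020202020224030202020203020b020202020202021f0203020202020306020202020202021a02020302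

def columnByte (a p : ℕ) : ℕ := (columnTable >>> (8 * (8 * a + p))) % 256

/-- The basis vector of rank `a` sends `v_p` to a multiple of `v_q`, where `q = imageIndex a p`. -/
def imageIndex (a p : ℕ) : ℕ := columnByte a p / 5

def imageCoeff (a p : ℕ) : ℤ := ((columnByte a p % 5 : ℕ) : ℤ) - 2

/-- The matrix entries of the basis vectors. -/
def entry (a q p : ℕ) : ℤ := if imageIndex a p = q then imageCoeff a p else 0

/-- Bytes `4 (28 a + b), …` describe the bracket of the basis vectors of ranks `a` and `b`: the byte
`5 i + c + 3` stands for the summand `c` times the basis vector of rank `i`. -/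
def bracketTable : ℕ :=
  0x7a0000000000000000000000810000006600000000000000000000006d000000000000000000000000000000000000008c0000008900000000000000000000004800000000000000200000003100000000000000000000000c0000001d0000000000000000000000000000007c00000000000000000000000000000000000000000000005c000000000000000000000000000000720000000000000086000000840000008600000084000000750000000000004d4300000000000000340000005400000002000000000000000000000000000000180000000000000000000000000000000000000000000000000000005c000000000000000000000000000000000000006d0000007c0000007f00000081000000810000007f00000000000000750000000000004843000000390000008b000000000000000200000000000000000000001d0000000000000000000000000000000000000000000000000000000000000000000000000000005c0000000000000068000000000000007c0000007c000000000000007a00000081000000860000008900000052004d484300000000000000000000000000000002000000000000000e000000000000007f0000000000000000000000000000000000000000000000000000005c000000000000000000000063000000840000007500000075000000780000007500000000000000000000003b00000036000000000000004300000000000000000000000000000002000000130000000000000068000000000000005e00000000000000000000000000000000000000000000000000000000000000000000000000000072000000700000000000000072000000610000000000000057000000000000000000000000004d433e0000000000000034000000540000002a00000086000000000000005e000000000000000000000000000000000000000000000000000000000000000000000000000000680000006b0000006d000000000000006d000000000000006100000000000000570000000000000000000000000048433e000000390000008b0000002f00000081000000000000000000000000000000000000005e0000000000000000000000000000000000000000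0000000000000000000000680000006800000066000000680000006d000000720000000000000000000000570000000000000089000000524d48433e00000000000000200000007c0000006b00000000000000000000005e0000000000000000000000000000000000000000000000000000000000000070000000610000006100000063000000630000000000000000000000000000000000000000000000570000003b00000036000000000000433e000000250000007700000000000000000000000000000000000000000000000000000000000000000000000000000000000000000000000000000000000000000000005e0000000000000000000000000000006d0000007200000063000000680000007f00000084000000750000007a4d48423e0000000000000000000000700000006b0000006600000061000000000000000000000000000000000000000000000000000000000000000000000000000000570000005a000000000000000000000000000000000000000000000000000000310000002c0000002700000022000000000000003e00000000000000000000007a000000000000008600000000000000660000000000000072000000000000000000000000000000550000000000000052000000000000004d0000000000000020000000000000002c000000000000000c00000000000000180000000000000000000000000000000000000084000000810000007a00000077000000700000006d0000006600000063000000000000000000000051000000000000000000000000000000000000003c00000000000000310000002a00000027000000200000001d00000016000000130000000c000000000000000000000088000000860000007f0000007a00000077000000720000006b00000066000000630000000000000000000000000000000000000000000000000000000000000000000000370000002f0000002c00000027000000200000001b00000018000000130000000c00000000000000000000008b000000840000007f0000000000000074000000000000000000000068000000610000005c0000005900000054000000000000000000000000000000000000003900000034000000310000002c0000000000000023000000000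0000000000000110000000e00000009000000020000000000000086000000810000007c00000077000000700000006b00000066000000610000000000000056000000000000000000000000000000000000000000000000000000000000002f0000002a00000025000000200000001d00000018000000130000000e00000000000000050000000000000077000000000000007f0000000000000063000000000000006b0000000000000000000000000000004f00000038000000000000003b0000000000000000000000000000000000000027000000000000002f0000000000000013000000000000001b00000000000000000000004a00000000000000770000008400000000000000000000006300000070000000000000000000000000000000000000000000000033000000360000000000000000000000000000002700000000000000000000002a0000001300000000000000000000001600000000000000000000000000004f45000000000000008b00000039000000590000000000000000000000000000006b00000000000000220000002f000000310000002f0000003100000000000000250000000000000000000000000000000000000000000000090000000000000000000000000000001b000000220000000000004a450000005400000034000000000000005900000000000000000000007000000000000000000000002c0000002a0000002a0000002c0000002500000000000000000000000000000000000000000000000900000000000000000000000000000000000000160000002f000000360000003b004f4a45000000000000000000000000000000590000000000000061000000000000002a0000002500000025000000000000002700000000000000000000000000000000000000000000000000000000000000000000000000000009000000000000001100000000000000520000008900000000000000450000000000000000000000000000005900000066000000000000000000000022000000220000001f00000022000000310000002c0000000000000000000000000000000000000000000000000000000900000000000000000000000c0000000000000004000000000000000000000000004f4540000000000000008b0000003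9000000810000002f0000000e0000001b0000001d000000000000001b0000000000000011000000000000000700000000000000000000000000000000000000000000000000000000000000000000000e0000000000000004000000000000000000000000004a45400000005400000034000000860000002a00000000000000180000001600000000000000160000001100000000000000070000000000000000000000000000000000000000000000000000000000000000000000000000001b00000000000000000000000400000000000000360000003b4f4a454000000000000000770000002500000016000000110000001100000013000000110000000000000000000000000000000000000000000000070000000000000000000000000000000000000000000000000000000000000000000000000000000000000004000000520000008900000000000045400000007c00000020000000000000000e0000000e0000000c0000000c0000001d000000180000000000000000000000070000000000000000000000000000000000000000000000000000000000000000000000160000001b0000000c000000110000002c0000003100000022000000274f4a46400000000000000000000000000000000000000007000000000000000000000000000000000000000000000000000000000000000000000000000000000000000000000000000000000000000000000000000000000000000000000000000000840000007f0000007a000000750000000000000040000000000000000000000000000000040000000100000000000000000000001d00000018000000130000000e000000000000000000000000000000000000000000000000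

/-- The list of the pairs of the rank and the coefficient that is described by the bytes of `x`. -/
def decodeTerms (n : ℕ) : ℕ → List (ℕ × ℤ) :=
  Nat.rec (fun _ => []) (fun _ ih x =>
    Nat.rec [] (fun y _ => (y / 5, Int.subNatNat (y % 5) 2) :: ih (x / 256)) (x % 256)) n

/-- The bracket of the basis vectors of ranks `a` and `b`. -/
def bracketTerms (a b : ℕ) : List (ℕ × ℤ) :=
  decodeTerms 4 ((bracketTable >>> (32 * (28 * a + b))) % 4294967296)

/-- Base `4` digits of the weights of the basis vectors, increased by `1`. -/
def weightTable : ℕ := 0x85119141611494446450580555555555a52599196949961666465a52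

/-- The eigenvalue of `H_i` on the basis vector of rank `b`. -/
def weightAt (i b : ℕ) : ℤ := ((weightTable >>> (2 * (4 * b + i))) % 4 : ℕ) - 1

/-- The eigenvalue of `H_i` on `v_p`. -/
def vectorWeight (i p : ℕ) : ℤ := if p = i then 1 else if p = i + 4 then -1 else 0

/-! ### Verification of the tables by computation -/

section Checks

/-- The integral version of `elem`. -/
def elemInt (p q : Fin 4 ⊕ Fin 4) : Matrix (Fin 4 ⊕ Fin 4) (Fin 4 ⊕ Fin 4) ℤ :=
  Matrix.single p q 1 - Matrix.single q.swap p.swap 1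

/-- The integral matrices of the basis vectors. -/
def basisInt : BasisIndex → Matrix (Fin 4 ⊕ Fin 4) (Fin 4 ⊕ Fin 4) ℤ
  | .inl (⟨(i, j), _⟩, false) => elemInt (.inl i) (.inl j)
  | .inl (⟨(i, j), _⟩, true) => elemInt (.inl i) (.inr j)
  | .inr (.inl i) =>
    let h := fun j : Fin 4 => elemInt (.inl j) (.inl j)
    ![h 0 - h 1, h 1 - h 2, h 2 - h 3, h 2 + h 3] i
  | .inr (.inr (⟨(i, j), _⟩, false)) => elemInt (.inl j) (.inl i)
  | .inr (.inr (⟨(i, j), _⟩, true)) => elemInt (.inr j) (.inl i)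

theorem toMatrix_elem_eq_map (p q : Fin 4 ⊕ Fin 4) :
    toMatrix (elem p q) = (elemInt p q).map (Int.cast : ℤ → ℂ) := by
  rw [toMatrix_elem, elemInt]
  ext a b
  simp [Matrix.single_apply]

theorem toMatrix_basisVec (b : BasisIndex) :
    toMatrix (basisVec b) = (basisInt b).map (Int.cast : ℤ → ℂ) := by
  rcases b with ⟨⟨⟨i, j⟩, h⟩, _ | _⟩ | i | ⟨⟨⟨i, j⟩, h⟩, _ | _⟩
  · exact toMatrix_elem_eq_map _ _
  · exact toMatrix_elem_eq_map _ _
  · fin_cases i <;>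
      simp [basisVec, coroot, basisInt, H, toMatrix_elem_eq_map] <;> ext a b <;> simp
  · exact toMatrix_elem_eq_map _ _
  · exact toMatrix_elem_eq_map _ _

/-- The numbering of the basis of `ℂ⁸`. -/
def vectorIndex : Fin 8 ≃ Fin 4 ⊕ Fin 4 := (finSumFinEquiv (m := 4) (n := 4)).symm

set_option maxRecDepth 10000 in
-- This ties the packed table to the actual matrices; the tables for brackets and weights are then
-- checked against the entries given by this one.
theorem basisInt_eq_entry : ∀ (a : Fin 28) (q p : Fin 8),
    basisInt (basisIndex a) (vectorIndex q) (vectorIndex p) = entry a q p := by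
  decide +kernel

theorem imageIndex_lt : ∀ (a : Fin 28) (p : Fin 8), imageIndex a p < 8 := by
  decide +kernel

/-- The entries of a product of two basis vectors. -/
def prodEntry (a b q p : ℕ) : ℤ := entry a q (imageIndex b p) * imageCoeff b p

/-- The bound on the ranks is part of the test because `basisAt` reduces its argument modulo 28,
while the table of entries does not. -/
def bracketCheck (a b : ℕ) : Bool :=
  (bracketTerms a b).all (fun t => t.1 < 28) &&
    (List.range 8).all fun p => (List.range 8).all fun q =>
      prodEntry a b q p - prodEntry b a q p ==
        ((bracketTerms a b).map fun t => t.2 * entry t.1 q p).sum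

theorem bracketCheck_eq_true :
    ((List.range 28).all fun a => (List.range 28).all fun b => bracketCheck a b) = true := by
  decide +kernel

/-- A matrix that sends v_p to a multiple of v_q is multiplied by the difference of the weights of
v_q and v_p under the bracket with the diagonal matrix H_i. Columns that vanish impose no condition.
-/
theorem weight_check : ∀ (i : Fin 4) (b : Fin 28) (p : Fin 8), imageCoeff b p = 0 ∨
    vectorWeight i (imageIndex b p) - vectorWeight i p = weightAt i b := by
  decide +kernel

/-- Rank 18 is f_θ and rank 1 is e_θ, for θ = ε_1 + ε_2. The trace 2 becomes (f_θ | e_θ) = 1, and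
f_θ is orthogonal to every other basis vector. -/
theorem form_check : ∀ b : Fin 28, ∑ p : Fin 8, prodEntry 18 b p p = if b.val = 1 then 2 else 0 := by
  decide +kernel

theorem elemInt_diag : ∀ (i : Fin 4) (q p : Fin 8),
    elemInt (.inl i) (.inl i) (vectorIndex q) (vectorIndex p) =
      if q = p then vectorWeight i p else 0 := by
  decide +kernel

end Checks

theorem toMatrix_basisAt {a : ℕ} (ha : a < 28) (q p : Fin 8) :
    toMatrix (basisAt a) (vectorIndex q) (vectorIndex p) = (entry a q p : ℂ) := by
  rw [basisAt, toMatrix_basisVec, Matrix.map_apply, basisInt_eq_entry]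
  simp [Nat.mod_eq_of_lt ha]

/-- Each basis vector sends v_p to a multiple of a single v_r, so only one summand of the matrix
product survives. -/
theorem toMatrix_mul_apply {a b : ℕ} (ha : a < 28) (hb : b < 28) (q p : Fin 8) :
    (toMatrix (basisAt a) * toMatrix (basisAt b)) (vectorIndex q) (vectorIndex p) =
      (prodEntry a b q p : ℂ) := by
  rw [Matrix.mul_apply, ← Equiv.sum_comp vectorIndex]
  simp only [toMatrix_basisAt ha, toMatrix_basisAt hb]
  rw [Finset.sum_eq_single ⟨imageIndex b p, imageIndex_lt ⟨b, hb⟩ p⟩]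
  · simp [prodEntry, entry]
  · intro r _ hr
    have : imageIndex b p ≠ r := fun h => hr (Fin.ext h.symm)
    simp [entry, this]
  · simp

theorem toMatrix_injective : Function.Injective toMatrix := Subtype.val_injective

theorem eq_of_entries {x y : D4} (h : ∀ q p : Fin 8,
    toMatrix x (vectorIndex q) (vectorIndex p) = toMatrix y (vectorIndex q) (vectorIndex p)) :
    x = y := by
  apply toMatrix_injective
  ext a b
  obtain ⟨q, rfl⟩ := vectorIndex.surjective a
  obtain ⟨p, rfl⟩ := vectorIndex.surjective b
  exact h q p

theorem bracketCheck_of_lt {a b : ℕ} (ha : a < 28) (hb : b < 28) : bracketCheck a b = true := by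
  have h := bracketCheck_eq_true
  simp only [List.all_eq_true, List.mem_range] at h
  exact h a ha b hb

theorem bracketTerms_lt {a b : ℕ} (ha : a < 28) (hb : b < 28) :
    ∀ t ∈ bracketTerms a b, t.1 < 28 := by
  have h := bracketCheck_of_lt ha hb
  simp only [bracketCheck, Bool.and_eq_true, List.all_eq_true, decide_eq_true_eq] at h
  exact h.1

/-- The defining representation is faithful, so the structure constants can be compared entry by
entry. -/
theorem basisAt_lie {a b : ℕ} (ha : a < 28) (hb : b < 28) : ⁅basisAt a, basisAt b⁆ =
    ((bracketTerms a b).map fun t => (t.2 : ℂ) • basisAt t.1).sum := by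
  apply eq_of_entries
  intro q p
  have h := bracketCheck_of_lt ha hb
  simp only [bracketCheck, Bool.and_eq_true, List.all_eq_true, List.mem_range, beq_iff_eq] at h
  have h' := congrArg (Int.cast : ℤ → ℂ) (h.2 p p.2 q q.2)
  rw [LieHom.map_lie, Ring.lie_def, Matrix.sub_apply, toMatrix_mul_apply ha hb,
    toMatrix_mul_apply hb ha, ← Int.cast_sub, h']
  generalize hl : bracketTerms a b = l
  have hlt : ∀ t ∈ l, t.1 < 28 := hl ▸ bracketTerms_lt ha hb
  clear hl h h'
  induction l with
  | nil => simp
  | cons t l ih =>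
    simp only [List.map_cons, List.sum_cons, Int.cast_add, map_add, Matrix.add_apply,
      ih fun t ht => hlt t (List.mem_cons_of_mem _ ht), map_smul, Matrix.smul_apply,
      toMatrix_basisAt (hlt t List.mem_cons_self), Int.cast_mul, smul_eq_mul]

theorem form_basisAt {b : ℕ} (hb : b < 28) :
    form (basisAt 18) (basisAt b) = if b = 1 then 1 else 0 := by
  rw [form_apply, Matrix.trace, ← Equiv.sum_comp vectorIndex]
  simp only [Matrix.diag_apply, toMatrix_mul_apply (show 18 < 28 by norm_num) hb]
  rw [← Int.cast_sum, form_check ⟨b, hb⟩]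
  split_ifs <;> simp

theorem toMatrix_H (i : Fin 4) (q p : Fin 8) : toMatrix (H i) (vectorIndex q) (vectorIndex p) =
    if q = p then (vectorWeight i p : ℂ) else 0 := by
  rw [H, toMatrix_elem_eq_map, Matrix.map_apply, elemInt_diag]
  split_ifs <;> simp

theorem H_lie_basisAt (i : Fin 4) {b : ℕ} (hb : b < 28) :
    ⁅H i, basisAt b⁆ = (weightAt i b : ℂ) • basisAt b := by
  apply eq_of_entries
  intro q p
  rw [LieHom.map_lie, Ring.lie_def, Matrix.sub_apply, Matrix.mul_apply, Matrix.mul_apply,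
    ← Equiv.sum_comp vectorIndex, ← Equiv.sum_comp vectorIndex, map_smul, Matrix.smul_apply]
  simp only [toMatrix_H, toMatrix_basisAt hb]
  simp only [ite_mul, zero_mul, mul_ite, mul_zero, Finset.sum_ite_eq, Finset.sum_ite_eq',
    Finset.mem_univ, if_true, smul_eq_mul]
  rcases weight_check i ⟨b, hb⟩ p with h | h
  · simp [entry, show imageCoeff b p = 0 from h]
  · rw [← h]
    by_cases hq : imageIndex b p = q
    · simp only [hq]; push_cast; ring
    · simp [entry, hq]

theorem basisAt_surjective (b : BasisIndex) : ∃ a < 28, basisAt a = basisVec b := by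
  obtain ⟨a, rfl⟩ := basisIndex_bijective.2 b
  exact ⟨a, a.2, by simp [basisAt, Nat.mod_eq_of_lt a.2]⟩


/-! ### Commutation relations in `V^k` -/

theorem ι_smul_comm {k : ℂ} (a b : AffineLie) (w : V k) :
    UniversalEnvelopingAlgebra.ι ℂ a • (UniversalEnvelopingAlgebra.ι ℂ b • w) =
      UniversalEnvelopingAlgebra.ι ℂ b • (UniversalEnvelopingAlgebra.ι ℂ a • w) +
        UniversalEnvelopingAlgebra.ι ℂ ⁅a, b⁆ • w := by
  rw [LieHom.map_lie, Ring.lie_def, sub_smul, mul_smul, mul_smul]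
  abel

/-- Since K is central in U, the element (K - k) u equals u (K - k), which lies in the left ideal.
-/
theorem K_smul {k : ℂ} (w : V k) : UniversalEnvelopingAlgebra.ι ℂ K • w = k • w := by
  obtain ⟨u, rfl⟩ := (vacIdeal k).mkQ_surjective w
  have hcomm : ∀ u : U, UniversalEnvelopingAlgebra.ι ℂ K * u =
      u * UniversalEnvelopingAlgebra.ι ℂ K := by
    intro u
    induction u using InducedModule.ι_induction with
    | h1 => simp
    | hadd u w hu hw => rw [mul_add, add_mul, hu, hw]
    | hsmul c u hu => rw [mul_smul_comm, smul_mul_assoc, hu]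
    | hι x u hu =>
      have h := congrArg (· * u) (LieHom.map_lie (UniversalEnvelopingAlgebra.ι ℂ) K x)
      simp only [K_lie, map_zero, zero_mul, Ring.lie_def, sub_mul] at h
      rw [← mul_assoc, mul_assoc _ u, ← hu, ← mul_assoc]
      exact (sub_eq_zero.mp h.symm)
  rw [← map_smul, ← LinearMap.map_smul_of_tower, ← sub_eq_zero, ← map_sub, Submodule.mkQ_apply,
    Submodule.Quotient.mk_eq_zero, smul_eq_mul, hcomm, Algebra.smul_def, Algebra.commutes,
    ← mul_sub]
  exact Submodule.smul_mem _ u (Submodule.subset_span (.inr (by simp)))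

theorem ι_K_smul {k : ℂ} (c : ℂ) (w : V k) :
    UniversalEnvelopingAlgebra.ι ℂ (c • K) • w = (c * k) • w := by
  rw [map_smul, smul_assoc, K_smul, smul_smul]

theorem nonneg_smul_vac {k : ℂ} (x : D4) (n : ℕ) :
    UniversalEnvelopingAlgebra.ι ℂ (mode x n) • vac k = 0 := by
  rw [vac, ← map_smul, Submodule.mkQ_apply, Submodule.Quotient.mk_eq_zero, smul_eq_mul, mul_one]
  exact Submodule.subset_span (.inl ⟨x, n, rfl⟩)

theorem d_smul_vac {k : ℂ} : UniversalEnvelopingAlgebra.ι ℂ d • vac k = 0 := by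
  rw [vac, ← map_smul, Submodule.mkQ_apply, Submodule.Quotient.mk_eq_zero, smul_eq_mul, mul_one]
  exact Submodule.subset_span (.inr (by simp))

theorem basisAt_mul_add (m i : ℕ) : basisAt (28 * m + i) = basisAt i := by
  unfold basisAt; congr 3; omega

theorem basisAt_mod (g : ℕ) : basisAt (g % 28) = basisAt g := by
  unfold basisAt; congr 3; omega

/-- The generator with code `g = 28 (n - 1) + b`: the element `x(-n)`, where `x` is the basis vector
of rank `b`. -/
def generator (g : ℕ) : U :=
  UniversalEnvelopingAlgebra.ι ℂ (mode (basisAt g) (-((g / 28 + 1 : ℕ) : ℤ)))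

theorem generator_mul_add (m : ℕ) {i : ℕ} (hi : i < 28) : generator (28 * m + i) =
    UniversalEnvelopingAlgebra.ι ℂ (mode (basisAt i) (-((m + 1 : ℕ) : ℤ))) := by
  rw [generator, basisAt_mul_add, show (28 * m + i) / 28 = m by omega]

theorem ι_mode_basisAt_lie {k : ℂ} {a b : ℕ} (ha : a < 28) (hb : b < 28) (n : ℤ) (w : V k) :
    UniversalEnvelopingAlgebra.ι ℂ (mode ⁅basisAt a, basisAt b⁆ n) • w =
      ((bracketTerms a b).map fun t =>
        (t.2 : ℂ) • (UniversalEnvelopingAlgebra.ι ℂ (mode (basisAt t.1) n) • w)).sum := by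
  rw [basisAt_lie ha hb]
  generalize bracketTerms a b = l
  induction l with
  | nil =>
    rw [List.map_nil, List.sum_nil, ← modeₗ_apply, map_zero, map_zero, zero_smul]; rfl
  | cons t l ih =>
    rw [List.map_cons, List.sum_cons, List.map_cons, List.sum_cons, mode_add, map_add, add_smul, ih,
      mode_smul, map_smul, smul_assoc]

/-! ### Trees of PBW monomials -/

/-- A finite linear combination of words in the generators: `const c` is the constant `c`, and
`node g t s` is the sum of `s` and the product of the generator `g` with `t`. -/
inductive PBWTree : Type
  | const (c : ℤ) : PBWTree
  | node (g : ℕ) (t s : PBWTree) : PBWTree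

namespace PBWTree

/-- The vector of `V^k` that is described by a tree. -/
def eval (k : ℂ) : PBWTree → V k
  | const c => (c : ℂ) • vac k
  | node g t s => generator g • eval k t + eval k s

/-! The kernel evaluates the following functions on a large tree; they are written with recursors,
which it unfolds faster than structural recursion. -/

/-- The sum of a constant and a tree. -/
def addConst (a : ℤ) (x : PBWTree) : PBWTree :=
  PBWTree.rec (fun b => const (a + b)) (fun g t _ _ is => node g t is) x

/-- Whether the tree is the constant `0`. -/
def isZero (x : PBWTree) : Bool :=
  PBWTree.rec (fun c => Int.rec (fun n => Nat.rec true (fun _ _ => false) n) (fun _ => false) c)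
    (fun _ _ _ _ _ => false) x

/-- `node g t s`, without the first summand if `t` is zero. -/
def cons (g : ℕ) (t s : PBWTree) : PBWTree := Bool.rec (node g t s) s (isZero t)

/-- The sum of `node g t s` and a tree, in terms of the addition to `t` and to `s`. -/
def addNode (g : ℕ) (t _ : PBWTree) (addt adds : PBWTree → PBWTree) (x : PBWTree) : PBWTree :=
  PBWTree.rec (fun b => node g t (adds (const b)))
    (fun h t' s' _ is => Bool.rec
      (Bool.rec (node h t' is) (node g t (adds (node h t' s'))) (Nat.ble g h))
      (cons g (addt t') (adds s')) (Nat.beq g h)) x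

/-- The sum of two trees. -/
def add (x : PBWTree) : PBWTree → PBWTree :=
  PBWTree.rec addConst addNode x

/-- The product of an integer and a tree, computed leaf by leaf. -/
def smulAux (c : ℤ) (x : PBWTree) : PBWTree :=
  PBWTree.rec (fun b => const (c * b)) (fun g _ _ it is => node g it is) x

/-- The product of an integer and a tree. -/
def smul (c : ℤ) (x : PBWTree) : PBWTree :=
  Int.rec (fun n => Bool.rec (smulAux c x) x (Nat.beq n 1)) (fun _ => smulAux c x) c

/-- The sum of `y` and of the `c • F i` for the pairs `(i, c)` in the list. -/
def addTerms (F : ℕ → PBWTree) (l : List (ℕ × ℤ)) (y : PBWTree) : PBWTree :=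
  List.rec y (fun p _ ih => add (smul p.2 (F p.1)) ih) l

/-- The product of the generator `g` and a tree. -/
def mulGen (x : PBWTree) : ℕ → PBWTree :=
  PBWTree.rec (fun c g => cons g (const c) (const 0))
    (fun h t s it is g => Bool.rec
      (addTerms (fun b => it (28 * (g / 28 + h / 28 + 1) + b)) (bracketTerms (g % 28) (h % 28))
        (cons h (it g) (is g)))
      (node g (node h t s) (const 0)) (Nat.ble g h)) x

/-- The action of `x(0)`, where `x` is the basis vector of rank `b`. -/
def actZero (x : PBWTree) : ℕ → PBWTree :=
  PBWTree.rec (fun _ _ => const 0)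
    (fun h t _ it is b =>
      addTerms (fun b' => mulGen t (28 * (h / 28) + b')) (bracketTerms b (h % 28))
        (add (mulGen (it b) h) (is b))) x

/-- The action of `x(1)`, where `x` is the basis vector of rank `b`, at level `0`. -/
def actOne (b : ℕ) (x : PBWTree) : PBWTree :=
  PBWTree.rec (fun _ => const 0)
    (fun h t _ it is => Bool.rec
      (addTerms (fun b' => actZero t b') (bracketTerms b h) (add (mulGen it h) is))
      (addTerms (fun b' => mulGen t (28 * (h / 28 - 1) + b')) (bracketTerms b (h % 28))
        (add (mulGen it h) is)) (Nat.ble 28 h)) x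

/-- The formal derivative with respect to the generator `g`. -/
def deriv (g : ℕ) (x : PBWTree) : PBWTree :=
  PBWTree.rec (fun _ => const 0)
    (fun h t _ it is => Bool.rec (cons h it is) (add t (cons h it is)) (Nat.beq h g)) x

/-! ### Correctness of the operations on trees -/

variable (k : ℂ)

theorem eval_addConst (a : ℤ) (x : PBWTree) :
    eval k (addConst a x) = (a : ℂ) • vac k + eval k x := by
  induction x with
  | const b => change eval k (const (a + b)) = _; simp [eval, add_smul]
  | node g t s _ is =>
    change generator g • eval k t + eval k (addConst a s) = _
    rw [is, eval]; abel

/-- This direction is all that is needed: if reordering and cancellation end in the constant 0, then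
the vector is 0. A converse would rest on the linear independence of the PBW monomials, which is
used nowhere. -/
theorem eval_eq_zero_of_isZero {x : PBWTree} (h : isZero x = true) : eval k x = 0 := by
  rcases x with ((_ | n) | n) | ⟨g, t, s⟩
  · simp [eval]
  · exact absurd h Bool.false_ne_true
  · exact absurd h Bool.false_ne_true
  · exact absurd h Bool.false_ne_true

theorem eval_cons (g : ℕ) (t s : PBWTree) :
    eval k (cons g t s) = generator g • eval k t + eval k s := by
  unfold cons
  cases h : isZero t
  · rfl
  · rw [eval_eq_zero_of_isZero k h, smul_zero, zero_add]

/-- The addition merges two lists of leading generators: equal generators are collected, otherwise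
the smaller code goes first. The order affects only how well terms cancel, never the value, so
nothing is assumed to be sorted; the same holds for all operations below. -/
theorem eval_addNode (g : ℕ) (t s : PBWTree) (addt adds : PBWTree → PBWTree)
    (ht : ∀ y, eval k (addt y) = eval k t + eval k y)
    (hs : ∀ y, eval k (adds y) = eval k s + eval k y) (x : PBWTree) :
    eval k (addNode g t s addt adds x) = eval k (node g t s) + eval k x := by
  induction x with
  | const b =>
    change generator g • eval k t + eval k (adds (const b)) = _
    rw [hs, ← add_assoc, eval.eq_def k (node g t s)]
  | node h t' s' _ is =>
    change eval k (Bool.rec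
      (Bool.rec (node h t' (addNode g t s addt adds s')) (node g t (adds (node h t' s')))
        (Nat.ble g h)) (cons g (addt t') (adds s')) (Nat.beq g h)) = _
    cases h1 : Nat.beq g h
    · cases h2 : Nat.ble g h
      · change generator h • eval k t' + eval k (addNode g t s addt adds s') = _
        rw [is, eval, eval]; abel
      · change generator g • eval k t + eval k (adds (node h t' s')) = _
        rw [hs, eval, eval]; abel
    · obtain rfl := Nat.eq_of_beq_eq_true h1
      change eval k (cons g (addt t') (adds s')) = _
      rw [eval_cons, ht, hs, eval, eval, smul_add]; abel

theorem eval_add (x y : PBWTree) : eval k (add x y) = eval k x + eval k y := by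
  induction x generalizing y with
  | const a => exact eval_addConst k a y
  | node g t s it is => exact eval_addNode k g t s (add t) (add s) it is y

theorem eval_smulAux (c : ℤ) (x : PBWTree) : eval k (smulAux c x) = (c : ℂ) • eval k x := by
  induction x with
  | const b =>
    change eval k (const (c * b)) = _
    rw [eval, eval, Int.cast_mul, mul_smul]
  | node g t s it is =>
    change generator g • eval k (smulAux c t) + eval k (smulAux c s) = _
    rw [it, is, eval, smul_add, smul_comm]

theorem eval_smul (c : ℤ) (x : PBWTree) : eval k (smul c x) = (c : ℂ) • eval k x := by
  rcases c with n | n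
  · change eval k (Bool.rec (smulAux (Int.ofNat n) x) x (Nat.beq n 1)) = _
    cases h : Nat.beq n 1
    · exact eval_smulAux k _ x
    · obtain rfl := Nat.eq_of_beq_eq_true h
      simp
  · exact eval_smulAux k _ x

theorem eval_addTerms (F : ℕ → PBWTree) (l : List (ℕ × ℤ)) (y : PBWTree) : eval k (addTerms F l y) =
    (l.map fun p => (p.2 : ℂ) • eval k (F p.1)).sum + eval k y := by
  induction l with
  | nil => simp [addTerms]
  | cons p l ih =>
    change eval k (add (smul p.2 (F p.1)) (addTerms F l y)) = _
    rw [eval_add, eval_smul, ih, List.map_cons, List.sum_cons, add_assoc]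

/-- Summands of a commutator with a generator. -/
theorem eval_addTerms_bracket {a b : ℕ} (ha : a < 28) (hb : b < 28) (n : ℤ) (w : V k)
    (F : ℕ → PBWTree) (hF : ∀ i < 28,
      eval k (F i) = UniversalEnvelopingAlgebra.ι ℂ (mode (basisAt i) n) • w) (y : PBWTree) :
    eval k (addTerms F (bracketTerms a b) y) =
      UniversalEnvelopingAlgebra.ι ℂ (mode ⁅basisAt a, basisAt b⁆ n) • w + eval k y := by
  rw [eval_addTerms, ι_mode_basisAt_lie ha hb]
  congr 2
  apply List.map_congr_left
  intro t ht
  rw [hF _ (bracketTerms_lt ha hb t ht)]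

/-- If g exceeds the leading generator h, then g h t = h g t + [g, h] t. Both modes are negative, so
there is no central term. Codes g and h stand for the modes -(g/28 + 1) and -(h/28 + 1), so the
bracket has codes 28 (g/28 + h/28 + 1) + b. -/
theorem eval_mulGen (x : PBWTree) (g : ℕ) : eval k (mulGen x g) = generator g • eval k x := by
  induction x generalizing g with
  | const c =>
    change eval k (cons g (const c) (const 0)) = _
    rw [eval_cons]; simp [eval]
  | node h t s it is =>
    change eval k (Bool.rec (addTerms (fun b => mulGen t (28 * (g / 28 + h / 28 + 1) + b))
      (bracketTerms (g % 28) (h % 28)) (cons h (mulGen t g) (mulGen s g)))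
      (node g (node h t s) (const 0)) (Nat.ble g h)) = _
    cases Nat.ble g h
    · change eval k (addTerms (fun b => mulGen t (28 * (g / 28 + h / 28 + 1) + b))
        (bracketTerms (g % 28) (h % 28)) (cons h (mulGen t g) (mulGen s g))) = _
      rw [eval_addTerms_bracket k (Nat.mod_lt _ (by norm_num)) (Nat.mod_lt _ (by norm_num))
        (-((g / 28 + h / 28 + 1 + 1 : ℕ) : ℤ)) (eval k t), eval_cons, it, is, eval, smul_add,
        basisAt_mod, basisAt_mod]
      · rw [generator, generator, ι_smul_comm (mode (basisAt g) _), mode_lie, if_neg (by push_cast; omega), zero_smul,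
          add_zero]
        rw [show (-((g / 28 + 1 : ℕ) : ℤ) + -((h / 28 + 1 : ℕ) : ℤ)) =
          -((g / 28 + h / 28 + 1 + 1 : ℕ) : ℤ) by push_cast; ring]
        abel
      · intro i hi
        rw [it, generator_mul_add _ hi]
    · change eval k (node g (node h t s) (const 0)) = _
      simp [eval]

/-- The Leibniz rule moves x(0) to the right, where it kills the vacuum. Each commutator with a
generator keeps the mode and has no central term. -/
theorem eval_actZero (x : PBWTree) {b : ℕ} (hb : b < 28) :
    eval k (actZero x b) = UniversalEnvelopingAlgebra.ι ℂ (mode (basisAt b) 0) • eval k x := by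
  induction x with
  | const c =>
    change eval k (const 0) = _
    rw [eval, eval, smul_comm, show (0 : ℤ) = ((0 : ℕ) : ℤ) from rfl, nonneg_smul_vac]
    simp
  | node h t s it is =>
    change eval k (addTerms (fun b' => mulGen t (28 * (h / 28) + b')) (bracketTerms b (h % 28))
      (add (mulGen (actZero t b) h) (actZero s b))) = _
    rw [eval_addTerms_bracket k hb (Nat.mod_lt _ (by norm_num)) (-((h / 28 + 1 : ℕ) : ℤ))
      (eval k t), eval_add, eval_mulGen, it, is, eval, smul_add, basisAt_mod]
    · rw [generator, ι_smul_comm (mode (basisAt b) 0), mode_lie, if_neg (by push_cast; omega),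
        zero_smul, add_zero, zero_add]
      abel
    · intro i hi
      rw [eval_mulGen, generator_mul_add _ hi]

/-- `f_θ(1)` is the sum of a level-independent part and of `k` times a derivative. -/
theorem eval_actOne (x : PBWTree) : eval k (actOne 18 x) + k • eval k (deriv 1 x) =
    UniversalEnvelopingAlgebra.ι ℂ (mode (basisAt 18) 1) • eval k x := by
  induction x with
  | const c =>
    change eval k (const 0) + k • eval k (const 0) = _
    rw [eval, eval, smul_comm _ (c : ℂ), show (1 : ℤ) = ((1 : ℕ) : ℤ) from rfl, nonneg_smul_vac]
    simp
  | node h t s it is =>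
    -- Code 1 is the generator e_θ(-1): rank 1 and mode -1.
    have hderiv : eval k (deriv 1 (node h t s)) = (if h = 1 then eval k t else 0) +
        (generator h • eval k (deriv 1 t) + eval k (deriv 1 s)) := by
      change eval k (Bool.rec (cons h (deriv 1 t) (deriv 1 s))
        (add t (cons h (deriv 1 t) (deriv 1 s))) (Nat.beq h 1)) = _
      cases h1 : Nat.beq h 1
      · rw [if_neg (Nat.ne_of_beq_eq_false h1), zero_add]
        exact eval_cons k _ _ _
      · rw [if_pos (Nat.eq_of_beq_eq_true h1)]
        change eval k (add t (cons h (deriv 1 t) (deriv 1 s))) = _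
        rw [eval_add, eval_cons]
    have hact : eval k (actOne 18 (node h t s)) = UniversalEnvelopingAlgebra.ι ℂ
        (mode ⁅basisAt 18, basisAt h⁆ (1 - ((h / 28 + 1 : ℕ) : ℤ))) • eval k t +
        (generator h • eval k (actOne 18 t) + eval k (actOne 18 s)) := by
      change eval k (Bool.rec
        (addTerms (fun b' => actZero t b') (bracketTerms 18 h)
          (add (mulGen (actOne 18 t) h) (actOne 18 s)))
        (addTerms (fun b' => mulGen t (28 * (h / 28 - 1) + b')) (bracketTerms 18 (h % 28))
          (add (mulGen (actOne 18 t) h) (actOne 18 s))) (Nat.ble 28 h)) = _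
      -- Codes below 28 are the modes -1. Their bracket with f_θ(1) lies in 𝔤 ⊗ 1 and has to be
      -- moved on to the vacuum; for all other codes the bracket still has negative mode and is a
      -- generator again.
      cases h28 : Nat.ble 28 h
      · have hh : h < 28 := by
          by_contra hc
          rw [Nat.ble_eq_true_of_le (not_lt.mp hc)] at h28
          exact absurd h28 (by simp)
        change eval k (addTerms (fun b' => actZero t b') (bracketTerms 18 h)
          (add (mulGen (actOne 18 t) h) (actOne 18 s))) = _
        rw [eval_addTerms_bracket k (by norm_num) hh 0 (eval k t), eval_add, eval_mulGen,
          show (1 - ((h / 28 + 1 : ℕ) : ℤ)) = 0 by push_cast; omega]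
        exact fun i hi => eval_actZero k t hi
      · have hh : 28 ≤ h := Nat.le_of_ble_eq_true h28
        change eval k (addTerms (fun b' => mulGen t (28 * (h / 28 - 1) + b'))
          (bracketTerms 18 (h % 28)) (add (mulGen (actOne 18 t) h) (actOne 18 s))) = _
        rw [eval_addTerms_bracket k (by norm_num) (Nat.mod_lt _ (by norm_num))
          (-((h / 28 - 1 + 1 : ℕ) : ℤ)) (eval k t), eval_add, eval_mulGen, basisAt_mod,
          show (1 - ((h / 28 + 1 : ℕ) : ℤ)) = -((h / 28 - 1 + 1 : ℕ) : ℤ) by push_cast; omega]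
        intro i hi
        rw [eval_mulGen, generator_mul_add _ hi]
    -- The central term requires mode -1 and a non-zero pairing with f_θ. This singles out e_θ(-1),
    -- with coefficient (f_θ | e_θ) k = k.
    have hform : UniversalEnvelopingAlgebra.ι ℂ
        ((if (1 : ℤ) + -((h / 28 + 1 : ℕ) : ℤ) = 0 then
          ((1 : ℤ) : ℂ) * form (basisAt 18) (basisAt h) else 0) • K) • eval k t =
        k • if h = 1 then eval k t else 0 := by
      rw [ι_K_smul]
      by_cases hh : h < 28
      · rw [if_pos (by push_cast; omega), form_basisAt hh]
        split_ifs <;> simp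
      · rw [if_neg (by push_cast; omega), if_neg (by omega)]
        simp
    rw [hderiv, hact, eval, smul_add (UniversalEnvelopingAlgebra.ι ℂ _), ← is, generator,
      ι_smul_comm (mode (basisAt 18) 1), ← it, mode_lie, map_add, add_smul, hform]
    simp only [smul_add, ← sub_eq_add_neg, smul_comm k]
    abel

end PBWTree


/-! ### The singular vector -/

/-- The first byte of a sequence of bytes, and the remaining sequence. The bytes are the base `256`
digits of numbers with leading digit `1`. -/
def nextByte (s : ℕ × List ℕ) : ℕ × ℕ × List ℕ :=
  Bool.rec (s.1 % 256, s.1 / 256, s.2)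
    (List.rec (0, 0, []) (fun c l _ => (c % 256, c / 256, l)) s.2) (Nat.ble s.1 1)

/-- Decodes a tree of degree `deg` with at most `n` levels. A coefficient is given by two bytes, a
generator by one byte that is followed by the two subtrees, and the byte `0` stands for `0`. -/
def parse (n : ℕ) : ℕ → ℕ × List ℕ → PBWTree × ℕ × List ℕ :=
  Nat.rec (fun _ s => (PBWTree.const 0, s))
    (fun _ ih deg s => Nat.rec
      -- Coefficients are stored with the low byte first and shifted by 30000, which makes them
      -- non-negative.
      ((fun p => (fun q => (PBWTree.const (Int.subNatNat (p.1 + 256 * q.1) 30000), q.2))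
        (nextByte p.2)) (nextByte s))
      -- A non-zero byte is the code of the generator plus 1. Only the first subtree loses the
      -- degree g/28 + 1 of the generator; reaching degree 0 marks a coefficient, so no separators
      -- are stored.
      (fun _ _ => (fun p => Nat.rec (PBWTree.const 0, p.2)
        (fun g _ => (fun t => (fun u => (PBWTree.node g t.1 u.1, u.2)) (ih deg t.2))
          (ih (deg - (g / 28 + 1)) p.2)) p.1) (nextByte s)) deg) n

/-- The singular vector, encoded as described for `parse`. -/
def singularData : List ℕ :=
  [0x17cc814120300007f501716007f5015140086e8131202020000007020120a0900007020120807000078fc121202010101,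
    0x17f50140e007a40140d007a40170c007a40160b00660013080700007cc817120600007cc816120500007cc81512040000,
    0x1191200702016110077b815100077b8150f007f50150e007a40150d080069cc300077b81812007cc81410007cc8140f00,
    0x10077b81a12007cc816100077b8160f007f50160e007a40160d007020150c006600130a09006edc310070201c170077b8,
    0x169cc330077b81b12007a4014110077b81710007cc8170f007f50170e007a40170d007020150b0a006edc32007a401c14,
    0x1120f0086e8120e0e006edc2e007e0c1210007e0c120f0086e8120e007b84120d0d00006d9812110c00006d981c120b00,
    0x12c71d02b66d82a666c2912006b102e0077b8121010006b102e007e0c12100077b8120f0f0060f02e0086e812100086e8,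
    0x1007a40120e0800007020140807000078fc121204030096f04a00759c261700759c251600759c241500759c23140071d0,
    0x1007a401210007a40120f007a40120e0070201508070400007020241200007020120b0a00007020120c007020140a0900,
    0x1120800007a40120c007020160807000078fc1212060500007020231200007a4012110a00007a401c12007020150a0900,
    0x1702012110800007a40120b0070201708070600007020261200007a40120f007a40120e0a00007020160a09000070201c,
    0x170201a0900702019080800007f500c0b0070201808070700007020251200007a401210007a40120e007020170a090000,
    0x1e029006d98100f0070201070200f70200e0e0072a81072a80f70200e72a80d0d007a40110c007a401c0b0070201b0a00,
    0x182b02012007bf0240e007890240d006e70250c006e70260b00006b10100b0a00006b100f0c007020180a09007a402a76,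
    0x10f007bf0230e007890230d00006b10110f0a00006b101c10007020190a0900007f501c1108080062a0400066001e1400,
    0x10a0a00006b101c0c0070201a0a09090062a03f007bf0251c0066001e150082b01f12007bf02611007bf02310007bf023,
    0x12a76e0290077b8100f0070201070200f70200e0e0072a81072a80f70200e72a80d0d007a40110c007a401c0b0070201b,
    0x16b10110b0a0a0062a042006e70241c0066001e160082b02212007bf0260f007bf0260e007890260d007bf0230c007a40,
    0x1000069601e120d0062a0410066001e170082b02112006e702411007bf02510007bf0250e007890250d007bf0230b0000,
    0x1fc1313020202000072f026250072f024230082b02e1e0070b03a1200006e701e121000006e701e120f000067b01e120e,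
    0x11a1309000077b8191308000077b818130700007cc817130600007cc816130500007cc815130400007cc8141303000078,
    0x1130d0d000070201917007a401b15006d9813110c000070201916007a401a15006d981c130b000077b81b130a000077b8,
    0x1007cc8130e0e00831c2f0070201a170070201b16007020181500702019140078fc13100078fc130f007cc8130e007b84,
    0x1a81914100078fc2f0072a81a170077b81b160077b818150072a819140078fc13100f007cc82f007cc81310007cc8130f,
    0x16c2913000066001b1a00660019181200007a4018160070201a14110078fc2f0077b81a170072a81b160077b818150072,
    0x13019006edc3118006fb436007a401c1817006aa43716006aa43415006fb4350070201c1b14006c542c6c542b5be02a66,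
    0x1007cc81614050000897017160091081514009108131204000078fc1414030300a1104b006edc321b0073ec331a0073ec,
    0x11b16007f5018150077b819140072a813100072a8130f007a40130e007020130d08000077b818140700007cc817140600,
    0x10c0b00007a4018170072a81b14006b10130b0a00007a4018160072a81a14006b10130c09006c542f007a401a17007a40,
    0x17a40170e007a40170d0c006edc320072a81c14007f501a12007cc816100077b8160f007a40160e007a40160d006b1015,
    0x11812007e0c1410007e0c140f0081d8140e007b84140d0d00716433007f501b120072a814110077b81710007cc8170f00,
    0x10081d81812007e0c14100077b8140f0f007e0c300084601812007f501410007f50140f007cc8140e0e0073ec30007a40,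
    0x1007aac27160071d02c71d02b666c2a666c2914006594241300708c34120077b8300081d818120077b81410100077b830,
    0x10f007a40130e007020130d0700007cc817150600007cc8161505000078fc1515040400b2c84c0067442e18007aac2817,
    0x11a15007f501c1309000077b8191508006c542f007a401a17007a401b160077b81815007f501914007cc81310007cc813,
    0x1150e007b84150d0d000072a815110c000072a81c150b00007a4019170072a81b15007f5013110a00007a4019160072a8,
    0x1007a401510007a40150f007cc8150e0e0078fc310070201c17007a40191200702016110078fc15100078fc150f0081d8,
    0x1a8161110007e0c310072a81c170077b819120077b816110078fc15100f00831c310070201c1700846019120070201611,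
    0x129150065942313007aac35006b101c1b12006edc32006b101c14006b101a12110078fc310077b81c170077b819120072,
    0x108131206000078fc1616050500adb84d0078fc331c0067442e19006fb43817006fb42d16006c542c6c542b666c2a666c,
    0x109000072a81916007a401a15006b101c1308000072a81816007a401a14007f50130c0700009108171600897015140091,
    0x12f007f501a170077b81b16007a401815007a4019140072a81310007cc8130f007a40130e007020130d0a000077b81a16,
    0x1dc31007f501c17006b1019120072a816110072a815100077b8150f007020150e007020150d0c000072a81c160b006c54,
    0x1007a40160f007cc8160e0e0078fc32007a401c14007a401a12007e0c16100078fc160f0081d8160e007b84160d0d006e,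
    0x1d81a120077b8161010007e0c320077b81c140077b81a1200767416100f00831c32007a401c140084601a12007f501610,
    0x1d02c6c542b666c2a666c2916006fb42815007aac38140065942613007aac36007f501c1812007f5032007cc81c140081,
    0x115006b10131108000072a81817007a401b14007f50130b07000078fc1717060600b0404e007164301c0067442e1a0071,
    0x11a17007f501b16007a401815007a401914007cc813100072a8130f007a40130e007020130d09000072a81917007a401b,
    0x1a81c17006b101912007f5016110077b815100072a8150f007020150e007020150d0b000077b81b170a006c542f0077b8,
    0x10073ec33007a401b12007a4014110078fc1710007e0c170f0081d8170e007b84170d0d000072a817110c007b84310072,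
    0x11b12007cc8141100767417100077b8170f0f007e0c330084601b12007a401411007a401710007f50170f007cc8170e0e,
    0x115007aac2d14006594251300708c371200716430007f50181211007b84330077b81b120077b81411100077b8330081d8,
    0x10900007f501b1a007cc8191808000073ec1818070700b0404f0067442e1b006c542c71d02b666c2a666c2917006fb427,
    0x17a401b0e0c007aac360077b81c180072a81a100077b81a0f007a401a0e007f50190c0b000072a81b180a000072a81a18,
    0x1180e0e0076e0340073ec18100073ec180f0072a8180e0073ec180d0d007824370077b818110077b81b100072a81b0f00,
    0x1140078fc20130072a8340077b81810100072a83400767418100077b8180f0f006d2c34007a401810007a40180f0077b8,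
    0x10a000072a81a1909000073ec19190808006b1050006edc281b006edc271a0071d02c71d02b774c2a76082918006fb41d,
    0x1190e0e0076e0350073ec19100073ec190f0072a8190e0073ec190d0d000077b819110c000077b81c190b000072a81b19,
    0x1006d981c1b0072a81a111000723c350072a81c1b006d981a1100716419100f00723c350070201c1b0070201a110077b8,
    0x1007b84381b007b842d1a0078242c78242b774c2a76082919006fb41d150078fc1f13007c5c36007f501c181100774c35,
    0x110006d98190f007020190e0c000077b81c1a0b00007cc81b1a007f5019180a000073ec1a1a09090070205100723c371c,
    0x177b81a0e0e0076e0360073ec1a100073ec1a0f0072a81a0e0073ec1a0d0d007c5c35006b101c1b0077b81a110072a819,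
    0x1fc2213007020360072a81c180077b81a101000723c360077b81c180078fc1a100f00723c36007a401c18007a401a1000,
    0x1000073ec1b1b0a0a006d9852007824341c0071d02c78242b774c2a7608291a007b842819006edc3818006fb41d160078,
    0x10072a81b0e0073ec1b0d0d000077b81b110c006fb4350077b81c1b006b101a11006d9819100072a8190f007020190e0b,
    0x1a818110078fc1b100077b81b0f0f006d2c37007a401811007a401b0f0077b81b0e0e0076e0370073ec1b100073ec1b0f,
    0x1774c2a7608291b007b842719006edc2d18006fb41d170078fc21130078243411006fb4370077b81811100072a8370072,
    0x1380071641c100071641c0f006d981c0e0071641c0d0d00005e681c110c000078fc1c1c0b0b006d98530078242c71d02b,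
    0x1006b7c2215007a4038006d981c1010007e0c380071641c100f007f5038006d981c10006d981c0f006d981c0e0e007a40,
    0x10e007164110d0d000078fc11110c0c00537054007f502c6c542b72a82a77b8291c0083f4231a00666c2619007ee41f16,
    0x171641110006d98110f0f007f502d006d981110006d98110f006d98110e0e007a402d0071641110007164110f006d9811,
    0x1005370490083f4231b00666c2519007ee41f17006b7c2115006c542c7f502b72a82a77b82911007e0c2d10007a402d00,
    0x1142b6d2c2a6aa4290076c51010007a401076c50f0f007f50107f500f7f500e0e00785a10785a0f7b840e76c50d0d0d0d,
    0x17716100f0f0070202c70202b63782a6018290078fc10100080941078fc0f0f0080941080940f7cc80e0e0e0073142c73,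
    0x11500759c1f140069cc1e130069cc1d12007a4028110072a82b6c542a6aa429100072a82c6c542a6aa429007716101000,
    0x173144770f84670f845007a40271c0076e0261b0076e0251a0076e024190076e0231800759c221700759c211600759c20,
    0x178fc100f0f0070202c70202b63782a6a38290078fc10100080941078fc0f0f007cc8107cc80f78fc0e0e0e0e00731448,
    0x11500759c1f14007cc81e130056d01d12007f5028110070202b63782a6a3829100070202c63782a6a38290078fc101000,
    0x18f5847a9804670f845007f50271c0078fc261b0078fc251a0078fc24190078fc231800759c221700759c211600759c20,
    0x17a401f140078fc1e130066001d12007a402811006c542a6fb429100076742c70202a73142900743d10100f0f008f5848,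
    0x1478f5846731445007e0c271c007e78261b006fb4251a006fb42419007e782318007a40221700708c211600708c201500,
    0x1007a40211600708c2015007a401f140078fc1e130066001d12007e0c28110076742b70202a7314291010008244486d98,
    0x17ee4221411006d98488244478f5846731445007a40271c006fb4261b007e78251a006fb42419007e78231800708c2217,
    0x1a83a130072a839007164221b007164211a00716420190071641f1812003ca84400666c241a0083f42618006b7c201600,
    0x1006b7c201c007aac1e1a170077283d007aac1e1b160077283c007aac1e18150077283b007ee4211c007aac1e19140072,
    0x16b102f1e0081002e1d003ca8431c00a0384200666c241c1b00a038411a00a038401900a0383f0083f4251c180077283e,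
    0x12d2800696038270064e037260073a436250073a435240064e03423006fb4332200796832210079683120006fb4301f00,
    0x1030300b790649f1863fd50627ba8610073802c2b007bf02c7bf02b7aac2a2a0078002c78002b7d582a7a1c2929006960,
    0x1007020241400007020120c0b00007020140b0a00007020140c09007a4030007a401812007a40140e0800007cc8141204,
    0x18460140e007a40140d007a40170c007a40160b006b1013080700007cc817120600007cc816120500007cc81512040400,
    0x1191200702016110077b815100077b8150f008460150e007a40150d080069cc300077b818120081d814100081d8140f00,
    0x10072a81a12007cc816100077b8160f007f50160e007a40160d006b10150c006b10130a09006edc310070201c170077b8,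
    0x164bc330072a81b12007f5014110077b81710007cc8170f007f50170e007a40170d006b10150b0a006edc32007f501c14,
    0x1120f0081d8120e0e006edc2e007e0c1210007e0c120f0086e8120e007b84120d0d000072a812110c000072a81c120b00,
    0x12c71d02b6be82a666c2912006b102e0077b8121010006b102e007e0c12100077b8120f0f0060f02e0081d812100081d8,
    0x1007a40160e0800007a40140c0700007cc8141206050091e04a00759c261700759c251600708c241500708c23140071d0,
    0x17a40120f0c007a4030007a401812007a40140f007a40140e007020160b0a00007020160c09000070201c14007a401a12,
    0x10e007020170c09007a4033007a401b120070201411007a40170e0800007a40140b070600007020241600702026140000,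
    0x1101a0b0807000070202417007020251400007a4012100b00007020170b0a007a4030007a401812007a401410007a4014,
    0x1270c0082b028006b10106b100f60f00e0c0b00007a40180b0a00007a40180c0900789034007a40180e006b101b0c006b,
    0x1007f501a10007a401a0e007020190c0900006b101c1b006b101a11007a40190e080800007a40241800738020140082b0,
    0x17020110e0c00006b101c100070201c0e0b006b1037007f501811007f501b0f007a401b0e007020190b0a00007f501c18,
    0x1738029007cc8100f007a40107a400f7a400e0e0e0071d02a0077b81077b80f7a400e0e0077b80e0d0d00006b10110f00,
    0x170202419007bf0231800660020150082b01f140084601e130067b01d120081002811006e702a10006e702a0f0069602a,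
    0x110180f0066001b0c0066001a0b0a00007a401a0c0909007a40487a404796f046008100271c007380261b007380251a00,
    0x17020107a400f70200e0e0072a81072a80f70200e72a80d0d007a40110c0c000066001c0c0b0082b034006b101810006b,
    0x10071d0241a007da0261800660020160082b022140071d0280f007bf0280e007890280d0073802a76e0290077b8100f00,
    0x1007a401070200f70200e0e0072a81072a80f70200e72a80d0d006600110c007a401c0b0b00007a401b0b0a0a00537044,
    0x1430071d0241b007da0251800660020170082b021140071d02710007bf0270e007890270d0073802a76e0290077b8100f,
    0x1003f3042007380241c0066001e160082b02212007f502610007bf0260f0082b0260e007890260d006e70230c0b005370,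
    0x1240e0072a8240d0d003f30410066001e170082b021120073802411007bf02510007f50250f0082b0250e007890250d0c,
    0x1e01e14005a3020120070202410007020240f006960240e0e000069601e1400696020120072a824100072a8240f006cc0,
    0x13c0073801e181200660040006e701e14006e7020121000660040006e701e14006e7020120077b824100f008cd0400076,
    0x1007a40150e0704040094b05c006c302726006c302825007c802a76e029240082b02e20008100301e0070b03a140070b0,
    0x10605000070202315000070201c121100007a4015110a00007a401c1509007a4031007a401912007a401510007a40150f,
    0x17a401c1609000070201c1508007a4032007a401a12007a401610007a40160f007a40160e007a40150c0700007cc81512,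
    0x10b0706000070202316007020261500007a401c1210007a4031007a401912007a401611007a40150f007a40150e0a0000,
    0x11912007a401510007a40150e0900007020151108007a4033007a401b12007a401710007a40170f007a40170e007a4015,
    0x1180e007f501b0c007f501a0b0707000070202317007020251500007a4012110f00007a4017110a00007a401c17007a40,
    0x109006e7035007f501c1b007f501a11007a401910007a40190f007a40190e08006b1034007a401810007a40180f007a40,
    0x1201b10007a401b0f007a401b0e006b10190b0a00702036007a401c18007a401a100070201a0f007a401a0e006b10190c,
    0x12d0070201110007a40110f007020110e0c007bf038007a401c100070201c0f0070201c0e0b006b1037007a4018110070,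
    0x171d02c71d02b71d02a0077b81010007a401077b80f0f007cc8107cc80f7a400e0e0077b81077b80f77b80e0d0d007bf0,
    0x1c81010007cc8100f0f006e702c6e702b69602a738029007a4010100086e8107a400f0f007f50107f500f7a400e0e0e00,
    0x10082b020150066001f140084601e130067b01d120070202811006b102b70202a73802910006b102c70202a738029007c,
    0x1702019110a000070201c1909080091e04891e04796f046007020271c007380261b007380251a007bf024190070202318,
    0x11c1a0909000082b02d1c007a4023190073801f150082b0381100006b101c111000006b101c110f000060f01c110e0000,
    0x177b81c0d0d000084601c110c000070201c1c0b007380350084601c1b0084601a11007f501910007f50190f0a00007020,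
    0x16038007cc81c100f006e70380084601c10007a401c0f007a401c0e0e0071d0380077b81c100077b81c0f007a401c0e00,
    0x1c0540067b02c81002b76e02a7380291c0071d0231a007da026190066001f160082b02215006b1038007f501c10100069,
    0x171d02d0077b811100077b8110f007a40110e0077b8110d0d0000702011110c000084601c110b000070201b110a0a0087,
    0x176e02a738029110069602d10006b102d007cc81110007f50110f0f006e702d007a401110008460110f007a40110e0e00,
    0x1230d0d0000738023110c00007380231c0b0087c0490071d0231b007da025190066001f170082b021150081002c67b02b,
    0x1a0230f006960230e0e000071d0251c0069601e150069601f120071d02611006f482310006f48230f006cc0230e0072a8,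
    0x1120071d02611006a382310006e70230f0f008cd03f0067b0251c0076e01e15005a301f120067b026110062a023100062,
    0x1009c003f0071d0251c007da01e150060f01f12006e702611006e70231010009c003f006e70251c007da01e150060f01f,
    0x11c000084601e1c170070b03a150070b03b0067b0211c0073801e191200ab3042006e70241c0084601e160067b0221211,
    0x1c8161206050500a0805b007e302d26007e303825007e302c7e302b7c802a76e029230082b02e1f0071d0311e00ab3041,
    0x17020261600007a401c120c007a4032007a401a12007a40160f007a40160e0a000070201c160800007a40160c0700007c,
    0x11812007cc81410007cc8140f007f50140e007a40140d007f50170c007f50160b006b1013080700007cc8171206060000,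
    0x109006edc31006b101c170072a81912006b1016110077b815100077b8150f007f50150e007a40150d080064bc300072a8,
    0x120150b0a006edc32007a401c140077b81a120081d816100077b8160f008460160e007a40160d007020150c006b10130a,
    0x172a812110c000072a81c120b0069cc330077b81b12007a4014110077b817100081d8170f008460170e007a40170d0070,
    0x10f0060f02e0081d812100081d8120f0081d8120e0e006edc2e007e0c1210007e0c120f0086e8120e007b84120d0d0000,
    0x100759c241500759c23140071d02c71d02b6be82a666c2912006b102e0077b8121010006b102e0078fc12100077b8120f,
    0x109007380360066001c18006b101a10007f501a0f008460190c0800007020180c07070091e04a00708c261700708c2516,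
    0x17020110c0c000084601c0c0b006b1034007f501810007a40180f007a40180e007a401b0c007f501a0b0a000070201a0c,
    0x171d0280d0067b02b76e02a738029007cc8107f500f0f007a401084600f7a400e0e0077b81077b80f7a400e77b80d0d00,
    0x17a401c1a0900007a401c1908080096f044007da0241a0071d026180082b020160066002214006b10280f006e70280e00,
    0x10e0072a81c0d0d000066001c110c00007a401c1c0b007020350070201c1b006b101a11007020190f007a40190e0a0000,
    0x1008100380077b81c100f007bf038007a401c100070201c0f0070201c0e0e007890380072a81c100072a81c0f0070201c,
    0x10e007f50190c0a090062a0540069602b73802a76e0291c007da0231a0071d026190082b01f1600660022150071d03810,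
    0x1007a40261a00738022160067b038007f501c10007f501c0f0089701c0e0c006e7036006b101c18007a401a0f007a401a,
    0x1006b101c100070201c0f0070201c0e0b006b1037007f501811007a401b0f007a401b0e006b10190b0a0a000067b0281c,
    0x12b71d02a0077b81077b80f0f0077b8107cc80f7a400e0e0077b80f77b80e0d0d00007a40110f007020110e0c007bf038,
    0x12a100070202a7380290072a8100f0f006e702b69602a7380290077b8107a400f0f007a40107f500f7a400e0e0e0071d0,
    0x1261b007bf0251a0073802419007380231800660022170082b021160084601e130067b01d1200810028110078902b6e70,
    0x12611006e7023100071d0230f0067b0230e0071d0230d0c00007380261c0b007a404891e04796f046007020271c007020,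
    0x100696022120072a82610006f48260f006cc0260e0072a8260d0d00ab303f007bf0251c0084601e150067b01f12007380,
    0x10f0f008cd0420082b0241c0076e01e16005a30221200702026100062a0260f006960260e0e00007890241c0069601e16,
    0x100660042007f50241c006e701e16006e70221210009c0042007bf0241c007da01e160060f02212006d982610006e7026,
    0x124007e3028230082b02e220071d0321e003f30401c0070b03a16000066001e1c140070b03e0082b0201c0073801e1a12,
    0x11b12007a401710007a40170e090000702017110800007a40170b07060600a2305e007e302b7c802a76e02926006c3038,
    0x166001811007f501b10006b101b0f008460190b0800007020180b070700007020251700007a4012110b007a4033007a40,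
    0x10070201c0b0b000070201b0b0a006b1034007a401810007f50180f007a40180e007f501b0c007a401a0b090082b03700,
    0x1b02c76e02a738029007f501010007cc8100f008460107a400f7a400e0e0077b81077b80f7a400e77b80d0d008460110c,
    0x1007a40191108080096f043007da0241b0071d025180082b020170066002114006b102710006e70270e0071d0270d0067,
    0x1a8110d0d00007a4011110c000066001c110b00007a401b110a00006b101c1b0070201a110070201910007a40190e0900,
    0x12d0077b811100f007bf02d0070201110007a40110f007020110e0e0078902d0072a811100072a8110f007020110e0072,
    0x110190c09090062a049007da0231b0071d025190082b01f1700660021150069602c73802a76e029110081002d100071d0,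
    0x170201c0e0b00789037006b101811007a401b10007a401b0e007f50190b0a00007f501c18007a401a10007a401a0e006b,
    0x10f007cc81077b80f7a400e0e0077b81077b80e0d0d007bf02d0070201110006b10110f007020110e0c00007a401c1000,
    0x1006e702c69602a738029007a4010100077b8100f007f50107a400f7a400e0e0e0071d02c71d02a0077b810100077b810,
    0x123180082b0221700660021160084601e130067b01d1200702028110070202a738029100078902c6e702a0072a810100f,
    0x1501110007f50110f008970110e0b0a0091e0487a404796f046008100271c007bf0261b007020251a0073802419007380,
    0x1007bf026110071d02310006e70230f0067b0230e0071d0230d0b00007a40251b00738021170067b027110067b02d007f,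
    0x111006f4825100072a8250f006cc0250e0072a8250d0d0000738025110c00ab303f007380251c0084601e150067b01f12,
    0x1d0410076e01e17005a3021120082b024110062a02510007020250f006960250e0e000069601e17006960211200789024,
    0x1007da01e170060f02112007bf02411006e7025101000660041006e701e17006e702112007f502411006d9825100f008c,
    0x17e3027230082b02e21008100331e0070b03a170070b03d0073801e1b12003f30400066001e140082b0201211009c0041,
    0x1901d100078901d0f007bf01d0e007bf01d0d0800007380201807070093005d007e302c7c802a76e02925006c302d2400,
    0x17380201b00738021180a00007380201a00738022180900819039007bf0221b007bf0211a007a402019007a401f180078,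
    0x10073802011007890210f0071d0210d0c006f003e007380201c0078901e1a00789022100071d0220d006e701f0c0b0000,
    0x1e0200f0076e0200e0e0070b03c0076e01e180076082010007608200f007a40200e007968200d0d006f003d0078901e1b,
    0x1241d0072603a18006cc03c0078901e1810006cc03c0078901e180077b820100f006a803c0078901e180076e020100076,
    0x11f1b00738021190a000073801f1a007380221909000073801f1908080084f0580073802a726029200071d0341e0070b0,
    0x176e01e1900789022110079681f100079681f0f007a401f0e0079681f0d0d000073801f110c000073801f1c0b00007380,
    0x1f03b00789022110077b81f100f006a803b0078901e190076e01f100076e01f0f0076e01f0e0e0070b03b007890211c00,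
    0x170b0231d007b603d1c000071d01e1c1b0072603a19007b603e006e70201c0071d01e1a110072f03b007890211c100072,
    0x119007bf01f180078901d100078901d0f007bf01d0e007bf01d0d0a00007380221a09090084f0570073802a7260291f00,
    0x1211c0071d01e1900738022110078901f0f0078901f0d0c00007380221c0b00819039007a40221b007a40211a007bf020,
    0x10076e0220e0e0070b03e0071d0201c0076e01e1a0076082210007968220f007a40220e007968220d0d007b603b007bf0,
    0x1901e1c18006cc03e007890201c0078901e1a100072f03e00745822100f006a803e0078901e1a0076e022100076e0220f,
    0x178901f100078901f0d0b00007380211b0a0a0086a05a0073802a726029220070b0261d006f003c1c0072603a1a000078,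
    0x10079682110007608210f007a40210e007968210d0d0000738021110c007b603b007380211c0071d01e19007bf0221100,
    0x190201100745821100f006a803d0078901e1b0076e021100076e0210f0076e0210e0e0070b03d0076e01e1b0071d02011,
    0x173802a726029210071d0371e0070b0251d0072603a1b006f003c0078901e18110072f03d10006cc03d0078901e1b0078,
    0x121007770251f0078903a1100007a401e110d0c000072f02322007770261f0078903a1c00007a401e1c0d0b0083405900,
    0x13a0070201e100070201e0f0070201e0e0e007ad03a0070f81e100070f81e0f006cc01e0e0070f81e0d0d0d000072f023,
    0x140560072f025220072f026210072f023200072f0241f007a402a8340291e0078903a100078903a0072a81e100f007bf0,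
    0x10f007bf0560072f025220072f026210072f023200072f0241f008070291e0071d03a100071d03a0f0071d03a0e0e0071,
    0x1f0262011007890560072f025220072f02320007ad0291e10007890560072f026210072f02320007ad0291e0073803a10,
    0x11e1600007bf0201e1500007bf01f1e1400007bf01e1e13000067b022210067b0201f006e701e1d120000777024220072,
    0x124210072f025201c00006de0261e1b00006de0251e1a00006de0241e1900006de0231e1800007bf0221e1700007bf021,
    0x10086403b240086403c230084f041220084f042210084f03f200084f0401f008190488190478df0468bb0451e00007770,
    0x1000078fc1313040300000070201b1a007020191813020202006f30720078903a2a0068103a290086403d260086403e25,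
    0x11b1a007020191814007020341300007a4018131000007a4018130f00007a4018130e00007a401b130c00007a401a130b,
    0x17a402f19000070201b1a007020191815000070201c1b13000070201a131100007a4019130e0400007a402f1800007020,
    0x170201b1a00702019181600007a401c181300007a401a131000007a401a130e0000702019130c000078fc131306050000,
    0x1007020191817007020371300007a4018131100007a401b130f00007a401b130e0000702019130b0600007a402f1a0000,
    0x170201a19180900000070201b1a19000070201919180800000070201b1a0070201918180700007a402f1b000070201b1a,
    0x100006b101a1a1100006b101a191000007f5019190c0b00000070201b1b1a000070201b19180a00000070201b1a1a0000,
    0x10087c0371900007a401b1a007a4019181100006b101b190f0c00005d9035007a401c1b1a008cd0361900007a401c1918,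
    0x1000072a81b1a0072a819180f000070201b1a00702019180e000072a81b1a0072a819180d0d000076e035006b101c1b1b,
    0x1201b1a00702019180e0e00007890361b007890371a007890341900789035180069601d13000072a81b1a0072a8191810,
    0x11b007020371a00702034190070203518006b101d13000070201b1a007020191810000070201b1a00702019180f000070,
    0x160361b007bf0371a007bf0341900696035180070201d1300006b101a1811000077b81b1a006d981918100f0000702036,
    0x1341a0076e036007f501c181811000071d0361b006960371a007bf0341900738035006b101c1b180070201d1310000069,
    0x184601d1b16000084601d1815000084601d19140070b0390067b0221b0067b0211a0067b020190067b01f1813000087c0,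
    0x1002b91e02a76e0291b1a0025e05019003000510062a0371c0081002c81002b91e02a76e0291918000084601d1a170000,
    0x14018130800007cc8141304030300007800373600780035340045f02f1d002af0520087c0341c1b002af0530081002c81,
    0x1007020341400007a4018141000007a4018140f00007a4018140e00007a401b140c00007a401a14007020130c0b00007a,
    0x1a81b130a000072a81a1309000077b8191308000077b818130700007cc817130600007cc816130500007cc81513040400,
    0x1007cc8130e007b84130d0d000070201917007f501b150072a813110c000070201916007f501a150072a81c130b000072,
    0x1b813100077b8130f0077b8130e0e00831c2f0070201a170070201b16007020181500702019140078fc13100078fc130f,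
    0x114100073ec2f0072a81a170077b81b16007cc818150072a819140078fc13100f0072a82f007a401815007a4019140077,
    0x11300006b101b1a006b1019181200007a401816006b101a14110073ec2f0077b81a170072a81b16007cc818150072a819,
    0x10073ec3118006fb436007a401c1817006aa437160065943415006fb435006b101c1b14006c542c6c542b60f02a666c29,
    0x100007a401a160b00007a4018130a00007a401a130800007cc81413060500ab304b006edc321b0078fc331a0078fc3019,
    0x100007a401816007a401a141000007a4018160f00007a401816007a401a140e00007a401b160070201914007a40130f0c,
    0x17a401a170070201914007a4013100b00007a4018130900007a401b13080600007a403218007020341600007a401c1814,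
    0x11400007a4018141100007a4018171000007a401817007a401b140f00007a401817007a401b140e00007a401b170c0000,
    0x1341800007a4018181000007a4018180f00007a4018180e00007a401b180c00007a401a180b0700007020341700702037,
    0x17f501b1a007a4019181000007f501b1a007a4019180f00007a4019180e000070201b190c000070201a190b0800007020,
    0x1000070201a1a0b09000067b0361b0071d0371a007a403419006e7035006b101c1b180076e01d1300006b101a18110000,
    0x1007da0341a007bf036007f501c181800007a401a1810000070201a180f00007a401a180e000084601b1a007f5019180c,
    0x1007f50181811000070201b181000007a401b180f00007a401b180e000070201b1b0c000084601b1a007f5019180b0a00,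
    0x1e0350084601c1b0084601a11006b101910006b10190f0060f0190e0c000070201c1a0b0b00007da0341b0067b0371800,
    0x10070201c180084601a10007a401a0f007a401a0e0e0071d0360077b81a100077b81a0f007a401a0e0077b81a0d0d0076,
    0x1702038180066001d160082b02213006b1036007a401c18007f501a1010006960360070201c18007cc81a100f0062a036,
    0x1007a401b0e0077b81b0d0d000070201b110c0c008cd0520067b0341c0067b02c81002b6b102a7380291a0076e0281900,
    0x1c81b10007f501b0f0f0067b0370070201811007a401b100084601b0f007a401b0e0e0071d0370077b81b100077b81b0f,
    0x1291b0076e027190070202d180066001d170082b021130067b03411006e703700702018111000660037007a401811007c,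
    0x1007cc8180f007a40180e0e0072a8340077b818100077b8180f0077b8180e0d0d008cd0530081002c67b02b6b102a7380,
    0x171d02a180069601d140069602013006f48340077b8181010006f4834007a4018100077b8180f0f006cc034007cc81810,
    0x1340086e81810007a40180f0f00007f501810007f50180f007a40180e0e0e000071d0281b0071d0271a0071d02c71d02b,
    0x150007a40281b007a40271a006e702c6e702b5d902a73802918005be01d140078902013006e7034007a40181010006e70,
    0x160271a006b102c64502a738029180060f01d14007da02013006a3834007cc8181010006e7034007cc818100f0f00c480,
    0x1006960281b0076e0271a006b102b64502a738029180060f01d14007da02013006e7034101000ab30500076e0281b0069,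
    0x167b0221b0067b0211a0076e020190067b01f18140070b03c0082b01e1813000066001d1812000087c028181100ab3050,
    0x11c006b10261b006b10251a0090302419006b1023181800008460201a1700008460201b16000084602018150070b03900,
    0x1726037280084f036270053702f20007380301d00ddd0441b00ddd043009a50241b1a00b55048b5504796f0460087c027,
    0x1150070201c131100007a4019150e00007a40191307040400f9f06c007e30342c007e30342b007c80342a0076e0342900,
    0x1007a401a150e0000702019150c00007a4019130a00007a401a130700007cc81513060500000070201c1b15000070201a,
    0x100007a401b13070600000070201c1b1600007a401c1815000070201a161100007a401a15007a401c131000007a401916,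
    0x170201a17007a4018151100007a401b15007a4013110f00007a401917007a401b150e0000702019150b00007a40191309,
    0x1006b101b1a0f00007a4019180e00007f501b190c00007f501a190b0700007a40311b000070201c1b1700702037150000,
    0x14019190e08000076e0361b0071d0371a006450341900007a401c1b180076e01d1300007a401a181100006b101b1a1000,
    0x11800007a401a1a1100007f501a191000007a401a190e00006b1019190c0900000070201c1b19000070201a191100007a,
    0x11019181100007f501b190f00007a401b190e00006b1019190b0a00008cd0350066001c1b1a005d90361900006b101c19,
    0x13819000066001c1a1100006b101c1910000070201c190e0b0000738035007a401c1b1b0067b03719000066001b1a006b,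
    0x12d190076e0350066001c1b007a401a111100006b1019110f0000702019110e0c00005d90351c00007a401c1c1b008cd0,
    0x10070201c1b0070201a110077b819100077b8190f007a40190e0e000072a81c1b0072a81a110077b8190e0d0d00008cd0,
    0x10071d02a190069601d150069601f130078903611000072a81c1b0072a81a1110000072a81c1b0072a81a110f0071d035,
    0x10f007a40350070201c1b0070201a11007a401910007a40190f007a40190e0e0e00007890371c007890381b0078902d1a,
    0x178901f13006e70360060f01c18110076e035007a401c1b0070201a1110008100350070201c1b007a401a11007cc81910,
    0x11c1b0077b81a11100f00ba60510082b0371c007020381b0070202d1a0069602c69602b5d902a73802919005be01d1500,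
    0x1007f5051007bf0371c006960381b0071d02d1a006e702a190070201d150070201f1300696036006b101c1811000077b8,
    0x1221311007f5051007380371c0071d0381b0069602d1a006e702a190070201d150070201f130071d036006b101c181110,
    0x182b01e1913000066001d1912003f3052008610341c0081002c81002b7f502a76e0291a0076e038180084601d160067b0,
    0x10084601f1b160070b0390067b0221b0067b0211a0067b020190076e01f1815000084601f19140070b03b0067b0211c00,
    0x14856d04796f046006b10261b006b10251a006b10241919000076e02d1c009030231918000084601d1c0084601f1a1700,
    0x12a0053702f1f006450311d003f30531c001bc0540081002c81002b7f502a76e0291c1b001bc049009a50231b1a0056d0,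
    0x1160e000070201916007a401c130c00007a401a130a00007cc8161306050500c7e06d00780038370079b0362d00726035,
    0x10077b81a1309000072a8191308000072a818130700007cc8171306060000007a401c181600007a401a161000007a401a,
    0x1007b84130d0d00006b101917007a401b150072a813110c00006b101916007a401a150072a81c130b000077b81b130a00,
    0x1b8130f0077b8130e0e00831c2f0070201a170070201b16007020181500702019140078fc13100078fc130f007cc8130e,
    0x12f0072a81a17007cc81b160077b818150072a819140073ec13100f0072a82f007a401a17007a401b160077b813100077,
    0x11b1a006b1019181200007f5018160070201a14110073ec2f007cc81a170072a81b160077b818150072a81914100073ec,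
    0x1006fb436007f501c18170065943716006aa43415006fb4350070201c1b14006c542c6c542b60f02a666c291300006b10,
    0x1401a180e00006b101b1a00660019180c00007f501a1a0b0700ab304b0073ec321b0078fc331a0078fc3019006edc3118,
    0x100007a401a190e00007a4019190c08000067b0341a007380360070201c181800007a401a181000007f501a180f00007a,
    0x11a1a0e000070201a190c0900005d9035007f501c1b1a008cd03619000084601c191800006b101a1a11000070201a1910,
    0x100006b1019180f00007a401b1a0e00007a401b190c00006b101a190b0a0000007a401c1a1800007a401a1a1000007a40,
    0x1190c0b00006450371a0071d034190076e0350070201c1b180076e01d1300007f501a181100007a401b1a007f50191810,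
    0x1190d0d00007a4019110c0c00005d90361c008cd0381a000070201c1c1800007a401c1a10000070201c1a0e000066001c,
    0x10089701c1b0070201a110070201910007a40190f007020190e0e007890350072a819100072a8190f007020190e0072a8,
    0x176e0360084601c18110071d035007f501c1b0070201a111000696035007f501c1b006b101a110077b819100f006e7035,
    0x11a0e0d0d004e6051006450371c007380381b0070202d1a0069602c81002b7f502a76e029190084601d150067b01f1300,
    0x1b81c180077b81a100f0071d036007a401c18007cc81a100077b81a0f007a401a0e0e000077b81c180077b81a100077b8,
    0x1341c0071d02c71d02a1a00789028190071d038180069601d1600696022130071d0360077b81c180077b81a1010000077,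
    0x11a101000810036007a401c180077b81a100f007a4036007a401c18007f501a10007a401a0f007a401a0e0e0e000071d0,
    0x1341c006e702c69602b5d902a7380291a0070202819007a403818005be01d160078902213007da0360084601c18007a40,
    0x12c6e702a1a0071d0281900810038180070201d16007020221300810036007cc81c180072a81a10100f00bf70520067b0,
    0x12a7380291a00810028190076e038180060f01d16007da0221300789036007f501c18101000897052006e70341c007890,
    0x1602219140070b03e0082b0201c0082b01e1a13000066001d1a12000087c0281a1100b04052006600341c0069602b6450,
    0x11800008460221a170070b0390076e0221b0067b0211a0067b020190067b01f181600008460221815000066001d1c0084,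
    0x19030261b006b10251a1a000c9044006b10241a1900cea0540067b02c69602b6b102a7380291c006b10231a009a502619,
    0x10070b0362c007260362a0079b035280053702f22006450321d009c00501c00007380281c1b00b5504856d04796f04600,
    0x14018171100007a401b170f00007a401b170e000070201917007a4013110b00007a401b1309060600e6406e0072603834,
    0x17f501b181000007a401b180f00007a401b180e00007f501b1b0c00006b101b1a00660019180b0700007020371700007a,
    0x1008460191811000070201b190f00007a401b190e00007a4019190b08000067b0341b007da03718000070201818110000,
    0x15019180f00007a401b1a0e00006b101b190c00007a401a190b0900007bf035006b101c1b1b007da0371900007f501b1a,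
    0x11b007a40371a0071d034190067b035007f501c1b180076e01d13000070201a181100006b1019181000007a401b1a007f,
    0x100007a401c190b0b00007020371b00007a401b181100007a401b1b0f00007a401b1b0e000070201b190b0a00006e7036,
    0x1007a401910007020190f007020190e0e007890350072a819100072a8190f007020190e0072a8190d0d0000660019110c,
    0x17da035006b101c1b007f501a1110008100350070201c1b007f501a110077b819100f0087c0350070201c1b0089701a11,
    0x1b0371c007020381b0073802d1a0081002c69602b7f502a76e029190084601d150067b01f13007380360084601c181100,
    0x177b81b0f0077b81b0e0d0d00008cd02d1b0067b03700702018111100007a401b110f000070201b110e0c004e60510067,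
    0x118110077b81b100077b81b0f0f006cc037007a4018110077b81b10007cc81b0f007a401b0e0e0072a8370077b8181100,
    0x1d02b71d02a1b00789027190071d02d180069601d1700696021130071d034110072a8370077b8181110006f48370077b8,
    0x11110006e703700846018110077b81b10007a401b0f0f00007a401811007a401b10007f501b0f007a401b0e0e0e000071,
    0x1530069602c6e702b5d902a7380291b0070202719007a402d18005be01d1700789021130067b03411007bf037007a4018,
    0x176e02d180060f01d17007da02113006600341100796837007cc8181110006e7037007f5018110072a81b100f0f00bf70,
    0x11b0071d027190081002d180070201d170070202113006e7034111000b040530069602c64502a7380291b008100271900,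
    0x11d1b12009c0050007380271a0069602c67b02b6b102a738029180066001d140082b0201311008970530078902b6e702a,
    0x1211a0067b020190067b01f181700008460211b1600008460211815000084602119140070b03d0082b01e1b1300006600,
    0x110261b1b00009030251b1a000c9043006b10241b1900cea049006b10231b009a502519180070b0390067b0221b0076e0,
    0x12c007e30372b007c80372a0076e0372900657035270053702f21007380331d0056d048b5504796f0460087c0271c006b,
    0x10073801d1810000073801d180f000076e01d180d000071d01d1b0c000071d01d1a0b0700eac06f007260342d00810037,
    0x10f000076e01d190d0800007650341d00006e70201b1a007260390076e0221b0076e0211a00702020190076e01f181800,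
    0x11a007260390076e0221b0076e0211a0076e0201919000070201f1918000078901d1a11000076e01d1910000076e01d19,
    0x1000073801d1a10000076e01d1a0f000076e01d1a0d000078901d190c09000072f0351d000078901d1c1b00006e701f1b,
    0x1190b0a000072f0361d00726039007020221b0076e0211a1a000076e0201a19000071d01d1c0076e01f1a006e70221918,
    0x1201b19000076e01f1b006e70211918000071d01d1811000076e01d1b10000073801d1b0f000076e01d1b0d000078901d,
    0x11d1c0071d01f1a00789022190d00007bf01f190c0b00007650371d007260390076e0221b1b00007020211b1a000076e0,
    0x17a401d1c006e701f1a1000007a401d1c0071d01f1a00789022190f00007f501d1c006e701f1a007bf022190e00007a40,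
    0x1007890391c000076e0221c1b006f003b0076e0211c1a007b603e0076e0201c19000076e01f1c1800006e70221a110000,
    0x1701f1b007bf02119007f501d110e000071d01f1b0078902119007a401d110d0c000070b035220079b0361f006e70381d,
    0x10076e0211a0076e020190076e01f1811000071d01f1b0078902119007a401d111000006e701f1b007a401d110f00006e,
    0x10e0070f81d0d0d0d000079203521007800371f006e702d1d006f003b006e70211c1b007b603d19007890390076e0221b,
    0x15f401d0f005f401d0e0e007ad0390070f8221b0070f8211a0070f820190070f81f18006cc01d10006cc01d0f0064501d,
    0x12019006d981f18006a381d100070f81d0f0f0084f039006960221b006960211a00696020190069601f18005f401d1000,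
    0x111007d10390070f8221b006d98211a0070f82019006d981f180070f81d1010007d1039006d98221b0070f8211a0070f8,
    0x13e007890201c1b0079b03d007bf01e1b1a0079b03c190079b03b0071d0211c007bf01e191800007890201a0071d02218,
    0x1006b101d0e0e0e0063c055007e303722007ad03621007ad03520007e30341f007ad02c7ad02b85802a8340291d0079b0,
    0x1601f180066001d100070201d0f0f007ad039006cc0221b006cc0211a006cc02019006cc01f180066001d100066001d0f,
    0x139007020221b006960211a00702020190069601f180070201d1010007ad039006960221b007020211a00702020190069,
    0x1201c1b0073803d007bf01e1b1a0073803c190073803b006e70211c007bf01e191800007bf0201a006e70221811007ad0,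
    0x1100f0f003750550086a03722007fe03621007fe035200086a0341f007bf02c7bf02b8cd02a8610291d0073803e007bf0,
    0x1007800390072a8221b0072a8211a0072a82019006be81f180072a81d1010007770390071d0221b0071d01f180072a81d,
    0x11d0071403e007890201c1b0077703d0078901e1b1a0077703c190071403b0071d0211c0078901e191800006e70221811,
    0x170390071d0211a0071d01f18101000564055007f50372200792036210079203520007f50341f0078902c81002a7da029,
    0x177703e1b0071403d0078901e1b1a0077703c190071403b006e70211c0078901e191800007890201a0071d02218110077,
    0x11a006f003e007bf0201c181100564055007c8037220078903621007c803520007f50341f0078902b81002a7da0291d00,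
    0x1f01f1d14000067b022210067b0201f006e701e1d1300007bf01d1d120000780034220079203620006e70281d007b603c,
    0x100291f0070b0351e007a40231d006f003d1c0081903a191800007bf0221d1700007bf0211d1600007bf0201d1500007b,
    0x1402c71402b77702a780029200070b0341e007a40241d1900471057007da02d22007da038210079b02c79b02b77702a78,
    0x1702a78002921006cc02d20007da0271f0070b0371e007a40251d0081903a1b1a0043b058006cc02722006cc028210071,
    0x179b02b77702a78002922006cc03820007da0281f0070b0361e007a40261d007b603c1c1b004560590079b02c71402b77,
    0x171405120006de0501f007f50487f50478970468bb0451d0000780034210072603720006e70271d1c0045605a0071402c,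
    0x13e37006a503d36006a503c350070803b34006a50392c006a50392b0062d0392a0068103929006f905322006f90522100,
    0x17f5017160086e81514007f50131204040000007020140c0b00007a40181408000078fc1414040303030046b071007080,
    0x1846018150077b819140072a813100072a8130f007020130d08000077b818140700007cc817140600007cc81614050000,
    0x1007a401817006d981b14007020130b0a00007a401816006d981a14007020130c090067442f007a401a17007a401b1600,
    0x10e007a40170d0c006edc320077b81c14007a401a12007cc816100077b8160f007a40160e007a40160d006600150c0b00,
    0x17e0c1410007e0c140f0081d8140e007b84140d0d006c5433007a401b120077b814110077b81710007cc8170f007a4017,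
    0x11812007e0c14100077b8140f0f0078fc30007f501812007a401410007a40140f0077b8140e0e0073ec30007a40181200,
    0x127160071d02c71d02b6b7c2a666c2914006aa4241300759c34120072a830007cc818120077b81410100072a830007cc8,
    0x120160c0b00007a4018140a00007a401816007a401a1408000078fc1414060500adb84c0067442e18007aac2817007aac,
    0x1181808070000007a401410007020170c0b00007a4018140900007a401817007a401b1408060000007a40140f0c000070,
    0x1501a0e007020190c0b000070201b180a000070201a180900007f501b1a007a40191808080000007020180c0b00007a40,
    0x177b8180f007a40180e0077b8180d0d00702037007a401811007f501b0f007f501b0e0c00007a401c18007f501a10007f,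
    0x1602013006e703410006e7034007cc818100f00702034007a401810007a40180f007a40180e0e0071d0340077b8181000,
    0x1101b0c0c00007a401a0c0b00007f5018180a09008cd050006960281b006960271a006e702a738029180067b01d140084,
    0x10071d034006b10180f006b10180e007a401b0c006b101a0b0b0a000082b028180071d034006b101810006b10180e006b,
    0x1b8100f007a40107a400f7a400e0e0072a81072a80f70200e72a80d0d007020110c0c000070201c0c0b0b000082b02718,
    0x100444044006cc0241a007a40261800660020160082b022140071d0280f006e70280e007890280d0076e02a76e0290077,
    0x1241800696020140d00444043006cc0241b007a40251800660020170082b021140071d02710006e70270e007890270d0c,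
    0x1140000660020181200006b102418006e7020141000006b102418006e7020140f00006450241800696020140e000071d0,
    0x1150600007cc8161505000078fc1515040404000079b02827007ad03424007380302000ab3040180070b03c0082b01e18,
    0x11915080067442f007a401a17007a401b160077b8181500846019140077b813100077b8130f007020130d0700007cc817,
    0x115110c000077b81c150b00007a401917006d981b15007a4013110a00007a401916006d981a15007a401c1309000077b8,
    0x1b8150e0e0078fc310070201c17007a40191200702016110078fc15100078fc150f0081d8150e007b84150d0d000077b8,
    0x11110007e0c310072a81c170077b819120077b816110078fc15100f007e0c310070201c17007f50191200702016110077,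
    0x1006aa42313007aac350070201c1b12006edc320066001c140070201a12110078fc310077b81c170077b819120072a816,
    0x11206000078fc1616050500b2c84d007e0c331c0067442e19006fb43817006fb42d16006c542c6c542b6b7c2a666c2915,
    0x10072a81916007f501a150070201c1308000072a81816007f501a14007a40130c07000091081716009108151400897013,
    0x10067442f007f501a170072a81b16007f501815007f5019140072a813100077b8130f007020130d0a000072a81a160900,
    0x10d0073ec31007f501c1700702019120077b816110072a81510007cc8150f007020150e007020150d0c000077b81c160b,
    0x1501a12007a4016100077b8160e0e0078fc32007a401c14007a401a12007e0c16100078fc160f0081d8160e007b84160d,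
    0x1320081d81c14007cc81a120077b8161010007e0c320077b81c140077b81a1200767416100f007e0c32007a401c14007f,
    0x11c0067442e1a0071d02c6c542b6b7c2a666c2916006fb42815007aac3814006aa42613007aac36007a401c1812007f50,
    0x172a81917007f501b15007020131108000072a81817007f501b14007a40130b07000078fc1717060600b0404e006c5430,
    0x10072a81b170a0067442f0072a81a17007f501b16007f501815007f5019140077b813100072a8130f007020130d090000,
    0x1000077b817110c007b84310077b81c170070201912007f501611007cc815100072a8150f007020150e007020150d0b00,
    0x11411007a40170f0077b8170e0e0073ec33007a401b12007a4014110078fc1710007e0c170f0081d8170e007b84170d0d,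
    0x10077b81b120077b81411100072a833007cc81b120081d8141100767417100077b8170f0f0078fc33007f501b12007a40,
    0x1006c542c71d02b6b7c2a666c2917006fb42715007aac2d14006aa4251300759c3712006c5430007a40181211007b8433,
    0x16b10190c0b000077b81b180a000077b81a180900006b101b1a007cc8191808000073ec1818070700b0404f0067442e1b,
    0x164370072a818110077b81b100072a81b0f0070201b0e0c006edc360072a81c180072a81a100077b81a0f0070201a0e00,
    0x100767418100077b8180f0f007e0c340072a8180e0e0076e0340073ec18100073ec180f0072a8180e0073ec180d0d0071,
    0x100867c281b00867c271a0071d02c71d02b723c2a760829180071641d14007aac2013007968340077b818101000796834,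
    0x1190e0073ec190d0d000072a819110c000072a81c190b000077b81b190a000077b81a1909000073ec19190808009db050,
    0x10f0078fc35007a401c1b007a401a110070201910007020190f0072a8190e0e0076e0350073ec19100073ec190f0072a8,
    0x17aac1f13006edc36006b101c181100774c350077b81c1b007cc81a111000723c35007cc81c1b0077b81a110071641910,
    0x10a000078fc1a1a0909008460510078fc371c006e04381b006e042d1a0078242c78242b723c2a760829190071641d1500,
    0x1007aac35006b101c1b0077b81a11007cc819100077b8190f007a40190e0c000077b81c1a0b00005e681b1a006b101918,
    0x11a100f007e0c360070201c180066001a10006d981a0e0e007a40360071641a100071641a0f006d981a0e0071641a0d0d,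
    0x11a0079d42819007aac3818007ee41d16006b7c2213007a40360072a81c18006d981a1010007e0c360077b81c18007164,
    0x11a110077b81910007cc8190f007a40190e0b000078fc1b1b0a0a006a38520079d4341c007f502c6c542b78fc2a77b829,
    0x1981b0e0e007a40370071641b100071641b0f006d981b0e0071641b0d0d000077b81b110c006e04350077b81c1b006b10,
    0x13411007b84370077b8181110007cc8370072a818110071641b10006d981b0f0f00831c3700702018110066001b0f006d,
    0x10073ec1c1c0b0b006a3853006c542c7f502b78fc2a77b8291b0079d42719007aac2d18007ee41d17006b7c21130079d4,
    0x177b81c100077b81c0f0077b81c0e0e0076e0380073ec1c100073ec1c0f0072a81c0e0073ec1c0d0d00007cc81c110c00,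
    0x108291c006e04231a0078fc2619006fb41f160078fc2215007020380077b81c101000723c380078fc1c100f0071d03800,
    0x10076e02d0073ec11100073ec110f0072a8110e0073ec110d0d000073ec11110c0c008460540071d02c78242b76082a76,
    0x12b76082a7608291100723c2d100070202d0078fc11100077b8110f0f0071d02d0077b811100077b8110f0077b8110e0e,
    0x10e0e00785a10785a0f7b840e76c50d0d0d0d00846049006e04231b0078fc2519006fb41f170078fc21150078242c71d0,
    0x10f0078fc1078fc0f77b80e0e0e0073142c73142b6fb42a6aa4290076c51010007a401076c50f0f007cc8107cc80f7cc8,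
    0x129100072a82c723c2a6aa4290077161010007716100f0f0073802c73802b6f482a6018290076741010007b841076740f,
    0x176e0231800759c221700759c21160069cc20150069cc1f1400759c1e1300759c1d120076e028110072a82b723c2a6aa4,
    0x10f0072a81072a80f73ec0e0e0e0e0073144873144770f84670f8450076e0271c007a40261b007a40251a0076e0241900,
    0x12910007a402c7b182a6be8290071641010007164100f0f0076e02c76e02b7b182a6be8290073ec1010006edc1073ec0f,
    0x1723c231800759c221700759c21160069cc20150069cc1f14006be81e13007f501d120071d02811007a402b7b182a6be8,
    0x12c76e02a73142900743d10100f0f006888486888475be04670f8450071d0271c00831c261b00831c251a00723c241900,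
    0x12318007a40221700708c21160078fc20150066001f1400708c1e13007a401d12007bf0281100774c2a6fb42910007674,
    0x10076742b76e02a7314291010008c644877b84768884673144500723c271c007cc8261b007b84251a0079d42419006d98,
    0x1c8251a0079d42419006d98231800708c2217007a4021160078fc20150066001f1400708c1e13007a401d1200723c2811,
    0x1f844007c5c241a0071642618007aac20160071642214110077b8488c6447688846731445007bf0271c007b84261b007c,
    0x1150072a83b007164211c0078fc1e19140077283a1300772839007ee4221b007ee4211a006fb42019006fb41f1812008b,
    0x177b840190077b83f007164251c180077283e007aac201c006b7c1e1a170077283d006b7c1e1b160072a83c0078fc1e18,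
    0x1332200796832210076083120007b84301f007f502f1e0073802e1d008bf8431c0041b842007c5c241c1b0041b8411a00,
    0x12a0078002c78002b7ba82a7a1c29290079202d2800792038270073803726006fb436250071f435240079203423007d34,
    0x1401a140a00007a401a160800007cc81614060505004ef0645688632280625ef8610073802c2b0072f02c72f02b735c2a,
    0x1a8130f007020130d08000072a818140700007cc81714060600007a4032007a401c14007a40160f0c00007a401816007a,
    0x100007f5018160072a81a14007020130c090067442f007f501a17007f501b16007f5018150072a819140072a813100072,
    0x1007a401a120081d816100077b8160f007a40160e007a40160d006b10150c0b00007f5018170072a81b14007020130b0a,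
    0x184140d0d006c5433007a401b120077b814110077b817100081d8170f007a40170e007a40170d0c006edc320077b81c14,
    0x130007f501812007a401410007a40140f0077b8140e0e0073ec30007a401812007e0c1410007e0c140f0081d8140e007b,
    0x1006aa4241300759c34120072a830007cc818120077b81410100072a830007cc818120078fc14100077b8140f0f0078fc,
    0x10000702018180a000084601a18080700adb84c0067442e18007aac2817007aac27160071d02c71d02b6b7c2a666c2914,
    0x11a09000070201a190808000067b0281800789034007f501810007a40180f007f50180e007f501b0c0c00006b101a0c0b,
    0x1702035007f501c1b007a401a11007020190f006b10190e0c000070201c1a0b000084601b1a00846019180a000070201a,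
    0x1100f00702036007a401a100070201a0f007a401a0e0e0071d0360077b81a100077b81a0f007a401a0e0077b81a0d0d00,
    0x12a7380291a00810028190076e038180067b01d16008460221300789036007f501c181000696036006b101c180072a81a,
    0x17f501c18006b101a100070201a0f006b101a0e007f50190c0c000084601a180a090087c052006cc0341c0081002b6e70,
    0x1501b0e0c0067b0360070201c18007f501a10007f501a0f006b10190c0b000070201b180a0a000082b0281a007bf03600,
    0x10f007a40180e0e0071d0340077b818100077b8180f007a40180e0077b8180d0d00702037007a401811007a401b0f007f,
    0x12a738029180067b01d140084602013006e7034100071d034007cc81810007f50180f0f00702034007a40181000846018,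
    0x17a40110f0c0c000071d0261a0073802216006e7038007a401c0f0c0b00a11050006960281b008b20271a0067b02b6e70,
    0x172a8100f0f007bf02b0070201070200f0f0070200f0e0e0071d02b0077b81077b80f0f007a400f0e0077b80f0d0d0000,
    0x1007a40251a007da02419007020231800660022170082b0211600846020150067b01f140078902b100073802a73802900,
    0x114007bf0280f0e000071d0241a0071d02618006960201600696022140071d0280f0d00b04047008610271c006cc0261b,
    0x12044007380241a0066002618007da020160060f02214007890280f0f00006450241a0064502618006960201600696022,
    0x13e007380201c0082b01e1a1400006600201a00660022181200006b10241a006b102618006e702016006e7022141000a6,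
    0x1007ad03426007770362400738030220071d0322000ab30401a00ab30420071d0241c180070b03c0082b01e18160070b0,
    0x1601b1808070000007a401411007a4017100b00007a401817007a401b140900007a401b17080606007a40600070b02b28,
    0x10808000067b0271800789034007a401810007f50180f007f50180e006b101b0c007f501a0b0b00007020181809000084,
    0x10c00007a401c1b007f501a110070201910006b10190e0b000070201b1b0a000084601b1a008460191809000070201b19,
    0x1370070201b10007a401b0f007a401b0e0e0071d0370077b81b100077b81b0f007a401b0e0077b81b0d0d000070201b11,
    0x10076e02d180067b01d170084602113006cc0341100738037006b10181110006e7037007f5018110072a81b100f007020,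
    0x11a10007f501a0e006b10190c0b000084601b180a000070201a1809090087c0530081002c6e702a7380291b0081002719,
    0x1b818100077b8180f007a40180e0077b8180d0d006cc0370070201811007f501b10007f501b0f0c00007a401c18007a40,
    0x120130071d034007f50181010006e7034007cc818100f007020340084601810007a40180f007a40180e0e0071d0340077,
    0x1101b0f006b101b0e007f50190b0b0a00a11050008b20281b006960271a0067b02c6e702a738029180067b01d14008460,
    0x1100e0077b8100d0d006e702d007a4011100c00007a401c100b0b000082b0271b0071d037007f5018110070201b10006b,
    0x1100078902c0072a810100f007bf02c0070201010007020100f007020100e0e0071d02c0077b810100077b8100f007a40,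
    0x11b006cc0251a007da0241900702023180082b02217006600211600846020150067b01f1400861028110073802a738029,
    0x10e000071d0241b0071d02518006960201700696021140071d027100d000071d0251b00738021170c00b04048007a4026,
    0x100006b10241b006b102518006e702017006e7021140f00006450241b006450251800696020170069602114007bf02710,
    0x1006600211812000071d0241800738020141100a62043007380241b0066002518007da020170060f02114007890271010,
    0x137240073803021007380332000ab30401b00ab3041180070b03c0082b01e18170070b03d0082b01e1b1400006600201b,
    0x190201b00738021180c00007890201a0073802218007bf01d0c0b000070201d180807000070b02c27007ad03425007ad0,
    0x10800006f9034200072603c0073801e1818000078902018100000789020180f00007a4020180e000076e020180d000078,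
    0x11d0d0d0000738021190076e01d110c000076e01d1c00738022190b000076e01d1b0a000076e01d1a09000076e01d1908,
    0x1006cc01d0e0e0079b0390071d0221b0071d0211a0076e02019006e701f180070f81d100070f81d0f0069601d0e0070f8,
    0x1d0221b0071d01f180072a81d100f00738039006e70221b006e70211a0073802019006e701f180070201d100070201d0f,
    0x10068d03b006e70211c007a401e191800007890201a006e70221811007770390071d0211a0071d01f1810007770390071,
    0x1090059a055007bf037220079b0341f007b602a7800291d006f003e007890201c1b006f003d007bf01e1b1a0072603c19,
    0x17b6039007bf0221b007380211a00789020190078901d10007bf01d0e0078901d0d0c00007380221a0b00006e701d180a,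
    0x11d0078903c1a006f003e007890201c0073801e1a180000789022181000007a40201a0e00007a40201a0071d022180d00,
    0x11b0c007b6039007380221b007bf0211a00789020190078901d0f007bf01d0e0078901d0d0b0a000072f034220070b028,
    0x1006f003d0073801e1b18000078902018110000789021180f00007a40201b0e00007a40201b0071d021180d0000738021,
    0x1901f100078901f0f007bf01f0e007bf01f0d0c00007380221c0b0b000072f034210071d037200070b0271d0078903c1b,
    0x11c0071d01e1a0076082210007968220f007da0220e007968220d0d0081903b007a40211c006e701e19007a4022110078,
    0x178901e1a100072f03e00745822100f0070b03e0076e0201c00738022100076e0220f0076e0220e0e0070b03e0076e020,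
    0x18d605a0075c02a726029220070b0281f006e70261d0072603c1c006f003a1a000073801e1c18006cc03e007890201c00,
    0x1e0210e0e0070b03d0071d01e1b0076e020110079682110007608210f007da0210e007968210d0d0000738021110c0c00,
    0x118110072f03d10006cc03d0078901e1b007890201100745821100f0070b03d0076e020110076e02110007380210f0076,
    0x10e0070f8200d0d0d008f10590075c02a726029210070b0271f0076e0371e006e70251d006f003a1b0072603c0073801e,
    0x10080703c007a401e18006f482010006f48200f006b10200e0e007ad03c0079681e180070f820100070f8200f00688820,
    0x1007c802a834029200072f0341e007e30241d0070b03a180078903c0076081e18100078903c0076081e180072a820100f,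
    0x11e180072a820100f007c803c0076e01e180073802010007380200f007380200e0e0e00657058006f902722006f902821,
    0x1f027220072f028210079202a83402920006f00341e0082b0241d006a803a18007a403c0076e01e1810007a403c0076e0,
    0x17bf05800765028210077702a7ad029200072f0341e007890241d006cc03a180073803c0077b81e18100f006720580072,
    0x100007bf0201d1200007140282011007bf05800765027220077702a7ad029200072f0341e007890241d006cc03a181000,
    0x1291e1800007bf022201700007bf021201600007bf0202015000067b02221006e70201f0067b01e1d1400007bf0201e13,
    0x10071d02520007140271e1a000074a0242019008d60560076e025220076e0262100738023200079b0241f0077702a7260,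
    0x1478bb0468bb04520007c80501e006570401d0000714027201c0000780024220071d02620007140281e1b000078002421,
    0x100740086403a340067803c2a0068103c290080103d280080103e27007080392400885043220088504421008850488850,
    0x11000007a4019150a00007a401916007a401a1507000078fc1515060500000070201c151100007a40191507040404007b,
    0x1310070201c171100007a4015110f00007a4019150900007a401917007a401b15070600000070201c161100007a401c15,
    0x119110c00007a401c190b000070201b190a000070201a190900007a4019190800007f501b1a007a401918070700007a40,
    0x1101a11007a401910007a40190f007a40190e0e0071d0350077b819100077b8190f007a40190e0077b8190d0d00007a40,
    0x10084601f13000070201c18110076e035006b101a111000810035006b101c1b007cc819100f007a4035006b101c1b006b,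
    0x10900000070201c19110800ab3051007a40371c0076e0381b0076e02d1a0069602c69602b6e702a738029190067b01d15,
    0x10e0a00008cd0351c00006b101c1c1b005d90381900007a401c1a1100007f501c191000007f501c190e00007f5019190a,
    0x1201c11110c00000070201c1c110b00005d902d1900738035007a401c1b006b101a111100007f5019110f00007f501911,
    0x10071d023190069601f150078903811000072a81c1110000072a81c110f000070201c110e000072a81c110d0d00000070,
    0x1006e702d1c00645023190069601f15006e70381100007a401c111000007a401c110f00007a401c110e0e000078902d1c,
    0x12d1c006e7023190070201f150071d0381110000071d02d1c006e7023190070201f150069603811000077b81c11100f00,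
    0x166001f1912003510540081002c81002b76e02a76e0291c007da0231a00702026190084601f160067b022151100006960,
    0x1311f003510491c00007da0231c1b00ab303f007020251c19000084601f1c170070b03b0067b0211c0082b01e19150000,
    0x1007a401c150c00007a401916007a401a150a00007a401a160700007cc81615060505000079b0382d0072603523006450,
    0x1007f501b160072a81815007f5019140077b813100077b8130f007020130d0700007cc8171506060000007a401c161000,
    0x17f5019170072a81b15007a4013110a00007f5019160072a81a15007a401c1309000072a81915080067442f007f501a17,
    0x117007a40191200702016110078fc15100078fc150f0081d8150e007b84150d0d000077b815110c000077b81c150b0000,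
    0x177b81912007cc816110073ec15100f007e0c310070201c17007f50191200702016110077b8150e0e0078fc310070201c,
    0x11c1b120073ec32006b101c140070201a12110073ec31007cc81c170077b819120072a8161110007e0c310072a81c1700,
    0x1c84d007e0c331c0067442e19006fb43817006fb42d16006c542c6c542b6b7c2a666c2915006aa42313007aac35007020,
    0x17f50190f0c00007a401c1a0b000084601b1a00846019180a000070201a1a09000084601a1908000070201a18070700b2,
    0x11a0e0e0071d0360077b81a100077b81a0f007a401a0e0077b81a0d0d00738035007f501c1b0070201a11006b10191000,
    0x1007a401c18007f501a101000810036007f501c18007cc81a100f007a4036007f501c180084601a10007a401a0f007a40,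
    0x10800b04052007020341c0067b02c69602b6e702a7380291a005f40281900738038180067b01d1600846022130076e036,
    0x10a0900005d90351c00007f501c1c1b008cd0381900006b101c1a11000070201c191000006b101c190e0000702019190a,
    0x1190a0a00008cd0361c005d90381a00007f501c1c1800007a401c1a1000007f501c1a0e00007f501c190c000084601a19,
    0x140190e0e0071d0350077b819100077b8190f007a40190e0077b8190d0d0000702019110c00007a401c190b000070201b,
    0x11b007f501a111000810035006b101c1b007f501a110072a819100f007a4035006b101c1b0070201910007a40190f007a,
    0x11b0073802d1a0081002c69602b6e702a738029190067b01d150084601f1300738036006b101c1811007890350070201c,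
    0x10d0d00006e702d1c00789023190076e01f1500007a401c11100c0000007a401c1c100b0096f051007a40371c0076e038,
    0x1d0231a0071d026190069601f1600696022150071d0380077b81c1010000077b81c100f00007a401c100e000077b81c10,
    0x100645026190069601f160069602215007bf0380070201c1010000070201c100f000070201c100e0e000071d02c1c0071,
    0x1000078902c1c006e70231a006e7026190070201f160070202215008100380072a81c10100f00007bf02c1c006450231a,
    0x11a0076e022161100b550540069602b73802a7380291c006600231a00738026190060f01f16007da02215007890381010,
    0x1b01e19160070b03e0082b0201c0082b01e1a15000066001f1c14000066001f1a00660022191200008610281c00789026,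
    0x1261c1b00ab303f007020251c1a00ab3042007a40241c1900006cc0231c1800008460221c170070b03b0067b0211c0082,
    0x1401b150900007a401b17070606000070b0382c007260352600726036230064503122006450321f00b040481c00007da0,
    0x184601b1a008460191809000084601b1908000070201b1807070000007a4017110f00007a4015110b00007a401917007a,
    0x10e0077b81b0d0d00007a401b110c0082b0350070201c1b007f501a11007f501910006b10190f0b000070201b1b0a0000,
    0x17f501b0f0f00702037007f501811007a401b100084601b0f007a401b0e0e0071d0370077b81b100077b81b0f007a401b,
    0x14027190073802d180067b01d17008460211300702034110076e037007f501811100071d037007a401811007cc81b1000,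
    0x1007f501a11110000702019110f00006b1019110e000070201919090800b040530069602c67b02b6e702a7380291b005f,
    0x1b8190d0d00007a4019110c000070201c190b000084601b190a000070201a19090900008cd02d19007bf035006b101c1b,
    0x1100f00702035006b101a11007a401910007020190f007a40190e0e0071d0350077b819100077b8190f007a40190e0077,
    0x10084601f1300702036006b101c1811006cc035007f501c1b006b101a111000696035007f501c1b0070201a110072a819,
    0x1110e00007f5019110b0a0096f051007da0371c007380381b0076e02d1a0069602c81002b6e702a738029190067b01d15,
    0x123190076e01f15006e70381100007a401c110f0b00005d902d1b00789037007f5018111100007a401b110f00007f501b,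
    0x10071d02b110071d02d0077b811100077b8110f0f00007a40110f0e000077b8110f0d0d0000007a4011110f0c00007890,
    0x17bf02b11007bf02d0070201110007020110f0f00007020110f0e0e000071d0231b0071d025190069601f170069602115,
    0x169602c73802a738029110081002d100078902d0072a811100f0f00006450231b00645025190069601f17006960211500,
    0x1231b006e7025190070201f1700702021150078902b111000b55049006600231b00738025190060f01f17007da0211500,
    0x110271c007020261b007da0251a007a402419006cc023180067b0221700846021160082b020150066001f141100006e70,
    0x100ab3041190070b03b0076e0211c0082b01e19170070b03d0082b01e1b15000066001f1b00660021191200b040470086,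
    0x108000076e01d180707007a40650070b02d2b0077703525007ad037230071d03121007380331f00ab303f007890251c1b,
    0x1007bf021190076e01d110c000076e01d1c0071d01f1a007bf022190b000076e01d1b0a000076e01d1a09000070201d19,
    0x1390071d0221b0071d0211a006e7020190076e01f18006d981d10006d981d0f0069601d0e0070f81d0d0d000071d01f1b,
    0x171d01d0f0f00738039006e70221b006e70211a006e7020190073801f180069601d100069601d0f006cc01d0e0e0079b0,
    0x1211a0071d020190073801f180071d01d101000714039006e70221b0071d0211a0071d020190073801f18006be81d1000,
    0x16f003d007bf01e1b1a0068d03c190072603b0076e0211c007a401e1918000076e0221811007140390071d0221b006e70,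
    0x11f190d08004dd055007bf03722007da036210079b03520007890341f0079b02c79b02b7b602a7800291d006f003e1b00,
    0x10073801e191900007bf01d1c0071d01f1a0076e0221911000076e01f1910000076e01f190f00007a401f190e000076e0,
    0x1007a401f1a0071d022190d000071d01f190c00006e701d190a09000072f0351f000071d01f1c1b0072603b0076e0211c,
    0x11100006e701d1c007a401f1a10000071d01d1c007a401f1a0071d022190f00006e701d1c007a401f1a0e000071d01d1c,
    0x1b0381d006f00391c00006e70221c1b0078903b0076e0211c1a006f003e0073801e1a19000071d01f1c18000076e0221a,
    0x17a401f1b006e701d110e00007a401f1b0071d021190071d01d110d000071d01f190b0a000079b03522006e70361f0079,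
    0x1390076e0221b006e70211a0071d01f181100007a401f1b0071d021190071d01d111000007a401f1b006e701d110f0000,
    0x10e000076e01f1c0d0b0000714035210071d0371f0079b02d1d0078903b0076e0211c1b006f003d0073801e1b19006f00,
    0x172f0381f0072603b0076e0211c1c000073801e1c1900007020221c11000073801f1c10000076e01f1c0f000076e01f1c,
    0x13b007020211c0073801e190076e0221111000076e01f1110000073801f110f000076e01f110e000076e01f110d0c0000,
    0x1d03b0070f8211c0079681e190070f82211006cc01f10006cc01f0f0068881f0e0070f81f0d0d0d000072f02d1f007260,
    0x1006a381f100070f81f0f0f0080703b006cc0211c007a401e19006cc022110066d81f100066d81f0f006b101f0e0e007a,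
    0x1901e1a11007d103b006d98211c0079681e190070f822110070f81f1010007d103b0070f8211c0079681e19006d982211,
    0x17ad02b7c802a8340291f006f90351e007e30231d0079b03d1c000078901e1c1b0070b03a190079b03e007bf0201c0078,
    0x180211c0076e01e1900738022110071d01f100071d01f0f0073801f0e0e0e00657057007ad02d22007ad03821007ad02c,
    0x11900738022110073801f1010007ec03b007380211c0076e01e190070202211006f481f100073801f0f0f007c803b0073,
    0x12a8340291f006f00351e0082b0231d0079b03d1c006a803a190079b03e007bf0201c11007ec03b007020211c0076e01e,
    0x1a822110072a81f10100077703b0071d022110072a81f100f0f006a80570077702d2200777038210077702c77702b7920,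
    0x1351e007f50231d0077703d1c0072f03a190071403e007890201c0078901e1a110078003b0072a8211c0077b81e190072,
    0x177703e007890201c110077703b0071d0211c1010005eb0570078902d2200792038210078902c76e02a7da0291f007140,
    0x179202d2200789038210078902b76e02a7da0291f006de0351e007f50231d0071403d1c000078901e1c1b0072f03a1900,
    0x12a780029220070b038200076e0281f006cc0361e007bf0261d0081903c1c007b603a1a00006e701e1c1811005b505700,
    0x1b02221006e70201f0067b01e1d1500007bf01f1f1400007bf01f1e1300007bf01f1d12004a705a0071402c79b02b74a0,
    0x179b02320007380241f0079202c79202b77702a7260291e19000074a0231f1800007bf0221f1700007bf0211f16000067,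
    0x10071d0261f007920381e007b603a1c1b0000780023210071d0251f0079202d1e1a008d60560076e025220076e0262100,
    0x1703f1d005130590079b02c71402b74a02a780029210070b02d200076e0271f007380371e007bf0251d1c000078002322,
    0x13b2b0067803b2a0068103b29007080392300672049220067205421007890487890478bb0468bb0451f007920511e0065,
    0x1401c160c00007a401a160a000078fc161606050505006d8073006a503d380080103a35006a503e2d006a503b2c006a50,
    0x1401a150070201c130800006d981816007a401a14007a40130c07000086e81716007f501514007f50131206060000007a,
    0x11a170077b81b16007a401815007a4019140072a813100077b8130f007020130d0a000077b81a160900006d981916007a,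
    0x1601c1700702019120077b816110072a815100077b8150f007020150e007020150d0c000077b81c160b0067442f008460,
    0x1100077b8160e0e0078fc32007a401c14007a401a12007e0c16100078fc160f0081d8160e007b84160d0d006edc310084,
    0x17cc81a120077b8161010007e0c320077b81c140077b81a1200716416100f007e0c32007a401c14007f501a12007a4016,
    0x171d02c6c542b6b7c2a666c2916006fb42815007aac3814006aa42613007aac36007a401c1812007a4032007cc81c1400,
    0x11a10007f501a0f007f501a0e006b10190c0c000070201a180a00007f501a1a080700b0404e006c54301c0067442e1a00,
    0x11a00006b101c1c1800006b101c1a0e000070201c190c000070201a190a08000067b0281a007380360070201c18007f50,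
    0x10e0c00007a401c1a0b00007a401b1a007f5019180a0a0000007a401c1a0c00007a401a1a0a0900005d90361c008cd038,
    0x11a0f007a401a0e0e0071d0360077b81a100077b81a0f007a401a0e0077b81a0d0d00007a401c1b007a401a11006b1019,
    0x116008460221300789036007f501c181000810036007f501c180072a81a100f007a4036007f501c18007a401a10007a40,
    0x1401c110c0c0000007a401c1c0c0b009c0052007020341c0069602b6e702a7380291a008100281900738038180067b01d,
    0x1007bf0380070201c100070201c0f0070201c0e0e0071d0380077b81c100077b81c0f007a401c0e0077b81c0d0d00007a,
    0x150540069602b73802a7380291c007020231a007da026190067b01f1600846022150078903810008100380072a81c100f,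
    0x11c006e70261a00702022160f00007bf0281c006450261a00696022160e000071d0281c0071d0261a00696022160d00b5,
    0x11c180070b03e0082b0201c0082b01e1a1600006600221c1400006600221a1200006b10261a006e702216100000789028,
    0x1130b07000078fc1717060606000070b038280072603626006450322200a620441c00ab3042007a40241c1a00006cc026,
    0x1140077b813100072a8130f007020130d0900006d981917007a401b1500702013110800006d981817007a401b14007a40,
    0x115100072a8150f007020150e007020150d0b000077b81b170a0067442f0077b81a170084601b16007a401815007a4019,
    0x1fc1710007e0c170f0081d8170e007b84170d0d000077b817110c007b84310077b81c17007020191200846016110077b8,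
    0x1100077b8170f0f0078fc33007f501b12007a401411007a40170f0077b8170e0e0073ec33007a401b12007a4014110078,
    0x100759c3712006c5430007a40181211007b84330077b81b120077b81411100072a833007cc81b12007cc8141100716417,
    0x11808000078fc1818070700b0404f0067442e1b006c542c71d02b6b7c2a666c2917006fb42715007aac2d14006aa42513,
    0x1b81c180072a81a10006d981a0f0070201a0e007f50190c0b000077b81b180a000077b81a180900006b101b1a005e6819,
    0x110007164180f006d98180e007164180d0d0079d4370077b81811006d981b100072a81b0f0070201b0e0c007c5c360077,
    0x16d98181010007cc8340069cc1810006d98180f0f00831c340066001810006600180f006d98180e0e007a403400716418,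
    0x1fc19190808005d905000708c281b00708c271a007f502c7f502b78fc2a77b82918007ee41d14006b7c2013007cc83400,
    0x110007164190f006d98190e007164190d0d000077b819110c000077b81c190b000077b81b190a000077b81a1909000078,
    0x1007e0c350072a81c1b0077b81a110078fc19100f007e0c35007a401c1b007a401a11006d98190e0e007a403500716419,
    0x16c542c6c542b78fc2a77b82919007ee41d15006b7c1f13007aac36007f501c18110078fc350077b81c1b0072a81a1110,
    0x10c000072a81c1a0b00007cc81b1a006b1019180a000073ec1a1a09090076e05100708c371c006fb4381b006fb42d1a00,
    0x1ec1a100073ec1a0f0072a81a0e0073ec1a0d0d006edc35007f501c1b0072a81a110072a819100077b8190f007a40190e,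
    0x1180077b81a101000723c36006d981c180073ec1a100f0078fc360070201c180070201a0f0072a81a0e0e0076e0360073,
    0x152007164341c0071d02c78242b723c2a7608291a0063e42819007c5c38180071641d16007aac22130076e0360072a81c,
    0x1000072a81b110c007b84350072a81c1b007f501a110077b819100072a8190f007a40190e0b000073ec1b1b0a0a009108,
    0x11b0f0f007e0c3700702018110070201b100072a81b0e0e0076e0370073ec1b100073ec1b0f0072a81b0e0073ec1b0d0d,
    0x119007c5c2d180071641d17007aac211300716434110079d437006d98181110007968370072a818110073ec1b100077b8,
    0x10072a81c0e0073ec1c0d0d00007cc81c110c000073ec1c1c0b0b009108530078242c71d02b723c2a7608291b0063e427,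
    0x1b81c101000723c380073ec1c100f0071d0380077b81c100077b81c0f0077b81c0e0e0076e0380073ec1c100073ec1c0f,
    0x111110c0c008460540071d02c78242b76082a7608291c007164231a007c5c26190071641f16007aac22150076e0380077,
    0x171d02d0077b811100077b8110f0077b8110e0e0076e02d0073ec11100073ec110f0072a8110e0073ec110d0d000073ec,
    0x15c25190071641f17007aac21150078242c71d02b76082a7608291100723c2d100076e02d0073ec11100077b8110f0f00,
    0x110100077b81076c50f0f007cc8107cc80f7cc80e0e00785a10785a0f7b840e76c50d0d0d0d00846049007164231b007c,
    0x12b6f482a60182900767410100076741076740f0f0078fc1078fc0f77b80e0e0e0073142c73142b6fb42a6aa4290076c5,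
    0x100759c1d120076e028110076082b723c2a6aa429100076082c723c2a6aa42900748e101000748e100f0f0073802c7380,
    0x1e0271c0076e0261b0076e0251a007a402419007a4023180069cc22170069cc211600759c201500759c1f1400759c1e13,
    0x12b7b182a6be8290073ec10100073ec1073ec0f0f0072a81072a80f73ec0e0e0e0e0073144873144770f84670f8450076,
    0x1007f501d120071d028110073802b7b182a6be829100073802c7b182a6be8290076741010007674100f0f0076e02c76e0,
    0x1d0271c00723c261b00723c251a00831c241900831c23180069cc22170069cc211600759c201500759c1f14006be81e13,
    0x1401d12006b1028110078fc2a716429100073142c76e02a7314290076c510100f0f006888486888475be04670f8450071,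
    0x11c006d98261b0079d4251a007b842419007cc8231800660022170078fc211600708c2015007a401f1400708c1e13007a,
    0x17a401f1400708c1e13007a401d1200723c28110073142b76e02a73142910100051544877b84768884673144500723c27,
    0x147688846731445006b10271c0079d4261b006d98251a007b842419007cc823180078fc2217006600211600708c201500,
    0x11b006fb4211a007ee42019007ee41f1812008bf8440078fc241a006e0426180078fc2016006fb42214110077b8485154,
    0x10072a83d0078fc1e1b160077283c006b7c1e18150077283b006fb4211c006b7c1e19140077283a1300772839006fb422,
    0x1f8431c0077b8420078fc241c1b0077b8411a0041b840190041b83f006e04251c180072a83e0078fc201c0078fc1e1a17,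
    0x1260071f43625006fb435240073803423007b84332200760832210079683120007d34301f007f502f1e0073802e1d008b,
    0x1625ef8610078002c2b0072f02c72f02b735c2a2a0078002c78002b7ba82a7a1c29290079202d28007920382700792037,
    0x110006e701d0f006e701d0e0071d01d0d0c00007890221a0b000076e01d180a00006e701d1a08070049e0645688632280,
    0x1007a4022180f00007a4022180e000071d0201a007a4022180d006f00390071d0221b006e7020190076e01f180071d01d,
    0x11d190a08000071d0342200714036200079b0281d006f003c1a0078903e007380201c0073801e1a1800007890201a1000,
    0x11f1a007a4022190f00007bf01d1c007a4022190e000078901d1c0071d01f1a007a4022190d000076e01f190c000076e0,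
    0x17890221c1b006f003b1a0078903e007380201c0073801e1a1900007bf01f1c18000071d0221a11000078901d1c0071d0,
    0x100006e701d1c0076e01f1a0071d022190c000070201d1a0a0900006e7035220079b0361f0070b0381d007b60391c0000,
    0x1603e007380201c0073801e1a1a00007890221c1800007890221a10000076e0221a0f00007a40221a0e000076e0221a0d,
    0x11d0d0d000076e01f1b0076e01d110c000076e01d1c006e701f1a00789022190b000076e01d1b0a0a000072f036220072,
    0x1006cc01d0e0e0079b0390076e0221b006e70211a0071d020190071d01f180070f81d10006d981d0f0069601d0e0070f8,
    0x1701f180072a81d100071d01d0f0f00738039007380221b006e70211a006e702019006e701f180070201d100069601d0f,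
    0x100007bf0201a0071d0221811007770390071d0211a0071d01f181000714039007380221b0071d0211a0071d02019006e,
    0x1341f0079b02b7b602a7800291d0072603e007380201c1b0068d03d007a401e1b1a006f003c19006f003b007bf01e1918,
    0x1e0221c0f000076e0221c0e000076e0221c0d000070201f1c0c0b004dd05500789037220079b03621007da03520007bf0,
    0x10e0070f81f0d0d000076e01f110c0c000072f038220072603e007380201c1c000073801e1c1a00007890221c10000076,
    0x173801f100070201f0f0073801f0e0e0079b03b006e70211c0078901e190076e022110070f81f10006d981f0f006cc01f,
    0x1211c100071403b0071d0211c0078901e1900738022110072a81f100071d01f0f0f0079b03b006e70211c0076e0221100,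
    0x16cc0351e007bf0231d0068d03d1c00007bf01e1c1b007b603a190072603e007a40201c0073801e1a110077703b0071d0,
    0x10079681e1a0070f82210006cc0220f006888220e0070f8220d0d0d004f80570079b038210079b02b74a02a7800291f00,
    0x1d022100070f8220f0f0080703e007da0201c007a401e1a006f4822100066d8220f006b10220e0e007ad03e007968201c,
    0x10070b03c1c0070b03a1a000071d01e1c180078903e007608201c0076081e1a10007d103e007968201c0079681e1a0071,
    0x1100071d0220f007380220e0e0e0063c05a007ad02b7c802a83402922006f903820007ad0281f006f90361e007e30261d,
    0x176e01e1a10007ec03e0076e0201c0076e01e1a0074582210007380220f0f007c803e0076e0201c0076e01e1a00738022,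
    0x12b79202a834029220072f03820007770281f006f00361e0082b0261d0070b03c1c006a803a1a007a403e007380201c00,
    0x1007f50261d0072f03c1c0072f03a1a007bf03e007458201c0074581e1a100077703e00760822100f0f0068d05a007770,
    0x190261d006cc03c1c006cc03a1a000078901e1c18100060605a0076e02a7da029220071403820007890281f007140361e,
    0x100007bf0221e1300007bf0221d12000071402822110082b05a0074102b77702a7ad029220076503820007650361e0078,
    0x17140381e006f003a1c1800007bf022221700006e7022210067b0201f0067b01e1d1600007bf022201500007bf0221f14,
    0x123200076e0241f0079202b77702a7260291e1a000071d024220078002620007920281e19000071d02322007800261f00,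
    0x128210079202b75c02a726029200076e0341e006e70241d1c000074a026221b008d605600738025220079b026210076e0,
    0x13926008850487890478bb0468bb045220083405420006210441f007ad0521e006570421d009420580076e027220079b0,
    0x10b00007a401b1709060606007440760080103c380080103a36006a503e2b0067803e2a0068103e29006a503b28007080,
    0x10070201811007f501b10007f501b0f007f501b0e006b10190b0b000070201b180900007f501b1b08070000007a401711,
    0x100008cd02d1b0071d037006b1018111100006b101b110e0000702019110b000070201b190908000067b0271b00789037,
    0x1b81b0d0d00007a401b110c00007a401c1b007a401a11006b10190e0b00007a401b1b0a00007a401b1a007f5019180909,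
    0x1100f00702037007f501811007a401b10007a401b0f007a401b0e0e0071d0370077b81b100077b81b0f007a401b0e0077,
    0x100810027190073802d180067b01d17008460211300702034110076e037007f50181110006e7037007f5018110072a81b,
    0x140110e0077b8110d0d00007a4011110c00007a401c110b0b0000007a401b110b0a009c00530069602c6e702a7380291b,
    0x12d100078902d0072a811100f007bf02d0070201110007020110f007020110e0e0071d02d0077b811100077b8110f007a,
    0x1696021170071d027110d00b55049007020231b007da025190067b01f1700846021150069602c73802a73802911008100,
    0x11b007020211700789027111000006b10251b006e7021170f00006450251b0069602117007bf027110e000071d0251b00,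
    0x11b0070b03d0082b01e1b1700006600211b1200a62043007a40241b006cc025180082b0201700660021141100006e7025,
    0x11d0f006e701d0e0071d01d0d0b000076e01d180900006e701d1b0807000070b02d27007ad03725007380332100ab3041,
    0x1180e000071d0201b007a4021180d00007890211b0c006f00390071d0211a006e7020190076e01f18006e701d100071d0,
    0x137200079b0271d006f003c1b0078903d0073801e1b180000738020181100007a4021181000007890201b0f00007a4021,
    0x119007bf01d110e000071d01f1b007a4021190078901d110d000076e01f190b000076e01d190908000071d034210072f0,
    0x10073801e1b19007b6039007890211a0073802019007bf01f1811000071d01f1b007a4021190078901d111000007a4021,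
    0x11d1c0076e01f1a0b000070201d1b0a000076e01d1a0909000072f0371f0070b02d1d006f003b0071d0211c1b0078903d,
    0x1190071d01f18006d981d100070f81d0f0069601d0e0070f81d0d0d00006e701f1b00789021190076e01d110c000076e0,
    0x17380211a006e702019006e701f180069601d100070201d0f006cc01d0e0e0079b039006e70221b0076e0211a0071d020,
    0x1211a0071d02019006e701f180071d01d1010007770390071d0221b0071d01f180072a81d100f00738039006e70221b00,
    0x172603d007a401e1b1a006f003c19006f003b0071d0211c007bf01e191800007380201a11007140390071d0221b007380,
    0x10071d02119006e701d110b0a0059a0550079b03722007bf0341f0079b02c7b602a7800291d0068d03e007bf0201c1b00,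
    0x11b1b00007380201b007890211811000076e0211b1000007890211b0f00007a40211b0e000076e0211b0d000076e01f1b,
    0x1981f100070f81f0f006cc01f0e0070f81f0d0d000070201f110c000076e01f1c0b0b00006f9037210072603d0073801e,
    0x13b0076e0211c006e7022110070201f100073801f0f0073801f0e0e0079b03b0076e0211c0078901e19006e702211006d,
    0x17bf01e1a110071403b007380211c0078901e190071d022110071d01f10100077703b0071d022110072a81f100f0079b0,
    0x10079b02d220079b02c74a02a7800291f007bf0231d0072603d1c000073801e1c1b007b603a190068d03e007a40201c00,
    0x10072603d0073801e1b007380201111000076e02111100000789021110f000076e021110e000076e021110d0c0057f057,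
    0x1006b10210e0e007ad03d0079681e1b0079682011006cc021100070f8210f006888210e0070f8210d0d0d000072f02d21,
    0x1f82110100078903d0076081e1b00760820110071d021100f0080703d007a401e1b007da020110066d82110006f48210f,
    0x12d20007ad0271f0072f0371e007e30251d0070b03a1b0070b03c0071d01e1811007d103d0079681e1b00796820110070,
    0x17c803d0076e01e1b0076e020110071d02110007380210f007380210e0e0e00672059007ad02c7c802a83402921006f90,
    0x13a1b0070b03c11007ec03d0076e01e1b0076e02011007380211010007a403d0076e01e1b007380201100745821100f00,
    0x15820110076082110100f0068d0590077702c79202a834029210072f02d20007770271f006f00371e0082b0251d006a80,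
    0x177702a7ad029210076502d200072f0371e007890251d006cc03a1b006cc03c0078901e1811007bf03d0074581e1b0074,
    0x17da029210071402d20007890271f007140371e007f50251d0072f03a1b0072f03c110077703d1010007f50590074102c,
    0x19420580079b027220076e028210079202c75c02a726029200076e0341e006e70241d006f003a1811006060590076e02a,
    0x1210067b0201f0067b01e1d1700007bf021211600007bf021201500007bf0211f1400007bf0211e1300007bf0211d1200,
    0x11e1b000074a025211a000071d024210078002520007920271e19000071d02321007800251f0071402d1e1800006e7022,
    0x1531e006570411d0000714027211c008d60560079b0252200738026210076e023200076e0241f0079202c77702a726029,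
    0x12c0067803d2a0068103d29006a503b270070803925007890488850478bb0468bb045210083404920006210431f007ad0,
    0x10f00007770201d0e00007770211d0c00007770221d0b000072f01d1d0807007440750086403a370080103c2d006a503d,
    0x17022201b0000777021201a00007770202019000071d02221007410201f0074101e1d1800007770201d1000007770201d,
    0x121007410201f0074101e1d19000077701f1f18000072f0221d11000077701f1d0e0800007b903920006ed03c1d000077,
    0x11f1d0c000072f01d1d0a0900007b90391f006ed03b1d000072f0211d1c00007770221f1b00007770211f1a000071d022,
    0x100741022210071d0201f0074101e1d1a0000777022201900007770221f1800007770221d1000007770221d0e000072f0,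
    0x100007770211d0f00007770211d0e000072f01f1d0b0a00007b903922006ed03e1d00007770201d1c0000777022221b00,
    0x1d03d1d0000741022210071d0201f0074101e1d1b0000777021211a0000777021201900007770211f1800007770201d11,
    0x1d01e1d1c000077701f1e1a000072f0221e190000777022221100007770221f10000072f01f1f0c0b00007b903921006e,
    0x10074102221007410201f0071d01e1d1100007770211f0f0c00007b903b22006ed03e1f000074102221007410201f0071,
    0x1002221007800201f0078001e1d0d0d00007b903b21006ed03d1f0000777021211c000077701f1e1b000072f0211e1900,
    0x1007800201f0078001e1d10000078002221007800201f0078001e1d0f00007ad02221007ad0201f007ad01e1d0e000078,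
    0x17650201f0078901e1d0e0e00006bd03d22006bd03e21006bd03b20006bd03c1f006bd0391e006bd03a1d000078002221,
    0x1000077701f1e18000076502221007650201f0078901e1d10000076502221007650201f0078901e1d0f00007650222100,
    0x13d22006bd03e21006bd03b20006bd03c1f007230391e0065703a1d00007770221e1b00007770211e1a00007770201e19,
    0x1006d503a1d00007770221e1b000077701f1e1800007770222011000074a022210076e0201f0076e01e1d100f00006bd0,
    0x10000777021201c00007770211e1a000077701f1e181000006d503d220073b03e210073b03b20006d503c1f0073b0391e,
    0x1201c000072f0201e1a00007770221e1811000073b03d22006d503e210073b03b20006d503c1f0073b0391e006d503a1d,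
    0x1007b903c1e1900006ed03a1f007b903b1e00007770211e1c000072f01e1e191800006ed03c22007b903e20000072f020,
    0x1903d201c00006ed03a22007b903e1e000072f0201e1c1b00006ed03a21007b903d1e000072f01e1e1b1a00006ed03a20,
    0x1220072f0341f1e008310560072f025220072f026210072f023200072f0241f0071d02a6f90291e1d00006ed03c21007b,
    0x172b03a390089d05922008c105a0074102a6f90292221008af05720008af0580074102a6f9029201f008c10550072f037,
    0x1000072b03e3d0072b03c3b00]

/-- The singular vector as a tree. -/
@[irreducible] def singularTree : PBWTree := (parse 1000 6 (1, singularData)).1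

/-! ### Tests that read off the properties of a tree -/

namespace PBWTree

/-- The number of non-zero coefficients. -/
def leafCount (x : PBWTree) : ℕ :=
  PBWTree.rec (fun c => Bool.rec 1 0 (isZero (const c))) (fun _ _ _ it is => it + is) x

/-- Whether the words are sorted and distinct, with generators that are at least `n`. -/
def isSorted (x : PBWTree) : ℕ → Bool :=
  PBWTree.rec (fun _ _ => true)
    (fun g _ _ it is n => and (Nat.ble n g) (and (it g) (is (g + 1)))) x

/-- Whether all words have weight `n`, if the generators have the weights `wt`. -/
def isHomogeneous (wt : ℕ → ℤ) (x : PBWTree) : ℤ → Bool :=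
  PBWTree.rec (fun c n => or (isZero (const c)) (n == 0))
    (fun g _ _ it is n => and (it (n - wt g)) (is n)) x

/-- The product of integers, without the evaluation of the second one if the first one is `0`. -/
def lazyMul (a b : ℤ) : ℤ :=
  Int.rec (fun n => Nat.rec 0 (fun _ _ => a * b) n) (fun _ => a * b) a

/-- The entry in row `q` and column `p` of the matrix that is obtained by evaluation at `t = 1`. -/
def matrixEntry (p : ℕ) (x : PBWTree) : ℕ → ℤ :=
  PBWTree.rec (fun c q => Bool.rec 0 c (Nat.beq q p))
    (fun g _ _ it is q =>
      List.rec (is q) (fun r _ ih => lazyMul (entry (g % 28) q r) (it r) + ih) (List.range 8)) x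

end PBWTree

/-! ### The computations with the singular vector -/

open PBWTree

/-- The encoding itself needs no proof: this and the following checks concern the decoded tree, and
nothing else about it is used. -/
theorem leafCount_singularTree : leafCount singularTree = 6753 := by
  decide +kernel

theorem isSorted_singularTree : isSorted singularTree 0 = true := by
  decide +kernel

theorem isHomogeneous_degree_singularTree :
    isHomogeneous (fun g => ((g / 28 + 1 : ℕ) : ℤ)) singularTree 6 = true := by
  decide +kernel

/-- The 𝔥-weight is 2ω₁ = 2ε_1, so the eigenvalue of H_1 (index 0) is 2 and the others vanish. -/
theorem isHomogeneous_weight_singularTree : ∀ i : Fin 4,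
    isHomogeneous (fun g => weightAt i (g % 28)) singularTree (if i = 0 then 2 else 0) = true := by
  decide +kernel

/-- A matrix of weight 2ε_1 can only map a_1^* (index 4, weight -ε_1) to a_1 (index 0, weight ε_1),
so this is the only entry that can detect the vector. -/
theorem matrixEntry_singularTree : matrixEntry 4 singularTree 0 = -255255 := by
  decide +kernel

/-- The ranks 0, 6, 10, 11 are the simple root vectors for ε_1 - ε_2, ε_2 - ε_3, ε_3 - ε_4 and ε_3 +
ε_4. -/
theorem isZero_actZero_singularTree :
    (isZero (actZero singularTree 0) && isZero (actZero singularTree 6) &&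
      isZero (actZero singularTree 10) && isZero (actZero singularTree 11)) = true := by
  decide +kernel

/-- This is f_θ(1) v = 0 at level -14/3, multiplied by 3 so that the arithmetic stays integral. -/
theorem isZero_actOne_singularTree :
    isZero (add (smul 3 (actOne 18 singularTree)) (smul (-14) (deriv 1 singularTree))) = true := by
  decide +kernel


/-! ### PBW expansions of trees -/

/-- The numbering of the generators: `28 (n - 1) + b` is the code of `x(-n)`, where `x` is the basis
vector of rank `b`. -/
def genAt (g : ℕ) : Gen :=
  (basisIndex ⟨g % 28, Nat.mod_lt _ (by norm_num)⟩, ⟨g / 28 + 1, Nat.succ_pos _⟩)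

theorem genAt_bijective : Function.Bijective genAt := by
  constructor
  · intro g h hgh
    obtain ⟨h1, h2⟩ := Prod.mk.inj hgh
    have h1 := congrArg Fin.val (basisIndex_bijective.1 h1)
    have h2 := congrArg PNat.val h2
    simp only [PNat.mk_coe] at h1 h2
    omega
  · rintro ⟨b, n⟩
    obtain ⟨a, rfl⟩ := basisIndex_bijective.2 b
    refine ⟨28 * (n - 1) + a, ?_⟩
    have ha := a.2
    have hn := n.pos
    refine Prod.ext (congrArg basisIndex (Fin.ext ?_)) (PNat.eq ?_)
    · change (28 * ((n : ℕ) - 1) + a) % 28 = a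
      omega
    · change (28 * ((n : ℕ) - 1) + a) / 28 + 1 = n
      omega

/-- The code of a generator. -/
def genCode (x : Gen) : ℕ := (Equiv.ofBijective genAt genAt_bijective).symm x

theorem genCode_genAt (g : ℕ) : genCode (genAt g) = g :=
  (Equiv.ofBijective genAt genAt_bijective).symm_apply_apply g

theorem genCode_injective : Function.Injective genCode :=
  (Equiv.ofBijective genAt genAt_bijective).symm.injective

/-- The order of the generators by their codes. -/
@[reducible] def genOrder : LinearOrder Gen := LinearOrder.lift' genCode genCode_injective

theorem genOrder_le {x y : Gen} : genOrder.le x y ↔ genCode x ≤ genCode y := Iff.rfl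

/-- A generator whose code is minimal is put in front by the sorting, so a word read along a sorted
tree is already the ordered monomial of its multiset. -/
theorem monomial_cons (k : ℂ) {g : ℕ} {m : Multiset Gen} (h : ∀ x ∈ m, g ≤ genCode x) :
    monomial k genOrder (genAt g ::ₘ m) = generator g • monomial k genOrder m := by
  have hs : (genAt g ::ₘ m).sort genOrder.le = genAt g :: m.sort genOrder.le :=
    Multiset.sort_cons _ _ _ fun x hx => genOrder_le.mpr (by rw [genCode_genAt]; exact h x hx)
  rw [monomial, hs, List.map_cons, word, List.map_cons, List.prod_cons, mul_smul]
  rfl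

theorem monomial_zero (k : ℂ) : monomial k genOrder 0 = vac k := by
  simp [monomial, word]

namespace PBWTree

/-- The coefficients of the PBW monomials. -/
def coefficients : PBWTree → Multiset Gen →₀ ℂ
  | const c => Finsupp.single 0 (c : ℂ)
  | node g t s => (coefficients t).mapDomain (genAt g ::ₘ ·) + coefficients s

theorem isSorted_node {g n : ℕ} {t s : PBWTree} :
    isSorted (node g t s) n = true ↔ n ≤ g ∧ isSorted t g = true ∧ isSorted s (g + 1) = true := by
  change (Nat.ble n g && (isSorted t g && isSorted s (g + 1))) = true ↔ _
  rw [Bool.and_eq_true, Bool.and_eq_true, Nat.ble_eq]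

/-- The lower bound serves twice: it makes the leading generator minimal in its words, and it
separates the words of the two branches. -/
theorem le_genCode_of_mem {x : PBWTree} {n : ℕ} (h : isSorted x n = true) :
    ∀ m ∈ (coefficients x).support, ∀ y ∈ m, n ≤ genCode y := by
  classical
  induction x generalizing n with
  | const c =>
    intro m hm
    obtain rfl : m = 0 := by simpa using Finsupp.support_single_subset hm
    simp
  | node g t s it is =>
    obtain ⟨h1, h2, h3⟩ := isSorted_node.mp h
    intro m hm y hy
    rcases Finset.mem_union.mp (Finsupp.support_add hm) with hm | hm
    · obtain ⟨m', hm', rfl⟩ := Finset.mem_image.mp (Finsupp.mapDomain_support hm)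
      rcases Multiset.mem_cons.mp hy with rfl | hy
      · rwa [genCode_genAt]
      · exact h1.trans (it h2 m' hm' y hy)
    · exact h1.trans ((Nat.le_succ g).trans (is h3 m hm y hy))

theorem isZero_const {c : ℤ} : isZero (const c) = true ↔ c = 0 := by
  rcases c with (_ | n) | n
  · exact ⟨fun _ => rfl, fun _ => rfl⟩
  · exact ⟨fun h => absurd h Bool.false_ne_true, fun h => by cases h⟩
  · exact ⟨fun h => absurd h Bool.false_ne_true, fun h => by cases h⟩

/-- At a node, the words of the first branch contain the generator g, while all generators in the
second branch have codes at least g + 1. So the supports are disjoint, nothing cancels, and every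
non-zero leaf contributes one monomial. -/
theorem card_support_coefficients {x : PBWTree} {n : ℕ} (h : isSorted x n = true) :
    (coefficients x).support.card = leafCount x := by
  classical
  induction x generalizing n with
  | const c =>
    change _ = (Bool.rec 1 0 (isZero (const c)) : ℕ)
    cases hc : isZero (const c)
    · have : (c : ℂ) ≠ 0 := by
        rw [Int.cast_ne_zero]
        intro h0
        rw [isZero_const.mpr h0] at hc
        exact absurd hc (by simp)
      rw [coefficients, Finsupp.support_single _ this, Finset.card_singleton]
    · rw [coefficients, isZero_const.mp hc]
      simp
  | node g t s it is =>
    obtain ⟨_, h2, h3⟩ := isSorted_node.mp h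
    have hinj : Function.Injective (genAt g ::ₘ ·) := fun _ _ h =>
      (Multiset.cons_inj_right _).mp h
    have hdisj : Disjoint ((coefficients t).mapDomain (genAt g ::ₘ ·)).support
        (coefficients s).support := by
      rw [Finset.disjoint_left]
      intro m hm hm'
      obtain ⟨m', _, rfl⟩ := Finset.mem_image.mp (Finsupp.mapDomain_support hm)
      have := le_genCode_of_mem h3 _ hm' _ (Multiset.mem_cons_self _ _)
      rw [genCode_genAt] at this
      omega
    rw [coefficients, Finsupp.support_add_eq hdisj, Finset.card_union_of_disjoint hdisj,
      Finsupp.mapDomain_support_of_injective hinj, Finset.card_image_of_injective _ hinj, it h2,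
      is h3]
    rfl

theorem eval_eq_linearCombination (k : ℂ) {x : PBWTree} {n : ℕ} (h : isSorted x n = true) :
    eval k x = Finsupp.linearCombination ℂ (monomial k genOrder) (coefficients x) := by
  induction x generalizing n with
  | const c => rw [eval, coefficients, Finsupp.linearCombination_single, monomial_zero]
  | node g t s it is =>
    obtain ⟨_, h2, h3⟩ := isSorted_node.mp h
    rw [eval, coefficients, map_add, it h2, is h3, Finsupp.linearCombination_mapDomain,
      Finsupp.linearCombination_apply, Finsupp.linearCombination_apply, Finsupp.sum, Finsupp.sum,
      Finset.smul_sum]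
    congr 1
    refine Finset.sum_congr rfl fun m hm => ?_
    change generator g • coefficients t m • monomial k genOrder m =
      coefficients t m • monomial k genOrder (genAt g ::ₘ m)
    rw [monomial_cons k (le_genCode_of_mem h2 m hm), smul_comm]

/-! ### Weights -/

theorem isHomogeneous_node {wt : ℕ → ℤ} {g : ℕ} {t s : PBWTree} {n : ℤ} :
    isHomogeneous wt (node g t s) n = true ↔
      isHomogeneous wt t (n - wt g) = true ∧ isHomogeneous wt s n = true := by
  change (isHomogeneous wt t (n - wt g) && isHomogeneous wt s n) = true ↔ _
  rw [Bool.and_eq_true]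

theorem isHomogeneous_const {wt : ℕ → ℤ} {c n : ℤ} :
    isHomogeneous wt (const c) n = true ↔ c = 0 ∨ n = 0 := by
  change (isZero (const c) || n == 0) = true ↔ _
  rw [Bool.or_eq_true, isZero_const, beq_iff_eq]

/-- Homogeneous trees are eigenvectors of derivations that act diagonally on the generators. -/
theorem smul_eval_of_isHomogeneous {k : ℂ} {a : AffineLie} {wt : ℕ → ℤ} {z : ℂ}
    (hvac : UniversalEnvelopingAlgebra.ι ℂ a • vac k = 0)
    (hgen : ∀ g, ⁅a, mode (basisAt g) (-((g / 28 + 1 : ℕ) : ℤ))⁆ =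
      (z * wt g : ℂ) • mode (basisAt g) (-((g / 28 + 1 : ℕ) : ℤ)))
    {x : PBWTree} {n : ℤ} (h : isHomogeneous wt x n = true) :
    UniversalEnvelopingAlgebra.ι ℂ a • eval k x = (z * n : ℂ) • eval k x := by
  induction x generalizing n with
  | const c =>
    rw [eval, smul_comm, hvac, smul_zero]
    rcases isHomogeneous_const.mp h with rfl | rfl <;> simp
  | node g t s it is =>
    obtain ⟨h1, h2⟩ := isHomogeneous_node.mp h
    rw [eval, smul_add, smul_add, is h2, generator, ι_smul_comm, hgen, it h1, map_smul, smul_assoc,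
      smul_comm _ (_ : ℂ), ← add_smul]
    congr 2
    push_cast
    ring

/-- The degree is an integer here, so that removing the degree of a generator is never truncated. -/
theorem eval_mem_span_word (k : ℂ) {x : PBWTree} {n : ℤ}
    (h : isHomogeneous (fun g => ((g / 28 + 1 : ℕ) : ℤ)) x n = true) :
    eval k x ∈ Submodule.span ℂ {w | ∃ l : List (D4 × ℕ), (∀ p ∈ l, 1 ≤ p.2) ∧
      ((l.map Prod.snd).sum : ℤ) = n ∧ w = word k l} := by
  induction x generalizing n with
  | const c =>
    rw [eval]
    rcases isHomogeneous_const.mp h with rfl | rfl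
    · simp
    · exact Submodule.smul_mem _ _ (Submodule.subset_span ⟨[], by simp, by simp, by simp [word]⟩)
  | node g t s it is =>
    obtain ⟨h1, h2⟩ := isHomogeneous_node.mp h
    rw [eval]
    refine add_mem ?_ (is h2)
    have h3 := it h1
    -- Left multiplication by the generator is linear, so it suffices to treat single words, to
    -- which the generator is prepended.
    generalize eval k t = w at h3
    induction h3 using Submodule.span_induction with
    | mem w hw =>
      obtain ⟨l, hl, hn, rfl⟩ := hw
      refine Submodule.subset_span ⟨(basisAt g, g / 28 + 1) :: l, ?_, ?_, ?_⟩
      · intro p hp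
        rcases List.mem_cons.mp hp with rfl | hp
        · exact Nat.succ_pos _
        · exact hl p hp
      · rw [List.map_cons, List.sum_cons, Nat.cast_add, hn]
        ring
      · rw [word, word, List.map_cons, List.prod_cons, mul_smul]
        rfl
    | zero => simp
    | add u w _ _ hu hw => rw [smul_add]; exact add_mem hu hw
    | smul c w _ hw => rw [smul_comm]; exact Submodule.smul_mem _ _ hw

/-! ### Evaluation at `t = 1` -/

theorem lazyMul_eq (a b : ℤ) : lazyMul a b = a * b := by
  rcases a with (_ | n) | n
  · exact (zero_mul b).symm
  · rfl
  · rfl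

theorem matrixEntry_node (p g : ℕ) (t s : PBWTree) (q : ℕ) : matrixEntry p (node g t s) q =
    ∑ r : Fin 8, entry (g % 28) q r * matrixEntry p t r + matrixEntry p s q := by
  have h : ∀ l : List ℕ, (List.rec (matrixEntry p s q)
      (fun r _ ih => lazyMul (entry (g % 28) q r) (matrixEntry p t r) + ih) l : ℤ) =
      (l.map fun r => entry (g % 28) q r * matrixEntry p t r).sum + matrixEntry p s q := by
    intro l
    induction l with
    | nil => simp
    | cons r l ih => rw [List.map_cons, List.sum_cons, add_assoc, ← ih, ← lazyMul_eq]
  refine (h (List.range 8)).trans ?_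
  congr 1

/-- Left multiplication acts on each column separately, so a single column p can be followed while
the row q varies in the induction. -/
theorem matrixMap_eval (k : ℂ) (x : PBWTree) (q p : Fin 8) :
    matrixMap k (eval k x) (vectorIndex q) (vectorIndex p) = (matrixEntry p x q : ℂ) := by
  induction x generalizing q with
  | const c =>
    change _ = (((Bool.rec 0 c (Nat.beq q p) : ℤ)) : ℂ)
    rw [eval, map_smul, matrixMap_vac, Matrix.smul_apply, Matrix.one_apply, smul_eq_mul]
    cases h : Nat.beq q p
    · have : q ≠ p := fun h' => Nat.ne_of_beq_eq_false h (congrArg Fin.val h')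
      simp [this]
    · have : q = p := Fin.ext (Nat.eq_of_beq_eq_true h)
      simp [this]
  | node g t s it is =>
    rw [eval, map_add, generator, matrixMap_smul k _ (by push_cast; omega), Matrix.add_apply, is,
      Matrix.mul_apply, ← Equiv.sum_comp vectorIndex, matrixEntry_node, ← basisAt_mod]
    simp only [it, toMatrix_basisAt (Nat.mod_lt g (show 28 > 0 by norm_num))]
    push_cast
    rfl

end PBWTree

/-! ### Singular vectors -/

/-- The elements of `𝔤̂` that annihilate a vector. -/
def annihilator {k : ℂ} (v : V k) : LieSubalgebra ℂ AffineLie where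
  carrier := {a | act a v = 0}
  zero_mem' := by simp [act]
  add_mem' := fun {a b} (ha : act a v = 0) (hb : act b v = 0) => by
    change UniversalEnvelopingAlgebra.ι ℂ (a + b) • v = 0
    rw [map_add, add_smul]
    exact (congrArg₂ (· + ·) ha hb).trans (add_zero 0)
  smul_mem' := fun c a (ha : act a v = 0) => by
    change UniversalEnvelopingAlgebra.ι ℂ (c • a) • v = 0
    rw [map_smul, smul_assoc]
    exact (congrArg (c • ·) ha).trans (smul_zero c)
  lie_mem' := fun {a b} (ha : act a v = 0) (hb : act b v = 0) => by
    change UniversalEnvelopingAlgebra.ι ℂ ⁅a, b⁆ • v = 0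
    rw [act] at ha hb
    have h := ι_smul_comm a b v
    rwa [ha, hb, smul_zero, smul_zero, zero_add, eq_comm] at h

theorem mem_annihilator {k : ℂ} {v : V k} {a : AffineLie} : a ∈ annihilator v ↔ act a v = 0 :=
  Iff.rfl

/-- The condition on m and n excludes a central term. This is essential for annihilators, because K
acts by the level and not by 0. -/
theorem mode_mem_of_bracket {S : LieSubalgebra ℂ AffineLie} {a b i : ℕ} {c : ℤ} (ha : a < 28)
    (hb : b < 28) (hc : c ≠ 0) (h : bracketTerms a b = [(i, c)]) {m n : ℤ}
    (hmn : m + n ≠ 0 ∨ m = 0) (h1 : mode (basisAt a) m ∈ S) (h2 : mode (basisAt b) n ∈ S) :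
    mode (basisAt i) (m + n) ∈ S := by
  have h0 : (if m + n = 0 then (m : ℂ) * form (basisAt a) (basisAt b) else 0) = 0 := by
    rcases hmn with h | rfl
    · rw [if_neg h]
    · simp
  have h3 := S.lie_mem h1 h2
  rw [mode_lie, h0, zero_smul, add_zero, basisAt_lie ha hb, h] at h3
  simp only [List.map_cons, List.map_nil, List.sum_cons, List.sum_nil, add_zero, mode_smul] at h3
  have h4 := S.smul_mem (c : ℂ)⁻¹ h3
  rwa [smul_smul, inv_mul_cancel₀ (Int.cast_ne_zero.mpr hc), one_smul] at h4

/-- A set of ranks that is closed under brackets with the simple root vectors, which have the ranks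
`0`, `6`, `10` and `11`. -/
def IsRaisingClosed (P : ℕ → Prop) : Prop :=
  ∀ a b i c, a ∈ [0, 6, 10, 11] → b < 28 → c ≠ 0 → bracketTerms a b = [(i, c)] → P b → P i

/-- The simple root vectors generate `𝔫₊`. -/
theorem IsRaisingClosed.positive {P : ℕ → Prop} (hP : IsRaisingClosed P) (h0 : P 0) (h6 : P 6)
    (h10 : P 10) (h11 : P 11) {i : ℕ} (hi : i < 12) : P i := by
  have step : ∀ a b i c, a ∈ [0, 6, 10, 11] → b < 28 ∧ c ≠ 0 → bracketTerms a b = [(i, c)] →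
    P b → P i := fun a b i c ha h => hP a b i c ha h.1 h.2
  have h2 := step 0 6 2 1 (by simp) (by norm_num) (by decide +kernel) h6
  have h8 := step 6 10 8 1 (by simp) (by norm_num) (by decide +kernel) h10
  have h9 := step 6 11 9 1 (by simp) (by norm_num) (by decide +kernel) h11
  have h4 := step 10 2 4 (-1) (by simp) (by norm_num) (by decide +kernel) h2
  have h7 := step 10 9 7 1 (by simp) (by norm_num) (by decide +kernel) h9
  have h5 := step 11 2 5 (-1) (by simp) (by norm_num) (by decide +kernel) h2
  have h3 := step 11 4 3 1 (by simp) (by norm_num) (by decide +kernel) h4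
  have h1 := step 6 3 1 1 (by simp) (by norm_num) (by decide +kernel) h3
  interval_cases i <;> assumption

/-- The lowest root vector `f_θ`, which has rank `18`, generates `𝔤` under the action of the simple root vectors. -/
theorem IsRaisingClosed.all {P : ℕ → Prop} (hP : IsRaisingClosed P) (h18 : P 18) {i : ℕ}
    (hi : i < 28) : P i := by
  have step : ∀ a b i c, a ∈ [0, 6, 10, 11] → b < 28 ∧ c ≠ 0 → bracketTerms a b = [(i, c)] →
    P b → P i := fun a b i c ha h => hP a b i c ha h.1 h.2
  -- The climb from f_θ passes through all negative root vectors, which have the ranks 16 to 27.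
  have h20 := step 6 18 20 (-1) (by simp) (by norm_num) (by decide +kernel) h18
  have h22 := step 10 20 22 (-1) (by simp) (by norm_num) (by decide +kernel) h20
  have h21 := step 11 20 21 (-1) (by simp) (by norm_num) (by decide +kernel) h20
  have h19 := step 11 22 19 1 (by simp) (by norm_num) (by decide +kernel) h22
  have h24 := step 0 20 24 (-1) (by simp) (by norm_num) (by decide +kernel) h20
  have h26 := step 0 22 26 (-1) (by simp) (by norm_num) (by decide +kernel) h22
  have h25 := step 0 21 25 (-1) (by simp) (by norm_num) (by decide +kernel) h21
  have h23 := step 0 19 23 (-1) (by simp) (by norm_num) (by decide +kernel) h19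
  have h17 := step 6 19 17 1 (by simp) (by norm_num) (by decide +kernel) h19
  have h16 := step 6 26 16 (-1) (by simp) (by norm_num) (by decide +kernel) h26
  have h27 := step 6 25 27 (-1) (by simp) (by norm_num) (by decide +kernel) h25
  -- Rank 23 is f for ε_2 - ε_3, so this is h_2 = [e_2, f_2]. The other coroots arise in the same
  -- way from the other negative simple root vectors.
  have h13 := step 6 23 13 1 (by simp) (by norm_num) (by decide +kernel) h23
  have h14 := step 10 27 14 1 (by simp) (by norm_num) (by decide +kernel) h27
  -- The second node is joined to the other three nodes of the Dynkin diagram, so [e_i, h_2] =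
  -- -α_i(h_2) e_i is non-zero for every i and h_2 alone yields all simple root vectors.
  have h10 := step 10 13 10 1 (by simp) (by norm_num) (by decide +kernel) h13
  have h15 := step 11 16 15 1 (by simp) (by norm_num) (by decide +kernel) h16
  have h11 := step 11 13 11 1 (by simp) (by norm_num) (by decide +kernel) h13
  have h12 := step 0 17 12 1 (by simp) (by norm_num) (by decide +kernel) h17
  have h0 := step 0 13 0 1 (by simp) (by norm_num) (by decide +kernel) h13
  have h6 := step 6 13 6 (-2) (by simp) (by norm_num) (by decide +kernel) h13
  have h8 := step 6 10 8 1 (by simp) (by norm_num) (by decide +kernel) h10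
  have h9 := step 6 11 9 1 (by simp) (by norm_num) (by decide +kernel) h11
  have h2 := step 6 0 2 (-1) (by simp) (by norm_num) (by decide +kernel) h0
  have h7 := step 10 9 7 1 (by simp) (by norm_num) (by decide +kernel) h9
  have h4 := step 10 2 4 (-1) (by simp) (by norm_num) (by decide +kernel) h2
  have h5 := step 11 2 5 (-1) (by simp) (by norm_num) (by decide +kernel) h2
  have h3 := step 11 4 3 1 (by simp) (by norm_num) (by decide +kernel) h4
  have h1 := step 6 3 1 1 (by simp) (by norm_num) (by decide +kernel) h3
  interval_cases i <;> assumption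

/-! ### Generation of 𝔫₊ ⊕ 𝔤 ⊗ tℂ[t] by the simple root vectors and f_θ(1) -/

section Generation

variable {S : LieSubalgebra ℂ AffineLie} (h0 : mode (basisAt 0) 0 ∈ S)
  (h6 : mode (basisAt 6) 0 ∈ S) (h10 : mode (basisAt 10) 0 ∈ S) (h11 : mode (basisAt 11) 0 ∈ S)

include h0 h6 h10 h11 in
-- A bracket with x(0) preserves the mode, and its central term carries the factor 0, so every n can
-- be treated alike, including n = 0.
theorem isRaisingClosed_mode (n : ℤ) : IsRaisingClosed fun i => mode (basisAt i) n ∈ S := by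
  intro a b i c ha hb hc h hmem
  have h1 : a < 28 ∧ mode (basisAt a) 0 ∈ S := by
    simp only [List.mem_cons, List.not_mem_nil, or_false] at ha
    rcases ha with rfl | rfl | rfl | rfl
    · exact ⟨by norm_num, h0⟩
    · exact ⟨by norm_num, h6⟩
    · exact ⟨by norm_num, h10⟩
    · exact ⟨by norm_num, h11⟩
  have h2 := mode_mem_of_bracket h1.1 hb hc h (.inr rfl) h1.2 hmem
  rwa [zero_add] at h2

include h0 h6 h10 h11 in
theorem mode_zero_mem_of_nPos {x : D4} (hx : x ∈ nPos) : mode x 0 ∈ S := by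
  have h : nPos ≤ S.toSubmodule.comap (modeₗ 0) := by
    rw [nPos, Submodule.span_le]
    rintro _ ⟨α, rfl⟩
    obtain ⟨a, ha⟩ := basisIndex_bijective.2 (.inl α)
    -- The positive root vectors occupy exactly the ranks below 12.
    have h12 : a.val < 12 := by
      by_contra hc
      rw [basisIndex, dif_neg hc] at ha
      split_ifs at ha
    have h := (isRaisingClosed_mode h0 h6 h10 h11 0).positive h0 h6 h10 h11 h12
    rw [basisAt] at h
    simp only [Nat.mod_eq_of_lt a.2, ha] at h
    exact h
  exact h hx

include h0 h6 h10 h11 in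
-- In each mode it is enough to have f_θ, because the simple root vectors raise it to all of 𝔤. The
-- next mode is reached by [h_2(1), f_θ(n+1)] = -θ(h_2) f_θ(n+2), with θ(h_2) = 1.
theorem mode_basisAt_mem_of_pos (h18 : mode (basisAt 18) 1 ∈ S) (n : ℕ) {i : ℕ} (hi : i < 28) :
    mode (basisAt i) ((n : ℤ) + 1) ∈ S := by
  have hall := fun n : ℤ => isRaisingClosed_mode h0 h6 h10 h11 n
  induction n generalizing i with
  | zero => exact (hall _).all (by simpa using h18) hi
  | succ n ih =>
    refine (hall _).all ?_ hi
    have h13 : mode (basisAt 13) 1 ∈ S := (hall 1).all h18 (by norm_num)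
    have h := mode_mem_of_bracket (a := 13) (b := 18) (i := 18) (c := -1) (by norm_num)
      (by norm_num) (by norm_num) (by decide +kernel) (.inl (by omega)) h13 (ih (by norm_num))
    rwa [show (1 : ℤ) + ((n : ℤ) + 1) = ((n + 1 : ℕ) : ℤ) + 1 by push_cast; ring] at h

end Generation

/-! ### The basis spans `D₄` -/

theorem toMatrix_swap_swap (x : D4) (p q : Fin 4 ⊕ Fin 4) :
    toMatrix x q.swap p.swap = -toMatrix x p q := by
  have hx : x.1 ∈ skewAdjointMatricesLieSubalgebra (LieAlgebra.Orthogonal.JD (Fin 4) ℂ) := x.2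
  rw [mem_skewAdjointMatricesLieSubalgebra, mem_skewAdjointMatricesSubmodule] at hx
  have hJ : LieAlgebra.Orthogonal.JD (Fin 4) ℂ =
      Matrix.of fun a b => if b = a.swap then 1 else 0 := by
    ext a b
    rcases a with a | a <;> rcases b with b | b <;>
      simp [LieAlgebra.Orthogonal.JD, Matrix.one_apply, eq_comm]
  have h := congrFun (congrFun hx p.swap) q
  have h2 : ∀ x y : Fin 4 ⊕ Fin 4, y = x.swap ↔ x = y.swap := by decide
  simp only [hJ, Matrix.mul_apply, Matrix.transpose_apply, Matrix.of_apply, Matrix.neg_apply,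
    mul_ite, ite_mul, mul_one, one_mul, zero_mul, mul_zero, Sum.swap_swap, h2 _ q,
    Finset.sum_ite_eq', Finset.mem_univ, if_true] at h
  exact h

/-- Skew-adjointness gives x_{q*,p*} = -x_{p,q}, so in the sum each matrix unit is counted once from
each of its two descriptions; hence the factor 1/2. -/
theorem eq_sum_elem (x : D4) : x = (1 / 2 : ℂ) • ∑ p, ∑ q, toMatrix x p q • elem p q := by
  apply toMatrix_injective
  ext a b
  have h2 : ∀ x y : Fin 4 ⊕ Fin 4, x.swap = y ↔ x = y.swap := by decide
  simp only [map_smul, map_sum, Matrix.smul_apply, Matrix.sum_apply, toMatrix_elem,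
    Matrix.sub_apply, Matrix.single_apply, smul_eq_mul, mul_sub, Finset.sum_sub_distrib, h2,
    mul_ite, mul_one, mul_zero, ite_and]
  simp [toMatrix_swap_swap]
  ring

theorem elem_swap_swap (p q : Fin 4 ⊕ Fin 4) : elem q.swap p.swap = -elem p q := by
  apply toMatrix_injective
  rw [map_neg, toMatrix_elem, toMatrix_elem, Sum.swap_swap, Sum.swap_swap, neg_sub]

theorem elem_mem_span (p q : Fin 4 ⊕ Fin 4) :
    elem p q ∈ Submodule.span ℂ (Set.range basisVec) := by
  set W := Submodule.span ℂ (Set.range basisVec)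
  have hb : ∀ b, basisVec b ∈ W := fun b => Submodule.subset_span ⟨b, rfl⟩
  have hH : ∀ i, H i ∈ W := by
    have hc : ∀ i, coroot i ∈ W := fun i => hb (.inr (.inl i))
    -- The sum h_3 + h_4 of the last two coroots is twice H_3 (index 2); the other H_i then follow
    -- by adding or subtracting coroots.
    have h2 : H 2 ∈ W := by
      have : H 2 = (1 / 2 : ℂ) • (coroot 2 + coroot 3) := by
        change H 2 = (1 / 2 : ℂ) • ((H 2 - H 3) + (H 2 + H 3))
        module
      rw [this]
      exact W.smul_mem _ (add_mem (hc 2) (hc 3))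
    have h3 : H 3 ∈ W := by
      have : H 3 = H 2 - coroot 2 := by change H 3 = H 2 - (H 2 - H 3); abel
      rw [this]
      exact sub_mem h2 (hc 2)
    have h1 : H 1 ∈ W := by
      have : H 1 = coroot 1 + H 2 := by change H 1 = (H 1 - H 2) + H 2; abel
      rw [this]
      exact add_mem (hc 1) h2
    have h0 : H 0 ∈ W := by
      have : H 0 = coroot 0 + H 1 := by change H 0 = (H 0 - H 1) + H 1; abel
      rw [this]
      exact add_mem (hc 0) h1
    intro i
    fin_cases i
    exacts [h0, h1, h2, h3]
  have hll : ∀ i j : Fin 4, elem (.inl i) (.inl j) ∈ W := by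
    intro i j
    rcases lt_trichotomy i j with h | rfl | h
    · exact hb (.inl (⟨(i, j), h⟩, false))
    · exact hH i
    · exact hb (.inr (.inr (⟨(j, i), h⟩, false)))
  rcases p with i | i <;> rcases q with j | j
  · exact hll i j
  · rcases lt_trichotomy i j with h | rfl | h
    · exact hb (.inl (⟨(i, j), h⟩, true))
    · have : elem (.inl i) (.inr i) = 0 := by
        apply toMatrix_injective
        rw [map_zero, toMatrix_elem]
        exact sub_self _
      rw [this]
      exact zero_mem _
    · rw [← neg_neg (elem _ _), ← elem_swap_swap]
      exact neg_mem (hb (.inl (⟨(j, i), h⟩, true)))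
  · rcases lt_trichotomy i j with h | rfl | h
    · rw [← neg_neg (elem _ _), ← elem_swap_swap]
      exact neg_mem (hb (.inr (.inr (⟨(i, j), h⟩, true))))
    · have : elem (.inr i) (.inl i) = 0 := by
        apply toMatrix_injective
        rw [map_zero, toMatrix_elem]
        exact sub_self _
      rw [this]
      exact zero_mem _
    · exact hb (.inr (.inr (⟨(j, i), h⟩, true)))
  · rw [← neg_neg (elem _ _), ← elem_swap_swap]
    exact neg_mem (hll j i)

theorem span_range_basisVec : Submodule.span ℂ (Set.range basisVec) = ⊤ := by
  rw [eq_top_iff]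
  intro x _
  rw [eq_sum_elem x]
  exact Submodule.smul_mem _ _ (sum_mem fun p _ => sum_mem fun q _ =>
    Submodule.smul_mem _ _ (elem_mem_span p q))

theorem mode_mem_of_basisAt {S : LieSubalgebra ℂ AffineLie} {n : ℤ}
    (h : ∀ i < 28, mode (basisAt i) n ∈ S) (x : D4) : mode x n ∈ S := by
  have h1 : Submodule.span ℂ (Set.range basisVec) ≤ S.toSubmodule.comap (modeₗ n) := by
    rw [Submodule.span_le]
    rintro _ ⟨b, rfl⟩
    obtain ⟨a, ha, hab⟩ := basisAt_surjective b
    rw [← hab]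
    exact h a ha
  rw [span_range_basisVec] at h1
  exact h1 (Submodule.mem_top (x := x))

/-- A non-zero vector is singular if it is annihilated by the simple root vectors and by
`f_θ(1)`. -/
theorem isSingular_of_simple {k : ℂ} {v : V k} (hv : v ≠ 0) (h0 : act (mode (basisAt 0) 0) v = 0)
    (h6 : act (mode (basisAt 6) 0) v = 0) (h10 : act (mode (basisAt 10) 0) v = 0)
    (h11 : act (mode (basisAt 11) 0) v = 0) (h18 : act (mode (basisAt 18) 1) v = 0) :
    IsSingular v := by
  rw [← mem_annihilator] at h0 h6 h10 h11 h18
  refine ⟨hv, fun x hx => mode_zero_mem_of_nPos h0 h6 h10 h11 hx, fun x n hn => ?_⟩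
  obtain ⟨m, rfl⟩ : ∃ m : ℕ, n = (m : ℤ) + 1 := ⟨(n - 1).toNat, by omega⟩
  exact mem_annihilator.mp (mode_mem_of_basisAt
    (fun i hi => mode_basisAt_mem_of_pos h0 h6 h10 h11 h18 m hi) x)

/-! ### The theorem -/

theorem isSingular_singularTree : IsSingular (singularTree.eval (-14 / 3)) := by
  have hz := isZero_actZero_singularTree
  simp only [Bool.and_eq_true] at hz
  obtain ⟨⟨⟨z0, z6⟩, z10⟩, z11⟩ := hz
  have hact : ∀ b < 28, (singularTree.actZero b).isZero = true →
      act (mode (basisAt b) 0) (singularTree.eval (-14 / 3)) = 0 := fun b hb hz =>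
    (PBWTree.eval_actZero _ _ hb).symm.trans (PBWTree.eval_eq_zero_of_isZero _ hz)
  refine isSingular_of_simple ?_ (hact 0 (by norm_num) z0) (hact 6 (by norm_num) z6)
    (hact 10 (by norm_num) z10) (hact 11 (by norm_num) z11) ?_
  · intro h
    -- Row a_1 and column a_1^*: this entry of the image of v was computed to be non-zero.
    have h1 := PBWTree.matrixMap_eval (-14 / 3) singularTree 0 4
    rw [h, map_zero, Matrix.zero_apply] at h1
    change (0 : ℂ) = (PBWTree.matrixEntry 4 singularTree 0 : ℂ) at h1
    rw [matrixEntry_singularTree] at h1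
    norm_num at h1
  · have h := PBWTree.eval_eq_zero_of_isZero (-14 / 3) isZero_actOne_singularTree
    rw [PBWTree.eval_add, PBWTree.eval_smul, PBWTree.eval_smul] at h
    refine (PBWTree.eval_actOne _ _).symm.trans ?_
    -- Clearing the denominator of the level turns f_θ(1) v = 0 into the integral identity that was
    -- checked.
    have h3 : (3 : ℂ) • (PBWTree.eval (-14 / 3) (PBWTree.actOne 18 singularTree) +
        (-14 / 3 : ℂ) • PBWTree.eval (-14 / 3) (PBWTree.deriv 1 singularTree)) = 0 := by
      rw [← h, smul_add, smul_smul]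
      push_cast
      norm_num
    exact (smul_eq_zero.mp h3).resolve_left (by norm_num)

theorem d_lie_generator (g : ℕ) : ⁅d, mode (basisAt g) (-((g / 28 + 1 : ℕ) : ℤ))⁆ =
    ((-1 : ℂ) * (((g / 28 + 1 : ℕ) : ℤ) : ℂ)) • mode (basisAt g) (-((g / 28 + 1 : ℕ) : ℤ)) := by
  rw [d_lie]
  congr 1
  push_cast
  ring

theorem H_lie_generator (i : Fin 4) (g : ℕ) :
    ⁅mode (H i) 0, mode (basisAt g) (-((g / 28 + 1 : ℕ) : ℤ))⁆ =
      ((1 : ℂ) * (weightAt i (g % 28) : ℂ)) •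
        mode (basisAt g) (-((g / 28 + 1 : ℕ) : ℤ)) := by
  rw [mode_lie, if_neg (by push_cast; omega), zero_smul, add_zero, zero_add, ← basisAt_mod,
    H_lie_basisAt i (Nat.mod_lt _ (by norm_num)), mode_smul, one_mul]

theorem hasWeight_singularTree : HasWeight (singularTree.eval (-14 / 3))
    ((-14 / 3 : ℂ) • Λ₀ - (6 : ℂ) • δ + (2 : ℂ) • ω₁) := by
  set v := singularTree.eval (-14 / 3) with hv
  set wt : Module.Dual ℂ AffineLie := (-14 / 3 : ℂ) • Λ₀ - (6 : ℂ) • δ + (2 : ℂ) • ω₁ with hwt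
  have hωH : ∀ i, ω₁ (mode (H i) 0) = if i = 0 then 1 else 0 := by
    intro i
    change toMatrix (coeffs (loop 0 (H i)) 0) (.inl 0) (.inl 0) = _
    simp [coeffs_loop, H, toMatrix_elem, Matrix.single_apply]
  have hH : ∀ i, act (mode (H i) 0) v = wt (mode (H i) 0) • v := by
    intro i
    have h := PBWTree.smul_eval_of_isHomogeneous (k := -14 / 3) (nonneg_smul_vac (H i) 0)
      (H_lie_generator i) (isHomogeneous_weight_singularTree i)
    have hw : wt (mode (H i) 0) = 2 * if i = 0 then 1 else 0 := by
      rw [← hωH]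
      change (-14 / 3 : ℂ) * 0 - 6 * 0 + 2 * ω₁ (mode (H i) 0) = _
      ring
    rw [hw]
    refine h.trans ?_
    congr 1
    split_ifs <;> simp
  have hK : act K v = wt K • v := by
    refine (K_smul v).trans ?_
    congr 1
    have : ω₁ K = 0 := by
      change toMatrix (coeffs (0 : Loop) 0) (.inl 0) (.inl 0) = 0
      simp
    change _ = (-14 / 3 : ℂ) * 1 - 6 * 0 + 2 * ω₁ K
    rw [this]
    ring
  have hd : act d v = wt d • v := by
    -- The factor z is -1 here: degrees of trees are counted positively, while d has eigenvalue -n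
    -- on x(-n).
    refine (PBWTree.smul_eval_of_isHomogeneous (k := -14 / 3) d_smul_vac d_lie_generator
      isHomogeneous_degree_singularTree).trans ?_
    congr 1
    have : ω₁ d = 0 := by
      change toMatrix (coeffs (0 : Loop) 0) (.inl 0) (.inl 0) = 0
      simp
    change _ = (-14 / 3 : ℂ) * 0 - 6 * 1 + 2 * ω₁ d
    rw [this]
    push_cast
    ring
  -- The eigenvalue equation is linear in the element of 𝔥̂, so it passes from the H_i, K and d to
  -- their span.
  have hadd : ∀ a b, act a v = wt a • v → act b v = wt b • v → act (a + b) v = wt (a + b) • v := by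
    intro a b ha hb
    rw [act] at ha hb ⊢
    rw [map_add, add_smul, ha, hb, map_add, add_smul]
  have hsmul : ∀ (c : ℂ) a, act a v = wt a • v → act (c • a) v = wt (c • a) • v := by
    intro c a ha
    rw [act] at ha ⊢
    rw [map_smul, smul_assoc, ha, map_smul, smul_assoc]
  have hzero : act 0 v = wt 0 • v := by simp [act]
  intro a ha
  induction ha using Submodule.span_induction with
  | mem a ha =>
    rcases ha with ⟨h, hh, rfl⟩ | rfl | rfl
    · induction hh using Submodule.span_induction with
      | mem h hh => obtain ⟨i, rfl⟩ := hh; exact hH i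
      | zero =>
        have : mode 0 0 = 0 := map_zero (modeₗ 0)
        rw [this]
        exact hzero
      | add x y _ _ hx hy => rw [mode_add]; exact hadd _ _ hx hy
      | smul c x _ hx => rw [mode_smul]; exact hsmul _ _ hx
    · exact hK
    · exact hd
  | zero => exact hzero
  | add x y _ _ hx hy => exact hadd _ _ hx hy
  | smul c x _ hx => exact hsmul _ _ hx

theorem hasConformalWeight_singularTree :
    HasConformalWeight (singularTree.eval (-14 / 3)) 6 := by
  have h := PBWTree.eval_mem_span_word (-14 / 3) isHomogeneous_degree_singularTree
  refine Submodule.span_mono ?_ h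
  rintro w ⟨l, h1, h2, h3⟩
  exact ⟨l, h1, by exact_mod_cast h2, h3⟩

theorem hasPBWExpansion_singularTree :
    HasPBWExpansion genOrder (singularTree.eval (-14 / 3)) 6753 :=
  ⟨singularTree.coefficients,
    (PBWTree.card_support_coefficients isSorted_singularTree).trans leafCount_singularTree,
    (PBWTree.eval_eq_linearCombination _ isSorted_singularTree).trans
      (Finsupp.linearCombination_apply ℂ _)⟩

end AffineD4
end

theorem theorem3p1 :
    ∃ v : AffineD4.V (-14 / 3),
      AffineD4.IsSingular v ∧
      AffineD4.HasWeight v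
        ((-14 / 3 : ℂ) • AffineD4.AffineLie.Λ₀ - (6 : ℂ) • AffineD4.AffineLie.δ
          + (2 : ℂ) • AffineD4.AffineLie.ω₁) ∧
      AffineD4.HasConformalWeight v 6 ∧
      ∃ r : LinearOrder AffineD4.Gen, AffineD4.HasPBWExpansion r v 6753 :=
  ⟨_, AffineD4.isSingular_singularTree, AffineD4.hasWeight_singularTree,
    AffineD4.hasConformalWeight_singularTree, _, AffineD4.hasPBWExpansion_singularTree⟩
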